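/- **Proposition 5.2.** Let $T=(S^1)^k$ be a compact torus acting smoothly on a closed connected smooth manifold $M$ of dimension $2m$ with finite fixed point set $M^T=\{p_1,\dots,p_n\}$. Let $ET\to BT$ be a universal principal $T$-bundle, $H_T^*(M;R)=H^*(ET\times_T M;R)$, and let $u_1,\dots,u_k\in H^2(BT;\mathbb Z)$ be the transgressions in $T\to ET\to BT$ of the standard generators of $H^1(T;\mathbb Z)$. A character $t\mapsto\prod_l t_l^{a_l}$ of $T$, $a\in\mathbb Z^k$, is identified with the element $\sum_l a_lu_l\in H^2(BT;\mathbb Z)$ (with the sign convention in which this is the first Chern class of the associated line bundle $ET\times_T\mathbb C_a\to BT$). The total equivariant Pontrjagin, Stiefel–Whitney and (if $M$ carries a $T$-invariant almost complex structure) Chern classes of $M$ are the total characteristic classes of the vector bundle $ET\times_T TM\to ET\times_T M$. For each $i$ let $\pm\alpha_{i1},\dots,\pm\alpha_{im}\in H^2(BT;\mathbb Z)$ be the weights, each determined up to sign, of the isotropy representation of $T$ on $T_{p_i}M$. Then: 1. the restriction of the total equivariant Pontrjagin class of $M$ to $H^*_T(M^T;\mathbb Z)=\bigoplus_{i=1}^n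 H^*(BT;\mathbb Z)$ is $$\sum_{i=1}^n\prod_{j=1}^m(1+\alpha_{ij}^2);$$ 2. the restriction of the total equivariant Stiefel–Whitney class of $M$ to $H^*_T(M^T;\mathbb Z_2)=\bigoplus_{i=1}^n H^*(BT;\mathbb Z_2)$ is $$\sum_{i=1}^n\prod_{j=1}^m(1\pm\alpha_{ij}),$$ where $\alpha_{ij}$ is reduced modulo $2$ and the signs are arbitrary; 3. if $M$ carries a $T$-invariant almost complex structure, then the signs of the $\alpha_{ij}$ are uniquely determined by it: for each $i$ there are signs for which $\alpha_{i1},\dots,\alpha_{im}$ are the weights of the complex representation $T_{p_i}M$, and the family of these weights is unique up to order. With these signs the restriction of the total equivariant Chern class of $M$ to $H^*_T(M^T;\mathbb Z)$ is $$\sum_{i=1}^n\prod_{j=1}^m(1+\alpha_{ij}).$$ -/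

import Mathlib

open scoped Manifold ContDiff Topology

noncomputable section

namespace EquivClass

/-! ### Singular cochains -/

/-- Singular `n`-simplices of `X`: continuous maps from the standard `n`-simplex. -/
abbrev Simp (n : ℕ) (X : Type*) [TopologicalSpace X] := C(stdSimplex ℝ (Fin (n + 1)), X)

/-- The vertex `min j n` of the standard `n`-simplex. -/
def clamp (n j : ℕ) : Fin (n + 1) := ⟨min j n, Nat.lt_succ_of_le (min_le_right j n)⟩

namespace Simp

variable {X : Type*} [TopologicalSpace X] {n : ℕ}

/-- Precomposition of a simplex with the affine map given by a map of vertices. -/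
def pull {m : ℕ} (σ : Simp n X) (f : Fin (m + 1) → Fin (n + 1)) : Simp m X :=
  σ.comp ⟨stdSimplex.map f, stdSimplex.continuous_map f⟩

/-- For `s + k ≤ n`, the `k`-dimensional face of `σ` with vertices `s, s + 1, …, s + k`. In
particular `σ.sub i 0` is the front `i`-face and `σ.sub (n - i) i` the back `(n - i)`-face. -/
def sub (σ : Simp n X) (k s : ℕ) : Simp k X := σ.pull fun j => clamp n (s + j)

/-- The `i`-th face of an `(n + 1)`-simplex (omitting the vertex `i`), for `i ≤ n + 1`. -/
def face (σ : Simp (n + 1) X) (i : ℕ) : Simp n X :=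
  σ.pull fun j => clamp (n + 1) (if (j : ℕ) < i then j else j + 1)

lemma pull_pull {m l : ℕ} (σ : Simp n X) (f : Fin (m + 1) → Fin (n + 1))
    (g : Fin (l + 1) → Fin (m + 1)) : (σ.pull f).pull g = σ.pull (f ∘ g) := by
  ext x
  simp only [pull, ContinuousMap.comp_apply, ContinuousMap.coe_mk]
  rw [stdSimplex.map_comp_apply]

lemma pull_congr {m : ℕ} (σ : Simp n X) {f g : Fin (m + 1) → Fin (n + 1)}
    (h : ∀ j, (f j : ℕ) = g j) : σ.pull f = σ.pull g := by
  congr 1; funext j; exact Fin.ext (h j)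

lemma sub_self (σ : Simp n X) : σ.sub n 0 = σ := by
  have : σ.sub n 0 = σ.pull id := pull_congr σ fun j => by simp [clamp]; omega
  rw [this]; ext x; simp [pull, stdSimplex.map_id_apply]

lemma sub_sub (σ : Simp n X) {k s k' s' : ℕ} (h' : s' + k' ≤ k) :
    (σ.sub k s).sub k' s' = σ.sub k' (s + s') := by
  rw [sub, sub, pull_pull]
  refine pull_congr σ fun j => ?_
  have := j.2
  simp only [Function.comp, clamp]; omega

lemma face_sub_front (σ : Simp (n + 1) X) {i j : ℕ} (hij : i ≤ j) (hj : j ≤ n) :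
    (σ.face i).sub j 0 = (σ.sub (j + 1) 0).face i := by
  rw [sub, face, face, sub, pull_pull, pull_pull]
  refine pull_congr σ fun l => ?_
  have := l.2
  simp only [Function.comp, clamp]
  grind

lemma face_sub_back (σ : Simp (n + 1) X) {i j : ℕ} (hij : i ≤ j) (hj : j ≤ n) :
    (σ.face i).sub (n - j) j = σ.sub (n - j) (j + 1) := by
  rw [sub, face, sub, pull_pull]
  refine pull_congr σ fun l => ?_
  have := l.2
  simp only [Function.comp, clamp]
  grind

lemma face_sub_front' (σ : Simp (n + 1) X) {i j : ℕ} (hij : j < i) (hj : j ≤ n) :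
    (σ.face i).sub j 0 = σ.sub j 0 := by
  rw [sub, face, sub, pull_pull]
  refine pull_congr σ fun l => ?_
  have := l.2
  simp only [Function.comp, clamp]
  grind

lemma face_sub_back' (σ : Simp (n + 1) X) {i j : ℕ} (hj : j ≤ n) :
    (σ.face (j + (i + 1))).sub (n - j) j = (σ.sub (n - j + 1) j).face (i + 1) := by
  rw [sub, face, face, sub, pull_pull, pull_pull]
  refine pull_congr σ fun l => ?_
  have := l.2
  simp only [Function.comp, clamp]
  grind

lemma sub_face_last (σ : Simp (n + 1) X) {j : ℕ} (hj : j ≤ n) :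
    (σ.sub (j + 1) 0).face (j + 1) = σ.sub j 0 := by
  rw [sub, face, sub, pull_pull]
  refine pull_congr σ fun l => ?_
  have := l.2
  simp only [Function.comp, clamp]
  grind

lemma sub_face_zero (σ : Simp (n + 1) X) {j : ℕ} (hj : j ≤ n) :
    (σ.sub (n - j + 1) j).face 0 = σ.sub (n - j) (j + 1) := by
  rw [sub, face, sub, pull_pull]
  refine pull_congr σ fun l => ?_
  have := l.2
  simp only [Function.comp, clamp]
  grind

end Simp

/-- (Inhomogeneous) singular cochains of `X` with coefficients in `R`: a family of cochains,
one in each degree. -/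
def Cochain (R X : Type*) [TopologicalSpace X] := ∀ n, Simp n X → R

namespace Cochain

variable {R S X Y : Type*} [Ring R] [Ring S] [TopologicalSpace X] [TopologicalSpace Y]

instance : AddCommGroup (Cochain R X) := inferInstanceAs (AddCommGroup (∀ n, Simp n X → R))

@[ext] lemma ext {a b : Cochain R X} (h : ∀ n σ, a n σ = b n σ) : a = b :=
  funext fun n => funext fun σ => h n σ

@[simp] lemma add_apply (a b : Cochain R X) (n : ℕ) (σ : Simp n X) :
    (a + b) n σ = a n σ + b n σ := rfl
@[simp] lemma neg_apply (a : Cochain R X) (n : ℕ) (σ : Simp n X) : (-a) n σ = -a n σ := rfl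
@[simp] lemma sub_apply (a b : Cochain R X) (n : ℕ) (σ : Simp n X) :
    (a - b) n σ = a n σ - b n σ := rfl
@[simp] lemma zero_apply (n : ℕ) (σ : Simp n X) : (0 : Cochain R X) n σ = 0 := rfl

/-- The cochain concentrated in degree `d`. -/
def single (d : ℕ) (c : Simp d X → R) : Cochain R X :=
  Pi.single (M := fun n => Simp n X → R) d c

/-- The coboundary operator `(δ a)(σ) = ∑ (-1)^i a(dᵢ σ)`. -/
def deltaFun (a : Cochain R X) : Cochain R X
  | 0, _ => 0
  | n + 1, σ => ∑ i ∈ Finset.range (n + 2), (-1) ^ i * a n (σ.face i)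

/-- The coboundary operator, as an additive map. -/
def delta : Cochain R X →+ Cochain R X where
  toFun := deltaFun
  map_zero' := by ext n σ; cases n <;> simp [deltaFun]
  map_add' a b := by
    ext n σ
    cases n <;> simp [deltaFun, mul_add, Finset.sum_add_distrib]

@[simp] lemma delta_zero (a : Cochain R X) (σ : Simp 0 X) : delta a 0 σ = 0 := rfl
lemma delta_succ (a : Cochain R X) (n : ℕ) (σ : Simp (n + 1) X) :
    delta a (n + 1) σ = ∑ i ∈ Finset.range (n + 2), (-1) ^ i * a n (σ.face i) := rfl

/-- The cup product `(a ∪ b)(σ) = ∑ a(front i-face) b(back (n-i)-face)`. -/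
instance : Mul (Cochain R X) :=
  ⟨fun a b n σ => ∑ i ∈ Finset.range (n + 1), a i (σ.sub i 0) * b (n - i) (σ.sub (n - i) i)⟩

lemma mul_apply (a b : Cochain R X) (n : ℕ) (σ : Simp n X) : (a * b) n σ =
    ∑ i ∈ Finset.range (n + 1), a i (σ.sub i 0) * b (n - i) (σ.sub (n - i) i) := rfl

/-- The unit: the constant function `1` on `0`-simplices. -/
instance : One (Cochain R X) := ⟨single 0 fun _ => 1⟩

lemma one_zero (σ : Simp 0 X) : (1 : Cochain R X) 0 σ = 1 := rfl
lemma one_ne {n : ℕ} (h : n ≠ 0) (σ : Simp n X) : (1 : Cochain R X) n σ = 0 := by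
  change Pi.single (M := fun n => Simp n X → R) 0 (fun _ => (1 : R)) n σ = 0
  rw [Pi.single_eq_of_ne h]; rfl

protected lemma one_mul' (a : Cochain R X) : 1 * a = a := by
  ext n σ
  rw [mul_apply, Finset.sum_eq_single 0]
  · rw [one_zero, one_mul, Nat.sub_zero, Simp.sub_self]
  · intro i _ h; rw [one_ne h, zero_mul]
  · simp

protected lemma mul_one' (a : Cochain R X) : a * 1 = a := by
  ext n σ
  rw [mul_apply, Finset.sum_eq_single n]
  · have : ∀ k, k = 0 → (1 : Cochain R X) k (σ.sub k n) = 1 := by rintro _ rfl; rfl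
    rw [this _ (Nat.sub_self n), mul_one, Simp.sub_self]
  · intro i hi h
    rw [one_ne (by rw [Finset.mem_range] at hi; omega), mul_zero]
  · simp

protected lemma mul_assoc' (a b c : Cochain R X) : a * b * c = a * (b * c) := by
  ext n σ
  simp only [mul_apply, Finset.sum_mul, Finset.mul_sum]
  rw [Finset.sum_sigma', Finset.sum_sigma']
  refine Finset.sum_bij' (fun x _ => ⟨x.2, x.1 - x.2⟩) (fun y _ => ⟨y.1 + y.2, y.1⟩) ?_ ?_ ?_ ?_ ?_
  · rintro ⟨i, j⟩ h; simp only [Finset.mem_sigma, Finset.mem_range] at h ⊢; omega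
  · rintro ⟨i, j⟩ h; simp only [Finset.mem_sigma, Finset.mem_range] at h ⊢; omega
  · rintro ⟨i, j⟩ h; simp only [Finset.mem_sigma, Finset.mem_range] at h ⊢
    have : j + (i - j) = i := by omega
    simp [this]
  · rintro ⟨i, j⟩ h; simp
  · rintro ⟨i, j⟩ h
    simp only [Finset.mem_sigma, Finset.mem_range] at h
    dsimp only
    have e1 : n - j - (i - j) = n - i := by omega
    have e2 : j + (i - j) = i := by omega
    rw [e1, Simp.sub_sub _ (by omega), Simp.sub_sub _ (by omega), Simp.sub_sub _ (by omega),
      Simp.sub_sub _ (by omega), mul_assoc, e2, add_zero, zero_add, add_zero]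

instance : Ring (Cochain R X) :=
  { (inferInstance : AddCommGroup (Cochain R X)) with
    mul := (· * ·)
    one := 1
    one_mul := Cochain.one_mul'
    mul_one := Cochain.mul_one'
    mul_assoc := Cochain.mul_assoc'
    zero_mul := fun a => by ext; simp [mul_apply]
    mul_zero := fun a => by ext; simp [mul_apply]
    left_distrib := fun a b c => by ext; simp [mul_apply, mul_add, Finset.sum_add_distrib]
    right_distrib := fun a b c => by ext; simp [mul_apply, add_mul, Finset.sum_add_distrib] }

/-- Multiplication of the degree `n` part by `(-1)^n`. -/
def sgn (a : Cochain R X) : Cochain R X := fun n σ => (-1) ^ n * a n σ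

lemma sgn_sgn (a : Cochain R X) : sgn (sgn a) = a := by
  ext n σ; simp only [sgn]; rw [← mul_assoc, ← pow_add, Even.neg_one_pow ⟨n, rfl⟩, one_mul]

lemma delta_sgn (a : Cochain R X) : delta (sgn a) = -sgn (delta a) := by
  ext n σ
  cases n with
  | zero => simp [sgn]
  | succ n =>
    simp only [neg_apply, sgn, delta_succ, Finset.mul_sum, ← Finset.sum_neg_distrib]
    refine Finset.sum_congr rfl fun i _ => ?_
    rw [← mul_assoc, ← mul_assoc, ((Commute.refl (-1 : R)).pow_pow i n).eq, pow_succ]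
    simp

/-- The Leibniz rule. -/
lemma delta_mul (a b : Cochain R X) : delta (a * b) = delta a * b + sgn a * delta b := by
  ext n σ
  cases n with
  | zero => simp [mul_apply]
  | succ n =>
    rw [add_apply, mul_apply (delta a), mul_apply (sgn a), delta_succ]
    rw [Finset.sum_range_succ' (fun i => delta a i (σ.sub i 0) * _) (n + 1),
      Finset.sum_range_succ (fun i => sgn a i (σ.sub i 0) * _) (n + 1)]
    have e0 : delta a 0 (σ.sub 0 0) = 0 := rfl
    have e1 : ∀ k, k = 0 → delta b k (σ.sub k (n + 1)) = 0 := by rintro _ rfl; rfl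
    rw [e0, e1 _ (Nat.sub_self _), zero_mul, mul_zero, add_zero, add_zero,
      ← Finset.sum_add_distrib]
    simp only [mul_apply, Finset.mul_sum]
    rw [Finset.sum_comm]
    refine Finset.sum_congr rfl fun j hj => ?_
    have hj : j ≤ n := by rw [Finset.mem_range] at hj; omega
    have e2 : n + 1 - (j + 1) = n - j := by omega
    have e3 : n + 1 - j = n - j + 1 := by omega
    rw [e2, e3, delta_succ, delta_succ, Finset.sum_mul, Finset.mul_sum,
      Finset.sum_range_succ _ (j + 1), Finset.sum_range_succ' _ (n - j + 1),
      Simp.sub_face_last σ hj, Simp.sub_face_zero σ hj]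
    have e4 : n + 2 = (j + 1) + (n - j + 1) := by omega
    rw [e4, Finset.sum_range_add]
    have h1 : ∀ i ∈ Finset.range (j + 1), (-1) ^ i * (a j ((σ.face i).sub j 0) *
        b (n - j) ((σ.face i).sub (n - j) j)) = (-1) ^ i * a j ((σ.sub (j + 1) 0).face i) *
        b (n - j) (σ.sub (n - j) (j + 1)) := fun i hi => by
      have hi : i ≤ j := by rw [Finset.mem_range] at hi; omega
      rw [Simp.face_sub_front σ hi hj, Simp.face_sub_back σ hi hj, mul_assoc]
    have h2 : ∀ i ∈ Finset.range (n - j + 1), (-1) ^ (j + 1 + i) *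
        (a j ((σ.face (j + 1 + i)).sub j 0) * b (n - j) ((σ.face (j + 1 + i)).sub (n - j) j)) =
        sgn a j (σ.sub j 0) * ((-1) ^ (i + 1) * b (n - j) ((σ.sub (n - j + 1) j).face (i + 1))) :=
      fun i _ => by
      have : j + 1 + i = j + (i + 1) := by omega
      rw [this, Simp.face_sub_front' σ (by omega) hj, Simp.face_sub_back' σ hj, sgn, pow_add]
      have hc : ∀ (r : R) (k : ℕ), (-1) ^ k * r = r * (-1) ^ k := fun r k =>
        ((Commute.neg_one_left r).pow_left k).eq
      rw [mul_assoc, mul_assoc, ← mul_assoc ((-1 : R) ^ (i + 1)), hc (a j _) (i + 1), mul_assoc]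
    rw [Finset.sum_congr rfl h1, Finset.sum_congr rfl h2]
    have h3 : (-1) ^ (j + 1) * a j (σ.sub j 0) * b (n - j) (σ.sub (n - j) (j + 1)) +
        sgn a j (σ.sub j 0) * ((-1) ^ 0 * b (n - j) (σ.sub (n - j) (j + 1))) = 0 := by
      simp [sgn, pow_succ]; 
    rw [show ∀ p q r s : R, p + q + (r + s) = p + r + (q + s) from fun p q r s => by abel, h3,
      add_zero]

lemma delta_one : delta (1 : Cochain R X) = 0 := by
  ext n σ
  match n with
  | 0 => rfl
  | 1 => simp [delta_succ, one_zero, Finset.sum_range_succ]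
  | n + 2 => simp [delta_succ, one_ne]

/-- Pullback of cochains along a continuous map. -/
def map (f : C(X, Y)) : Cochain R Y →+* Cochain R X where
  toFun a n σ := a n (f.comp σ)
  map_zero' := rfl
  map_one' := by
    ext n σ
    by_cases h : n = 0
    · subst h; rfl
    · rw [one_ne h, one_ne h]
  map_add' _ _ := rfl
  map_mul' _ _ := rfl

lemma delta_map (f : C(X, Y)) (a : Cochain R Y) : delta (map f a) = map f (delta a) := by
  ext n σ; cases n <;> rfl

/-- Change of coefficients. -/
def coeff (φ : R →+* S) : Cochain R X →+* Cochain S X where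
  toFun a := fun n σ => φ (a n σ)
  map_zero' := by ext; simp
  map_one' := by
    ext n σ
    by_cases h : n = 0
    · subst h; exact φ.map_one
    · rw [one_ne h, one_ne h, map_zero]
  map_add' a b := by ext n σ; exact φ.map_add (a n σ) (b n σ)
  map_mul' a b := by
    ext n σ
    exact (map_sum φ _ _).trans (Finset.sum_congr rfl fun i _ => φ.map_mul _ _)

lemma coeff_apply (φ : R →+* S) (a : Cochain R X) (n : ℕ) (σ : Simp n X) :
    coeff φ a n σ = φ (a n σ) := rfl

lemma delta_coeff (φ : R →+* S) (a : Cochain R X) : delta (coeff φ a) = coeff φ (delta a) := by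
  ext n σ; cases n <;> simp [coeff_apply, delta_succ]

/-- Multiplication of the degree `n` part by the integer `s n`, for every `n`. -/
def scale (s : ℕ → ℤ) : Cochain R X →+ Cochain R X where
  toFun a n σ := s n • a n σ
  map_zero' := by ext; simp
  map_add' a b := by ext n σ; exact smul_add (s n) (a n σ) (b n σ)

lemma scale_apply (s : ℕ → ℤ) (a : Cochain R X) (n : ℕ) (σ : Simp n X) :
    scale s a n σ = s n • a n σ := rfl

lemma delta_scale (s : ℕ → ℤ) (a : Cochain R X) :
    delta (scale (fun n => s (n + 1)) a) = scale s (delta a) := by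
  ext n σ; cases n <;> simp [scale_apply, delta_succ, Finset.mul_sum, Int.cast_comm,mul_assoc]

/-- The ring of singular cocycles. -/
def cocycles (R X : Type*) [Ring R] [TopologicalSpace X] : Subring (Cochain R X) where
  carrier := {a | delta a = 0}
  zero_mem' := map_zero _
  one_mem' := delta_one
  add_mem' {a b} ha hb := by
    simp only [Set.mem_ofPred_eq] at *; rw [map_add, ha, hb, add_zero]
  neg_mem' {a} ha := by simp only [Set.mem_ofPred_eq] at *; rw [map_neg, ha, neg_zero]
  mul_mem' {a b} ha hb := by
    simp only [Set.mem_ofPred_eq] at *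
    rw [delta_mul, ha, hb, zero_mul, mul_zero, add_zero]

/-- The two-sided ideal of coboundaries in the ring of cocycles. -/
def coboundaries (R X : Type*) [Ring R] [TopologicalSpace X] : Ideal (cocycles R X) where
  carrier := {z | ∃ b : Cochain R X, delta b = z}
  zero_mem' := ⟨0, map_zero _⟩
  add_mem' := by
    rintro a b ⟨a', ha⟩ ⟨b', hb⟩
    exact ⟨a' + b', by rw [map_add, ha, hb]; rfl⟩
  smul_mem' := by
    rintro ⟨z, hz⟩ a ⟨b, hb⟩
    have hz : delta z = 0 := hz
    refine ⟨sgn z * b, ?_⟩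
    rw [delta_mul, delta_sgn, hz, sgn_sgn, hb]
    have : sgn (0 : Cochain R X) = 0 := by ext; simp [sgn]
    rw [this, neg_zero, zero_mul, zero_add]; rfl

instance : (coboundaries R X).IsTwoSided where
  mul_mem_of_left := by
    rintro a ⟨z, hz⟩ ⟨b, hb⟩
    have hz : delta z = 0 := hz
    refine ⟨b * z, ?_⟩
    rw [delta_mul, hz, mul_zero, add_zero, hb]; rfl

end Cochain

/-- The total singular cohomology ring `∏ₙ Hⁿ(X; R)` with the cup product. -/
def Coh (R X : Type*) [Ring R] [TopologicalSpace X] : Type _ :=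
  Cochain.cocycles R X ⧸ Cochain.coboundaries R X

namespace Coh

variable {R S X Y : Type*} [Ring R] [Ring S] [TopologicalSpace X] [TopologicalSpace Y]

instance : Ring (Coh R X) :=
  inferInstanceAs (Ring (Cochain.cocycles R X ⧸ Cochain.coboundaries R X))

/-- The cohomology class of a cocycle. -/
def mk : Cochain.cocycles R X →+* Coh R X := Ideal.Quotient.mk (Cochain.coboundaries R X)

/-- The ring homomorphism induced by a continuous map. -/
def map (f : C(X, Y)) : Coh R Y →+* Coh R X :=
  Ideal.quotientMap (Cochain.coboundaries R X)
    ((Cochain.map f).restrict (Cochain.cocycles R Y) (Cochain.cocycles R X) fun a ha => by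
      have ha : Cochain.delta a = 0 := ha
      change Cochain.delta _ = 0
      rw [Cochain.delta_map, ha, map_zero])
    (by rintro z ⟨b, hb⟩; exact ⟨Cochain.map f b, by rw [Cochain.delta_map, hb]; rfl⟩)

/-- The ring homomorphism induced by a homomorphism of coefficients. -/
def coeff (φ : R →+* S) : Coh R X →+* Coh S X :=
  Ideal.quotientMap (Cochain.coboundaries S X)
    ((Cochain.coeff φ).restrict (Cochain.cocycles R X) (Cochain.cocycles S X) fun a ha => by
      have ha : Cochain.delta a = 0 := ha
      change Cochain.delta _ = 0
      rw [Cochain.delta_coeff, ha, map_zero])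
    (by rintro z ⟨b, hb⟩; exact ⟨Cochain.coeff φ b, by rw [Cochain.delta_coeff, hb]; rfl⟩)

/-- Multiplication of the degree `n` part of a cohomology class by `s n`, for every `n`. -/
def scale (s : ℕ → ℤ) : Coh R X →+ Coh R X :=
  QuotientAddGroup.map (Cochain.coboundaries R X).toAddSubgroup
    (Cochain.coboundaries R X).toAddSubgroup
    (AddMonoidHom.mk' (fun z : Cochain.cocycles R X =>
      (⟨Cochain.scale s z.1, by
        have hz : Cochain.delta z.1 = 0 := z.2
        change Cochain.delta _ = 0
        ext n σ
        cases n with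
        | zero => rfl
        | succ n =>
          have := congrArg (s n • ·) (congrFun (congrFun hz (n + 1)) σ)
          simpa [Cochain.scale_apply, Cochain.delta_succ, Finset.mul_sum, Int.cast_comm, mul_assoc] using this⟩ :
        Cochain.cocycles R X)) fun a b => Subtype.ext (map_add _ _ _))
    (by
      rintro z ⟨b, hb⟩
      exact ⟨Cochain.scale (fun n => s (n + 1)) b, by rw [Cochain.delta_scale, hb]; rfl⟩)

end Coh

/-! ### Transgression -/

/-- A `d`-cochain `c` on `P` transgresses along `q : P → B` to the class `x ∈ H^{d+1}(B; R)`: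
the coboundary of `c` is the pullback of a cocycle of degree `d + 1` representing `x`. -/
def Transgresses {R P B : Type*} [Ring R] [TopologicalSpace P] [TopologicalSpace B] (q : C(P, B))
    (d : ℕ) (c : Simp d P → R) (x : Coh R B) : Prop :=
  ∃ z : Cochain.cocycles R B, Coh.mk z = x ∧ z.1 = Cochain.single (d + 1) (z.1 (d + 1)) ∧
    Cochain.delta (Cochain.single d c) = Cochain.map q z.1

/-! ### Orbit spaces -/

/-- The orbit space of a group action, with the quotient topology. -/
def OrbitSpace (G X : Type*) [Group G] [MulAction G X] : Type _ :=
  Quotient (MulAction.orbitRel G X)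

instance (G X : Type*) [Group G] [MulAction G X] [TopologicalSpace X] :
    TopologicalSpace (OrbitSpace G X) :=
  inferInstanceAs (TopologicalSpace (Quotient (MulAction.orbitRel G X)))

/-- The projection to the orbit space. -/
def orbitMk (G : Type*) {X : Type*} [Group G] [MulAction G X] [TopologicalSpace X] :
    C(X, OrbitSpace G X) :=
  ⟨fun x => Quotient.mk (MulAction.orbitRel G X) x, continuous_quotient_mk'⟩

lemma orbitMk_smul {G X : Type*} [Group G] [MulAction G X] [TopologicalSpace X] (g : G) (x : X) :
    orbitMk G (g • x) = orbitMk G x :=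
  Quotient.sound (s := MulAction.orbitRel G X) ⟨g, rfl⟩

/-- `E → E / G` is a locally trivial principal `G`-bundle. -/
def IsPrincipalBundle (G E : Type*) [Group G] [TopologicalSpace G] [TopologicalSpace E]
    [MulAction G E] : Prop :=
  ∀ e : E, ∃ U : Set E, IsOpen U ∧ e ∈ U ∧ (∀ (g : G), ∀ x ∈ U, g • x ∈ U) ∧
    ∃ τ : E → G, ContinuousOn τ U ∧ ∀ (g : G), ∀ x ∈ U, τ (g • x) = g * τ x

/-! ### Characteristic classes of vector bundles -/

section Bundles

open Bundle

variable (𝕜 : Type*) [Field 𝕜] {B : Type*} [TopologicalSpace B] (F : Type*) (V : B → Type*)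
  [∀ b, AddCommGroup (V b)] [∀ b, Module 𝕜 (V b)] [TopologicalSpace (TotalSpace F V)]

/-- The complement of the zero section of a vector bundle. -/
def NonzeroVec : Type _ := {v : TotalSpace F V // v.2 ≠ 0}

instance : TopologicalSpace (NonzeroVec F V) :=
  inferInstanceAs (TopologicalSpace {v : TotalSpace F V // v.2 ≠ 0})

variable {V} in
/-- A nonzero vector in the fibre over `b`. -/
def NonzeroVec.of {b : B} (v : V b) (hv : v ≠ 0) : NonzeroVec F V := ⟨⟨b, v⟩, hv⟩

instance : MulAction 𝕜ˣ (NonzeroVec F V) where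
  smul u v := ⟨⟨v.1.1, u • v.1.2⟩, (smul_ne_zero_iff_ne u).2 v.2⟩
  one_smul v := by
    refine Subtype.ext ?_
    change (⟨v.1.1, (1 : 𝕜ˣ) • v.1.2⟩ : TotalSpace F V) = v.1
    rw [one_smul]
  mul_smul u w v := by
    refine Subtype.ext ?_
    change (⟨v.1.1, (u * w) • v.1.2⟩ : TotalSpace F V) = ⟨v.1.1, u • w • v.1.2⟩
    rw [mul_smul]

/-- The projectivization `P(V) → B` of a vector bundle: the space of lines in its fibres. The
projection `NonzeroVec F V → ProjBundle 𝕜 F V` is the complement of the zero section of the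
tautological line bundle over `P(V)`. -/
abbrev ProjBundle : Type _ := OrbitSpace 𝕜ˣ (NonzeroVec F V)

/-- The bundle over `B` whose fibre over `b` is the space of ordered decompositions of `V b` into
`n` lines, where `n` is the rank of `V`. For `𝕜 = ℝ` or `ℂ` it is fibre homotopy equivalent to the
bundle of complete flags. -/
def SplitBundle (n : ℕ) : Type _ :=
  {x : B × (Fin n → ProjBundle 𝕜 F V) // ∃ (v : Fin n → V x.1) (h : LinearIndependent 𝕜 v),
    ∀ i, x.2 i = orbitMk 𝕜ˣ (NonzeroVec.of F (v i) (h.ne_zero i))}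

instance (n : ℕ) : TopologicalSpace (SplitBundle 𝕜 F V n) :=
  inferInstanceAs (TopologicalSpace {x : B × (Fin n → ProjBundle 𝕜 F V) //
    ∃ (v : Fin n → V x.1) (h : LinearIndependent 𝕜 v),
      ∀ i, x.2 i = orbitMk 𝕜ˣ (NonzeroVec.of F (v i) (h.ne_zero i))})

/-- The projection of the bundle of decompositions to the base. -/
def SplitBundle.base (n : ℕ) : C(SplitBundle 𝕜 F V n, B) :=
  ⟨fun x => x.1.1, continuous_fst.comp continuous_subtype_val⟩

/-- The `i`-th line of a decomposition. The pullback of the tautological line bundle along this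
map is the `i`-th of the `n` line bundles into which the pullback of `V` splits. -/
def SplitBundle.line (n : ℕ) (i : Fin n) : C(SplitBundle 𝕜 F V n, ProjBundle 𝕜 F V) :=
  ⟨fun x => x.1.2 i, (continuous_apply i).comp (continuous_snd.comp continuous_subtype_val)⟩

/-- `x ∈ H^*(B; R)` pulls back to `∏ᵢ (1 + tᵢ)` on the bundle of decompositions into lines, where
`tᵢ` is the pullback along the `i`-th line of the class `t ∈ H^*(P(V); R)`. -/
def IsSplitProduct {R : Type*} [Ring R] (n : ℕ) (t : Coh R (ProjBundle 𝕜 F V)) (x : Coh R B) :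
    Prop :=
  Coh.map (SplitBundle.base 𝕜 F V n) x =
    (List.ofFn fun i => 1 + Coh.map (SplitBundle.line 𝕜 F V n i) t).prod

end Bundles

section Classes

open Bundle

variable {B : Type*} [TopologicalSpace B] (F : Type*) (V : B → Type*)
  [∀ b, AddCommGroup (V b)] [TopologicalSpace (TotalSpace F V)]

/-- `t ∈ H²(P(V); ℤ)` is the first Chern class of the tautological line bundle `L` over the
projectivization of the complex vector bundle `V`. In terms of the principal `ℂˣ`-bundle
`L ∖ 0 = V ∖ 0 → P(V)` the first Chern class (that is, the Euler class) is minus the transgression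
of the generator of `H¹(ℂˣ; ℤ)` with value `1` on the positive loop `s ↦ exp(2πis)`. The value of
the cochain on the constant path is subtracted because representing cocycles need not
vanish on constant simplices. -/
def IsTautologicalChern [∀ b, Module ℂ (V b)] (t : Coh ℤ (ProjBundle ℂ F V)) : Prop :=
  ∃ c : Simp 1 (NonzeroVec F V) → ℤ, Transgresses (orbitMk ℂˣ) 1 c t ∧
    ∀ (v : NonzeroVec F V) (γ : Simp 1 (NonzeroVec F V)),
      (∀ s, γ s = Circle.toUnits (Circle.exp (2 * Real.pi * s 1)) • v) →
        c γ - c (ContinuousMap.const _ v) = -1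

/-- `t ∈ H¹(P(V); ℤ/2)` is the first Stiefel–Whitney class of the tautological line bundle `L`
over the projectivization of the real vector bundle `V`, the class of the double covering given by
the two orientations of `L`: it is the transgression of the nontrivial class of
`H̃⁰(ℝˣ; ℤ/2)` in the principal `ℝˣ`-bundle `V ∖ 0 → P(V)`. -/
def IsTautologicalSW [∀ b, Module ℝ (V b)] (t : Coh (ZMod 2) (ProjBundle ℝ F V)) : Prop :=
  ∃ c : Simp 0 (NonzeroVec F V) → ZMod 2, Transgresses (orbitMk ℝˣ) 0 c t ∧
    ∀ v : NonzeroVec F V,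
      c (ContinuousMap.const _ ((-1 : ℝˣ) • v)) - c (ContinuousMap.const _ v) = 1

/-- `x ∈ H^*(B; ℤ)` is the total Chern class of the complex vector bundle `V` of rank `n`. Over the
bundle of decompositions of `V` into lines, `V` becomes a sum of line bundles `L₁, …, Lₙ`, the
pullback map in cohomology is injective, and `c(V)` is the unique class with pullback
`∏ᵢ (1 + c₁(Lᵢ))`. -/
def IsTotalChern [∀ b, Module ℂ (V b)] (n : ℕ) (x : Coh ℤ B) : Prop :=
  ∃ t, IsTautologicalChern F V t ∧ IsSplitProduct ℂ F V n t x

/-- `x ∈ H^*(B; ℤ/2)` is the total Stiefel–Whitney class of the real vector bundle `V` of rank `n`: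
the unique class whose pullback to the bundle of decompositions of `V` into lines `L₁, …, Lₙ` is
`∏ᵢ (1 + w₁(Lᵢ))`. -/
def IsTotalSW [∀ b, Module ℝ (V b)] (n : ℕ) (x : Coh (ZMod 2) B) : Prop :=
  ∃ t, IsTautologicalSW F V t ∧ IsSplitProduct ℝ F V n t x

end Classes

/-- The complex vector space structure on a real vector space defined by `J` with `J² = -1`. -/
@[reducible] def complexModule {W : Type*} [AddCommGroup W] [Module ℝ W] (J : W →ₗ[ℝ] W)
    (hJ : ∀ v, J (J v) = -v) : Module ℂ W :=
  Module.compHom W (Complex.liftAux (A := Module.End ℝ W) J (LinearMap.ext hJ)).toRingHom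

lemma complexModule_smul {W : Type*} [AddCommGroup W] [Module ℝ W] (J : W →ₗ[ℝ] W)
    (hJ : ∀ v, J (J v) = -v) (z : ℂ) (v : W) :
    letI := complexModule J hJ
    z • v = z.re • v + z.im • J v := by
  change (Complex.liftAux (A := Module.End ℝ W) J (LinearMap.ext hJ)) z v = _
  rw [Complex.liftAux_apply]; rfl

section Complexification

open Bundle

variable {B : Type*} (F : Type*) (V : B → Type*) [∀ b, AddCommGroup (V b)]
  [∀ b, Module ℝ (V b)] [TopologicalSpace (TotalSpace F V)]

/-- The complexification `V ⊗ ℂ = V ⊕ V` of a real vector bundle, on which `i` acts as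
`(v, w) ↦ (-w, v)`. -/
def Complexified (b : B) : Type _ := V b × V b

instance (b : B) : AddCommGroup (Complexified V b) := inferInstanceAs (AddCommGroup (V b × V b))

instance (b : B) : Module ℂ (Complexified V b) :=
  complexModule (W := V b × V b)
    ((-LinearMap.snd ℝ (V b) (V b)).prod (LinearMap.fst ℝ (V b) (V b))) fun _ => rfl

instance : TopologicalSpace (TotalSpace F (Complexified V)) :=
  TopologicalSpace.induced
    (fun x => ((⟨x.1, x.2.1⟩, ⟨x.1, x.2.2⟩) : TotalSpace F V × TotalSpace F V)) inferInstance

/-- `x ∈ H^*(B; ℤ)` is the total Pontrjagin class of the real vector bundle `V` of rank `n`, i.e.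
`x = ∑ᵢ pᵢ(V)` with `pᵢ(V) = (-1)^i c_{2i}(V ⊗ ℂ) ∈ H^{4i}(B; ℤ)`. -/
def IsTotalPontrjagin [TopologicalSpace B] (n : ℕ) (x : Coh ℤ B) : Prop :=
  ∃ c, IsTotalChern F (Complexified V) n c ∧
    x = Coh.scale (fun d => if 4 ∣ d then (-1) ^ (d / 4) else 0) c

/-- A complex structure on the fibres of a real vector bundle. -/
structure FiberComplexStructure where
  /-- Multiplication by `i`. -/
  J : ∀ b, V b →ₗ[ℝ] V b
  sq : ∀ b v, J b (J b v) = -v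

variable {V}

/-- A real vector bundle with a complex structure on the fibres, as a complex vector bundle. -/
def WithComplex (_ : FiberComplexStructure V) (b : B) : Type _ := V b

instance (J : FiberComplexStructure V) (b : B) : AddCommGroup (WithComplex J b) :=
  inferInstanceAs (AddCommGroup (V b))

instance (J : FiberComplexStructure V) (b : B) : Module ℂ (WithComplex J b) :=
  complexModule (W := V b) (J.J b) (J.sq b)

instance (J : FiberComplexStructure V) : TopologicalSpace (TotalSpace F (WithComplex J)) :=
  TopologicalSpace.induced (fun x => (⟨x.1, x.2⟩ : TotalSpace F V)) inferInstance

end Complexification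

/-! ### The Borel construction -/

section Borel

open Bundle

/-- The Borel construction `EG ×_G M`, the orbit space of the diagonal action on `EG × M`. -/
abbrev HomotopyQuotient (G EG M : Type*) [Group G] [MulAction G EG] [MulAction G M] : Type _ :=
  OrbitSpace G (EG × M)

/-- The inclusion `BG = EG ×_G {p} → EG ×_G M` of a fixed point `p`. -/
def fixedPointInclusion {G EG M : Type*} [Group G] [TopologicalSpace EG] [MulAction G EG]
    [TopologicalSpace M] [MulAction G M] (p : MulAction.fixedPoints G M) :
    C(OrbitSpace G EG, HomotopyQuotient G EG M) where
  toFun := Quotient.lift (s := MulAction.orbitRel G EG) (fun e => orbitMk G (e, p.1)) (by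
    rintro _ e ⟨g, rfl⟩
    have h : ((g • e, p.1) : EG × M) = g • (e, p.1) := Prod.ext rfl (p.2 g).symm
    exact (congrArg (orbitMk G) h).trans (orbitMk_smul g _))
  continuous_toFun := Continuous.quotient_lift (by fun_prop) _

/-- The restriction `H^*_G(M; R) → H^*_G(M^G; R) = ∏_{p ∈ M^G} H^*(BG; R)`. -/
def restrictFixed {R G EG M : Type*} [Ring R] [Group G] [TopologicalSpace EG] [MulAction G EG]
    [TopologicalSpace M] [MulAction G M] (x : Coh R (HomotopyQuotient G EG M)) :
    MulAction.fixedPoints G M → Coh R (OrbitSpace G EG) :=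
  fun p => Coh.map (fixedPointInclusion p) x

variable {𝕜 G : Type*} [Field 𝕜] [Group G] (EG : Type*) [TopologicalSpace EG] [MulAction G EG]
  {M : Type*} [TopologicalSpace M] [MulAction G M] (F : Type*) {V : M → Type*}
  [∀ x, AddCommGroup (V x)] [∀ x, Module 𝕜 (V x)] [TopologicalSpace (TotalSpace F V)]
  (act : ∀ (g : G) (x : M), V x →ₗ[𝕜] V (g • x))

/-- The fibre of `EG ×_G V → EG ×_G M` over `b` for a `G`-equivariant vector bundle `V → M`,
as a vector space: an element of `EG ×_G V` over `b` is a `G`-orbit in `EG × V` over the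
orbit `b ⊆ EG × M`, i.e. a `G`-equivariant family of vectors `f (e, x) ∈ V x` indexed by the
elements `(e, x)` of `b`. -/
def borelSubmodule (b : HomotopyQuotient G EG M) :
    Submodule 𝕜 (∀ y : {y : EG × M // orbitMk G y = b}, V y.1.2) where
  carrier := {f | ∀ (g : G) (y : {y : EG × M // orbitMk G y = b}),
    f ⟨g • y.1, (orbitMk_smul g y.1).trans y.2⟩ = act g y.1.2 (f y)}
  zero_mem' := fun g y => (map_zero (act g y.1.2)).symm
  add_mem' := fun {f f'} hf hf' g y => by
    exact (congrArg₂ (· + ·) (hf g y) (hf' g y)).trans (map_add (act g y.1.2) _ _).symm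
  smul_mem' := fun c f hf g y => by
    exact (congrArg (c • ·) (hf g y)).trans (map_smul (act g y.1.2) c _).symm

/-- The vector bundle `EG ×_G V` over `EG ×_G M`. -/
def BorelBundle (b : HomotopyQuotient G EG M) : Type _ := borelSubmodule EG act b

instance (b : HomotopyQuotient G EG M) : AddCommGroup (BorelBundle EG act b) :=
  inferInstanceAs (AddCommGroup (borelSubmodule EG act b))

instance (b : HomotopyQuotient G EG M) : Module 𝕜 (BorelBundle EG act b) :=
  inferInstanceAs (Module 𝕜 (borelSubmodule EG act b))

/-- The graph of the quotient map `EG × V → EG ×_G V`. -/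
def BorelGraph : Type _ :=
  {x : (EG × TotalSpace F V) × TotalSpace F (BorelBundle EG act) //
    ∃ h : orbitMk G (x.1.1, x.1.2.1) = x.2.1, x.2.2.1 ⟨(x.1.1, x.1.2.1), h⟩ = x.1.2.2}

/-- The total space of `EG ×_G V` carries the quotient topology from `EG × V`. -/
instance : TopologicalSpace (TotalSpace F (BorelBundle EG act)) :=
  TopologicalSpace.coinduced (fun x : BorelGraph EG F act => x.1.2)
    (TopologicalSpace.induced (fun x : BorelGraph EG F act => x.1.1) inferInstance)

end Borel

/-! ### Torus actions -/

section Torus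

/-- The `k`-dimensional torus. -/
abbrev Torus (k : ℕ) := Fin k → Circle

/-- The character `t ↦ ∏ tₗ ^ aₗ` of the torus; the weight lattice is identified with `ℤ^k`. -/
def weightChar {k : ℕ} (a : Fin k → ℤ) (t : Torus k) : ℂ := ((∏ l, t l ^ a l : Circle) : ℂ)

variable {k : ℕ} {ET : Type*} [TopologicalSpace ET] [MulAction (Torus k) ET]

/-- `x ∈ H²(BT; ℤ)` is the transgression in `T → ET → BT` of the class in `H¹(T; ℤ) ≅ ℤ^k` with
value `a l` on the `l`-th coordinate circle. -/
def IsTransgression (a : Fin k → ℤ) (x : Coh ℤ (OrbitSpace (Torus k) ET)) : Prop :=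
  ∃ c : Simp 1 ET → ℤ, Transgresses (orbitMk (Torus k)) 1 c x ∧
    ∀ (e : ET) (l : Fin k) (γ : Simp 1 ET),
      (∀ s, γ s = (Pi.mulSingle l (Circle.exp (2 * Real.pi * s 1)) : Torus k) • e) →
        c γ - c (ContinuousMap.const _ e) = a l

/-- The element `∑ₗ aₗ uₗ` of `H²(BT; ℤ)` corresponding to a weight `a`. -/
def weightClass {X : Type*} [TopologicalSpace X] (u : Fin k → Coh ℤ X) (a : Fin k → ℤ) :
    Coh ℤ X :=
  ∑ l, a l • u l

variable {d : ℕ} {M : Type*} [TopologicalSpace M] [ChartedSpace (EuclideanSpace ℝ (Fin d)) M]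
  [IsManifold (𝓡 d) ∞ M] [MulAction (Torus k) M]

/-- The action of a torus element on the tangent bundle, by its differential. -/
def tangentAction (t : Torus k) (p : M) :
    TangentSpace (𝓡 d) p →ₗ[ℝ] TangentSpace (𝓡 d) (t • p) :=
  (mfderiv (𝓡 d) (𝓡 d) (fun q : M => t • q) p).toLinearMap

/-- The isotropy representation at a fixed point. -/
def isotropyRep (p : MulAction.fixedPoints (Torus k) M) (t : Torus k) :
    TangentSpace (𝓡 d) p.1 →ₗ[ℝ] TangentSpace (𝓡 d) p.1 :=
  (p.2 t) ▸ tangentAction t p.1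

variable (d) in
/-- `a₁, …, aₘ` are the weights, each determined up to sign, of the isotropy representation at
`p`: the representation is a direct sum of real planes on which `T` acts by rotations through the
characters `aⱼ`. -/
def IsWeights {m : ℕ} (p : MulAction.fixedPoints (Torus k) M) (a : Fin m → Fin k → ℤ) : Prop :=
  ∃ φ : TangentSpace (𝓡 d) p.1 ≃ₗ[ℝ] (Fin m → ℂ),
    ∀ t v j, φ (isotropyRep p t v) j = weightChar (a j) t * φ v j

variable (k d M) in
/-- An invariant (smooth) almost complex structure. -/
structure InvariantACS extends FiberComplexStructure (fun p : M => TangentSpace (𝓡 d) p) where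
  smooth : ContMDiff (𝓡 d).tangent (𝓡 d).tangent ∞
    (fun v : TangentBundle (𝓡 d) M => (⟨v.1, J v.1 v.2⟩ : TangentBundle (𝓡 d) M))
  invariant : ∀ (t : Torus k) (p : M) (v : TangentSpace (𝓡 d) p),
    J (t • p) (tangentAction t p v) = tangentAction t p (J p v)

/-- The complex linear action on the tangent bundle with an invariant almost complex structure. -/
def InvariantACS.action (J : InvariantACS k d M) (t : Torus k) (p : M) :
    WithComplex J.toFiberComplexStructure p →ₗ[ℂ] WithComplex J.toFiberComplexStructure (t • p) where
  toFun v := tangentAction t p v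
  map_add' v w := (tangentAction t p).map_add v w
  map_smul' z v := by
    have h1 := complexModule_smul (J.J p) (J.sq p) z v
    have h2 := complexModule_smul (J.J (t • p)) (J.sq (t • p)) z (tangentAction t p v)
    have h3 : ∀ w : TangentSpace (𝓡 d) p, tangentAction t p (z.re • w + z.im • J.J p w) =
        z.re • tangentAction t p w + z.im • J.J (t • p) (tangentAction t p w) := fun w => by
      rw [map_add, map_smul, map_smul, J.invariant]
    exact (congrArg (tangentAction t p) h1).trans ((h3 v).trans h2.symm)

/-- `b₁, …, bₘ` are the weights of the isotropy representation at `p` as a complex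
representation, for an invariant almost complex structure. -/
def IsComplexWeights {m : ℕ} (J : InvariantACS k d M) (p : MulAction.fixedPoints (Torus k) M)
    (b : Fin m → Fin k → ℤ) : Prop :=
  ∃ φ : TangentSpace (𝓡 d) p.1 ≃ₗ[ℝ] (Fin m → ℂ), (∀ v j, φ (J.J p.1 v) j = Complex.I * φ v j) ∧
    ∀ t v j, φ (isotropyRep p t v) j = weightChar (b j) t * φ v j

variable (ET d) in
/-- `x ∈ H^*_T(M; ℤ)` is the total equivariant Pontrjagin class of `M`: the total Pontrjagin class
of `ET ×_T TM → ET ×_T M`. -/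
def IsEquivariantPontrjagin (x : Coh ℤ (HomotopyQuotient (Torus k) ET M)) : Prop :=
  IsTotalPontrjagin (EuclideanSpace ℝ (Fin d))
    (BorelBundle ET (V := fun p : M => TangentSpace (𝓡 d) p) tangentAction) d x

variable (ET d) in
/-- `x ∈ H^*_T(M; ℤ/2)` is the total equivariant Stiefel–Whitney class of `M`: the total
Stiefel–Whitney class of `ET ×_T TM → ET ×_T M`. -/
def IsEquivariantSW (x : Coh (ZMod 2) (HomotopyQuotient (Torus k) ET M)) : Prop :=
  IsTotalSW (EuclideanSpace ℝ (Fin d))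
    (BorelBundle ET (V := fun p : M => TangentSpace (𝓡 d) p) tangentAction) d x

end Torus

section TorusComplex

variable {k m : ℕ} (ET : Type*) [TopologicalSpace ET] [MulAction (Torus k) ET] {M : Type*}
  [TopologicalSpace M] [ChartedSpace (EuclideanSpace ℝ (Fin (2 * m))) M]
  [IsManifold (𝓡 (2 * m)) ∞ M] [MulAction (Torus k) M]

/-- `x ∈ H^*_T(M; ℤ)` is the total equivariant Chern class of the `2m`-dimensional manifold `M`
with the invariant almost complex structure `J`: the total Chern class of the complex vector bundle
`ET ×_T (TM, J) → ET ×_T M` of rank `m`. -/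
def IsEquivariantChern (J : InvariantACS k (2 * m) M)
    (x : Coh ℤ (HomotopyQuotient (Torus k) ET M)) : Prop :=
  IsTotalChern (EuclideanSpace ℝ (Fin (2 * m))) (BorelBundle ET J.action) m x

end TorusComplex

end EquivClass

end

open EquivClass

/-! At a fixed point `p` the bundle `ET ×_T TM` restricts to `ET ×_T T_pM → BT`, and an eigenbasis
of the isotropy representation splits it into line bundles. The total classes are characterized by
their pullback to the bundle of decompositions into lines, and the eigenlines lift the inclusion of
`BT` to that bundle. Hence the restriction of a total class is the product of the factors `1 + t_i`,
where `t_i` is the pullback of the tautological class along the `i`-th family of lines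
(`IsEquivariantFrame.splitProduct`). The injectivity of the splitting principle is not needed.

Chern classes: an eigenvector of weight `b` defines a map from `ET` to the nonzero vectors of the
bundle, and pulling back the transgression cochain of the tautological class shows that `t_i` is a
transgression of weight `b` (`IsEquivariantFrame.isTransgression_line`). A transgression is
determined by its weight (`IsTransgression.eq_weightClass`): a cochain of weight zero, corrected by
its values on paths from a chosen point of each orbit, takes the same value on all lifts of a path
and descends to a primitive on `BT`.

Pontrjagin classes: the complexified representation has the weights `α_j` and `-α_j`, so its Chern
class is the product of the `1 - α_j²`, and the signs in the definition of the Pontrjagin class turn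
this into the product of the `1 + α_j²`.

Stiefel–Whitney classes: a plane of nonzero weight contains no invariant real line, but under the
subgroup `{±1}^k` it is twice a sign representation. On `ET / {±1}^k` the class becomes the product
of the `(1 + R_j)² = 1 + R_j²`, with `R_j` a combination of the degree one classes of double
coverings, and `R_j²` is the pullback of `α_j` modulo `2` (`sum_signClass_sq`). It remains to see
that the cohomology of `BT` modulo `2` injects into that of `ET / {±1}^k`
(`coh_map_orbitBase_injective`). The projection is a tower of `k` circle bundles, each turning one
more coordinate into a sign. Each has a cocycle modulo `2` with value `1` on the fibres, and for
such a bundle a section on the level of chains modulo `2` is built by induction on the degree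
(`IsFlowQuotient.coh_map_injective`).

Complex weights: the real weights provide enough complex eigenvectors to span, hence a complex
eigenbasis. Isomorphisms have a nonzero term in the Leibniz expansion of the determinant, which
matches weights up to order, and up to sign in the real case. -/

noncomputable section

namespace EquivClass

/-! ### Principal bundles: local sections and lifting of simplices -/

section Lifting

variable {G E : Type*} [Group G] [TopologicalSpace G] [IsTopologicalGroup G]
  [TopologicalSpace E] [MulAction G E] [ContinuousSMul G E]

lemma orbitMk_eq_iff {G E : Type*} [Group G] [MulAction G E] [TopologicalSpace E] {x y : E} :
    orbitMk G x = orbitMk G y ↔ ∃ g : G, g • y = x :=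
  (Quotient.eq (r := MulAction.orbitRel G E)).trans Iff.rfl

lemma orbitMk_surjective {G E : Type*} [Group G] [MulAction G E] [TopologicalSpace E] :
    Function.Surjective (orbitMk G : C(E, OrbitSpace G E)) :=
  Quotient.mk_surjective (s := MulAction.orbitRel G E)

lemma isOpenMap_orbitMk {G E : Type*} [Group G] [MulAction G E] [TopologicalSpace E]
    [ContinuousConstSMul G E] : IsOpenMap (orbitMk G : C(E, OrbitSpace G E)) :=
  isOpenMap_quotient_mk'_mul (Γ := G) (T := E)

/-- The map of orbit spaces induced by a map invariant up to orbits. -/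
def orbitLift (G : Type*) {E X : Type*} [Group G] [MulAction G E] [TopologicalSpace E]
    [TopologicalSpace X] (f : C(E, X)) (h : ∀ (g : G) e, f (g • e) = f e) :
    C(OrbitSpace G E, X) where
  toFun := Quotient.lift (s := MulAction.orbitRel G E) f (by rintro _ e ⟨g, rfl⟩; exact h g e)
  continuous_toFun := Continuous.quotient_lift f.continuous _

lemma IsPrincipalBundle.free (h : IsPrincipalBundle G E) {g : G} {e : E} (hg : g • e = e) :
    g = 1 := by
  obtain ⟨U, -, heU, -, τ, -, hτ⟩ := h e
  have := hτ g e heU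
  rw [hg] at this
  simpa using this.symm

lemma IsPrincipalBundle.smul_left_cancel (h : IsPrincipalBundle G E) {g g' : G} {e : E}
    (hg : g • e = g' • e) : g = g' := by
  have h1 : (g'⁻¹ * g) • e = e := by rw [mul_smul, hg, inv_smul_smul]
  exact (inv_mul_eq_one.1 (h.free h1)).symm

/-- Two lifts to a principal bundle of the same map differ by a continuous map to the group. -/
lemma IsPrincipalBundle.exists_diff (h : IsPrincipalBundle G E) {X : Type*} [TopologicalSpace X]
    {C : Set X} {s s' : X → E} (hs : ContinuousOn s C) (hs' : ContinuousOn s' C)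
    (he : ∀ x ∈ C, orbitMk G (s x) = orbitMk G (s' x)) :
    ∃ g : X → G, ContinuousOn g C ∧ ∀ x ∈ C, g x • s x = s' x := by
  classical
  have hex : ∀ x, ∃ g : G, x ∈ C → g • s x = s' x := fun x => by
    by_cases hx : x ∈ C
    · obtain ⟨g, hg⟩ := orbitMk_eq_iff.1 (he x hx).symm
      exact ⟨g, fun _ => hg⟩
    · exact ⟨1, fun hx' => absurd hx' hx⟩
  choose g hg using hex
  refine ⟨g, fun x hx => ?_, hg⟩
  obtain ⟨U, hU, heU, hinv, τ, hτc, hτ⟩ := h (s x)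
  have hUn : s ⁻¹' U ∈ 𝓝[C] x := hs x hx (hU.mem_nhds heU)
  -- Inside a chart the difference is a quotient of chart coordinates, hence continuous.
  have key : ∀ y ∈ s ⁻¹' U ∩ C, τ (s' y) * (τ (s y))⁻¹ = g y := fun y hy => by
    rw [← hg y hy.2, hτ _ _ hy.1, mul_inv_cancel_right]
  have hmem' : ∀ y ∈ s ⁻¹' U ∩ C, s' y ∈ U := fun y hy => by
    rw [← hg y hy.2]; exact hinv _ _ hy.1
  have hc : ContinuousWithinAt (fun y => τ (s' y) * (τ (s y))⁻¹) C x := by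
    have h1 : ContinuousWithinAt (fun y => τ (s' y)) C x :=
      ((hτc.continuousAt (hU.mem_nhds (hmem' x ⟨heU, hx⟩))).tendsto).comp (hs' x hx)
    have h2 : ContinuousWithinAt (fun y => τ (s y)) C x :=
      ((hτc.continuousAt (hU.mem_nhds heU)).tendsto).comp (hs x hx)
    exact h1.mul h2.inv
  refine hc.congr_of_eventuallyEq ?_ (key x ⟨heU, hx⟩).symm
  filter_upwards [hUn, self_mem_nhdsWithin] with y h1 h2
  exact (key y ⟨h1, h2⟩).symm

/-- In a chart with coordinate `τ` the point `τ(x)⁻¹ • x` depends only on the orbit of `x`, and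
continuously on the orbit because the orbit map is open. -/
lemma IsPrincipalBundle.exists_local_section (h : IsPrincipalBundle G E) (b : OrbitSpace G E) :
    ∃ W : Set (OrbitSpace G E), IsOpen W ∧ b ∈ W ∧ ∃ s : OrbitSpace G E → E,
      ContinuousOn s W ∧ ∀ x ∈ W, orbitMk G (s x) = x := by
  classical
  obtain ⟨e, rfl⟩ := orbitMk_surjective b
  obtain ⟨U, hU, heU, hinv, τ, hτc, hτ⟩ := h e
  have hop := isOpenMap_orbitMk (G := G) (E := E)
  have hex : ∀ b : OrbitSpace G E, ∃ y : E, b ∈ orbitMk G '' U →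
      ∀ x ∈ U, orbitMk G x = b → y = (τ x)⁻¹ • x := fun b => by
    by_cases hb : b ∈ orbitMk G '' U
    · obtain ⟨x, hx, rfl⟩ := hb
      refine ⟨(τ x)⁻¹ • x, fun _ x' hx' he' => ?_⟩
      obtain ⟨g, rfl⟩ := orbitMk_eq_iff.1 he'
      rw [hτ _ _ hx, mul_inv_rev, mul_smul, inv_smul_smul]
    · exact ⟨e, fun h => absurd h hb⟩
  choose s hs using hex
  have hsx : ∀ x ∈ U, s (orbitMk G x) = (τ x)⁻¹ • x := fun x hx =>
    hs _ ⟨x, hx, rfl⟩ x hx rfl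
  refine ⟨orbitMk G '' U, hop U hU, ⟨e, heU, rfl⟩, s, ?_, ?_⟩
  · rintro _ ⟨x, hx, rfl⟩
    rw [ContinuousWithinAt, hsx x hx, Filter.tendsto_iff_forall_eventually_mem]
    intro O hO
    refine mem_nhdsWithin_of_mem_nhds ?_
    have hc : ContinuousAt (fun x => (τ x)⁻¹ • x) x :=
      ((hτc.continuousAt (hU.mem_nhds hx)).inv).smul continuousAt_id
    have := hop.image_mem_nhds (Filter.inter_mem (hc hO) (hU.mem_nhds hx))
    refine Filter.mem_of_superset this ?_
    rintro _ ⟨y, ⟨hy, hyU⟩, rfl⟩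
    change s _ ∈ O
    rw [hsx y hyU]; exact hy
  · rintro _ ⟨x, hx, rfl⟩
    rw [hsx x hx, orbitMk_smul]

/-- A property of boxes that holds for small boxes and is preserved by glueing along a
coordinate hyperplane holds for all boxes. -/
lemma box_induction {N : ℕ} (p : (Fin N → ℝ) → (Fin N → ℝ) → Prop) (lo₀ hi₀ : Fin N → ℝ)
    (glue : ∀ lo hi i c, lo₀ ≤ lo → hi ≤ hi₀ → lo ≤ hi → lo i ≤ c → c ≤ hi i →
      p lo (Function.update hi i c) → p (Function.update lo i c) hi → p lo hi)
    {δ : ℝ} (hδ : 0 < δ) (small : ∀ lo hi, lo₀ ≤ lo → hi ≤ hi₀ → lo ≤ hi →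
      (∀ i, hi i - lo i ≤ δ) → p lo hi) (h₀ : lo₀ ≤ hi₀) : p lo₀ hi₀ := by
  classical
  -- Induction on the set `S` of directions in which the box may be longer than `δ`.
  have key : ∀ S : Finset (Fin N), ∀ lo hi, lo₀ ≤ lo → hi ≤ hi₀ → lo ≤ hi →
      (∀ i ∉ S, hi i - lo i ≤ δ) → p lo hi := by
    intro S
    induction S using Finset.induction_on with
    | empty => exact fun lo hi h1 h2 h3 h => small lo hi h1 h2 h3 fun i => h i (by simp)
    | insert i S hi' ih =>
      intro lo hi hlo hhi hle h
      -- `n` bounds the number of slabs of thickness `δ` in direction `i`; the lowest slab is split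
      -- off and handled by `ih`.
      obtain ⟨n, hn⟩ := exists_nat_ge ((hi i - lo i) / δ)
      rw [div_le_iff₀ hδ] at hn
      induction n generalizing lo with
      | zero =>
        refine ih lo hi hlo hhi hle fun j hj => ?_
        by_cases hji : j = i
        · subst hji; simp at hn; linarith [hle j]
        · exact h j (by simp [hji, hj])
      | succ n ihn =>
        by_cases hs : hi i - lo i ≤ δ
        · refine ih lo hi hlo hhi hle fun j hj => ?_
          by_cases hji : j = i
          · subst hji; exact hs
          · exact h j (by simp [hji, hj])
        · push Not at hs
          refine glue lo hi i (lo i + δ) hlo hhi hle (by linarith) (by linarith) ?_ ?_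
          · refine ih _ _ hlo (fun j => ?_) (fun j => ?_) fun j hj => ?_
            · by_cases hji : j = i
              · subst hji; simp; linarith [hhi j]
              · simp [hji, hhi j]
            · by_cases hji : j = i
              · subst hji; simp; linarith
              · simp [hji, hle j]
            · by_cases hji : j = i
              · subst hji; simp
              · simpa [hji] using h j (by simp [hji, hj])
          · refine ihn _ (fun j => ?_) (fun j => ?_) (fun j hj => ?_) ?_
            · by_cases hji : j = i
              · subst hji; simp; linarith [hlo j]
              · simp [hji, hlo j]
            · by_cases hji : j = i
              · subst hji; simp; linarith
              · simp [hji, hle j]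
            · have hji : j ≠ i := by rintro rfl; simp at hj
              simpa [hji] using h j hj
            · simp; push_cast at hn; linarith
  exact key Finset.univ lo₀ hi₀ le_rfl le_rfl h₀ (by simp)

/-- Maps from a cube to the base of a principal bundle lift. -/
lemma IsPrincipalBundle.exists_lift_cube (h : IsPrincipalBundle G E) {N : ℕ}
    (f : C(Fin N → ℝ, OrbitSpace G E)) :
    ∃ s : (Fin N → ℝ) → E, ContinuousOn s (Set.Icc 0 1) ∧
      ∀ x ∈ Set.Icc (0 : Fin N → ℝ) 1, orbitMk G (s x) = f x := by
  classical
  choose W hWo hWm s hs hsec using h.exists_local_section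
  -- Boxes of side at most half the Lebesgue number are mapped by `f` into the domain of a single
  -- local section.
  obtain ⟨δ, hδ, hL⟩ := lebesgue_number_lemma_of_metric (s := Set.Icc (0 : Fin N → ℝ) 1)
    (c := fun b : OrbitSpace G E => f ⁻¹' W b) isCompact_Icc
    (fun b => (hWo b).preimage f.continuous)
    (fun x _ => Set.mem_iUnion.2 ⟨f x, hWm _⟩)
  refine box_induction (fun lo hi => ∃ s : (Fin N → ℝ) → E, ContinuousOn s (Set.Icc lo hi) ∧
      ∀ x ∈ Set.Icc lo hi, orbitMk G (s x) = f x) 0 1 ?_ (half_pos hδ) ?_ (fun _ => zero_le_one)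
  · rintro lo hi i c hlo hhi hle hc1 hc2 ⟨s1, hs1, hf1⟩ ⟨s2, hs2, hf2⟩
    set A := Set.Icc lo (Function.update hi i c)
    set B := Set.Icc (Function.update lo i c) hi
    have hA : ∀ x ∈ Set.Icc lo hi, x i ≤ c → x ∈ A := fun x hx hxi => ⟨hx.1, fun j => by
      by_cases hji : j = i
      · subst hji; simpa using hxi
      · simpa [hji] using hx.2 j⟩
    have hB : ∀ x ∈ Set.Icc lo hi, c ≤ x i → x ∈ B := fun x hx hxi => ⟨fun j => by
      by_cases hji : j = i
      · subst hji; simpa using hxi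
      · simpa [hji] using hx.1 j, hx.2⟩
    have hp : ∀ x ∈ Set.Icc lo hi, Function.update x i c ∈ A ∩ B := fun x hx => by
      have : Function.update x i c ∈ Set.Icc lo hi := ⟨fun j => by
        by_cases hji : j = i
        · subst hji; simpa using hc1
        · simpa [hji] using hx.1 j, fun j => by
        by_cases hji : j = i
        · subst hji; simpa using hc2
        · simpa [hji] using hx.2 j⟩
      exact ⟨hA _ this (by simp), hB _ this (by simp)⟩
    have hBI : B ⊆ Set.Icc lo hi := fun x hx => ⟨fun j => by
        have := hx.1 j
        by_cases hji : j = i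
        · subst hji; simp at this; linarith
        · simpa [hji] using this, hx.2⟩
    have hAI : A ⊆ Set.Icc lo hi := fun x hx => ⟨hx.1, fun j => by
        have := hx.2 j
        by_cases hji : j = i
        · subst hji; simp at this; linarith
        · simpa [hji] using this⟩
    obtain ⟨g, hg, hgs⟩ := h.exists_diff (hs2.mono (Set.inter_subset_right (s := A)))
      (hs1.mono (Set.inter_subset_left (t := B)))
      (fun x hx => (hf2 x hx.2).trans (hf1 x hx.1).symm)
    have hpc : Continuous fun x : Fin N → ℝ => Function.update x i c :=
      continuous_id.update i continuous_const
    -- The lifts differ by `g` on the common wall `x i = c`. Extending `g` constantly in direction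
    -- `i` moves the second lift so that it agrees with the first one there.
    set s2' : (Fin N → ℝ) → E := fun x => g (Function.update x i c) • s2 x
    have hs2' : ContinuousOn s2' B := by
      refine ContinuousOn.smul (hg.comp hpc.continuousOn fun x hx => hp x (hBI hx)) hs2
    refine ⟨fun x => if x i ≤ c then s1 x else s2' x, ?_, fun x hx => ?_⟩
    · have hun : Set.Icc lo hi = A ∪ B := Set.Subset.antisymm
        (fun x hx => (le_total (x i) c).imp (hA x hx) (hB x hx)) (Set.union_subset hAI hBI)
      rw [hun]
      refine ContinuousOn.union_of_isClosed ?_ ?_ isClosed_Icc isClosed_Icc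
      · refine hs1.congr fun x hx => if_pos ?_
        simpa using hx.2 i
      · refine hs2'.congr fun x hx => ?_
        have hci : c ≤ x i := by simpa using hx.1 i
        by_cases hxc : x i ≤ c
        · have hxi : Function.update x i c = x := by
            rw [← le_antisymm hxc hci]; simp
          simp only [if_pos hxc, s2']
          rw [hxi]
          have hm := hp x (hBI hx)
          rw [hxi] at hm
          exact (hgs x hm).symm
        · exact if_neg hxc
    · by_cases hxc : x i ≤ c
      · simp only [if_pos hxc]; exact hf1 x (hA x hx hxc)
      · simp only [if_neg hxc, s2', orbitMk_smul]
        exact hf2 x (hB x hx (le_of_not_ge hxc))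
  · intro lo hi hlo hhi hle hd
    obtain ⟨b, hb⟩ := hL lo ⟨hlo, hle.trans hhi⟩
    have hsub : Set.Icc lo hi ⊆ f ⁻¹' W b := fun x hx => hb (by
      rw [Metric.mem_ball, dist_pi_lt_iff hδ]
      intro j
      rw [Real.dist_eq, abs_of_nonneg (sub_nonneg.2 (hx.1 j))]
      linarith [hd j, hx.2 j])
    exact ⟨fun x => s b (f x), (hs b).comp f.continuous.continuousOn hsub,
      fun x hx => hsec b _ (hsub hx)⟩

/-- The retraction of `ℝ^(n+1)` onto the standard simplex. -/
def simplexRetract (n : ℕ) : C(Fin (n + 1) → ℝ, stdSimplex ℝ (Fin (n + 1))) where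
  -- Negative coordinates are cut off; a total below `1` is topped up evenly, a total above `1` is
  -- divided out.
  toFun x := ⟨fun i => (max (x i) 0 + max 0 (1 - ∑ j, max (x j) 0) / (n + 1)) /
      max 1 (∑ j, max (x j) 0), fun i => by positivity, by
    rw [← Finset.sum_div, Finset.sum_add_distrib]
    simp only [Finset.sum_const, Finset.card_univ, Fintype.card_fin, nsmul_eq_mul]
    push_cast
    rw [mul_div_cancel₀ _ (by positivity), div_eq_one_iff_eq (by positivity)]
    rcases le_total (∑ j, max (x j) 0) 1 with h | h
    · rw [max_eq_right (by linarith), max_eq_left h]; ring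
    · rw [max_eq_left (by linarith), max_eq_right h]; ring⟩
  continuous_toFun := by
    refine Continuous.subtype_mk (continuous_pi fun i => ?_) _
    refine Continuous.div (by fun_prop) (by fun_prop) fun x => by positivity

lemma simplexRetract_apply {n : ℕ} (s : stdSimplex ℝ (Fin (n + 1))) :
    simplexRetract n (fun i => s i) = s := by
  have h : ∀ i, max (s i) 0 = s i := fun i => max_eq_left (stdSimplex.zero_le s i)
  refine stdSimplex.ext (funext fun i => ?_)
  change (max (s i) 0 + max 0 (1 - ∑ j, max (s j) 0) / (n + 1)) / max 1 (∑ j, max (s j) 0) = s i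
  simp only [h, stdSimplex.sum_eq_one]
  simp

/-- The retraction extends the simplex over a cube, where a lift exists, and the lift is restricted
back to the simplex. -/
lemma IsPrincipalBundle.exists_lift (h : IsPrincipalBundle G E) {n : ℕ}
    (σ : Simp n (OrbitSpace G E)) : ∃ σ' : Simp n E, (orbitMk G).comp σ' = σ := by
  obtain ⟨s, hs, hs'⟩ := h.exists_lift_cube (σ.comp (simplexRetract n))
  have hm : ∀ x : stdSimplex ℝ (Fin (n + 1)), (fun i => x i) ∈ Set.Icc (0 : Fin (n + 1) → ℝ) 1 :=
    fun x => ⟨fun i => stdSimplex.zero_le x i, fun i => stdSimplex.le_one x i⟩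
  have hc : Continuous fun x : stdSimplex ℝ (Fin (n + 1)) => fun i => x i :=
    continuous_subtype_val
  refine ⟨⟨fun x => s fun i => x i, hs.comp_continuous hc hm⟩, ContinuousMap.ext fun x => ?_⟩
  have := hs' _ (hm x)
  rw [ContinuousMap.comp_apply, simplexRetract_apply] at this
  exact this

lemma IsPrincipalBundle.exists_simp_diff (h : IsPrincipalBundle G E) {n : ℕ} {σ σ' : Simp n E}
    (he : (orbitMk G).comp σ = (orbitMk G).comp σ') :
    ∃ g : C(stdSimplex ℝ (Fin (n + 1)), G), ∀ x, g x • σ x = σ' x := by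
  obtain ⟨g, hg, hg'⟩ := h.exists_diff (C := Set.univ) σ.continuous.continuousOn
    σ'.continuous.continuousOn (fun x _ => DFunLike.congr_fun he x)
  exact ⟨⟨g, continuousOn_univ.1 hg⟩, fun x => hg' x trivial⟩

end Lifting

/-- Maps from a simplex to a torus lift to `ℝ^k`. -/
lemma exists_circle_lift {n : ℕ} (g : C(stdSimplex ℝ (Fin (n + 1)), Circle)) :
    ∃ θ : C(stdSimplex ℝ (Fin (n + 1)), ℝ), ∀ x, Circle.exp (2 * Real.pi * θ x) = g x := by
  obtain ⟨e₀, he₀⟩ := Circle.exp_surjective (g (simplexRetract n 0))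
  -- Extended along the retraction, the map is defined on the simply connected space `ℝ^(n+1)` and
  -- lifts through the covering `Circle.exp`.
  obtain ⟨F, ⟨-, hF⟩, -⟩ := Circle.isCoveringMap_exp.existsUnique_continuousMap_lifts
    (g.comp (simplexRetract n)) (0 : Fin (n + 1) → ℝ) e₀ he₀
  refine ⟨⟨fun x => F (fun i => x i) / (2 * Real.pi), ?_⟩, fun x => ?_⟩
  · have hc : Continuous fun x : stdSimplex ℝ (Fin (n + 1)) => fun i => x i :=
      continuous_subtype_val
    exact (F.continuous.comp hc).div_const _
  · have := congrFun hF (fun i => x i)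
    simp only [Function.comp, ContinuousMap.comp_apply, simplexRetract_apply] at this
    rw [← this]
    simp only [ContinuousMap.coe_mk]
    rw [mul_div_cancel₀ _ (by positivity)]

/-! ### Singular chains modulo 2 -/

section Chains

variable {X Y Z : Type*} [TopologicalSpace X] [TopologicalSpace Y] [TopologicalSpace Z]

/-- Singular chains with coefficients in `ℤ/2`. -/
abbrev Chain (n : ℕ) (X : Type*) [TopologicalSpace X] := Simp n X →₀ ZMod 2

lemma zmod_two_add_self {M : Type*} [AddCommGroup M] [Module (ZMod 2) M] (x : M) : x + x = 0 := by
  rw [← two_smul (ZMod 2) x, show (2 : ZMod 2) = 0 from rfl, zero_smul]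

lemma zmod_two_eq_of_add_eq_zero {M : Type*} [AddCommGroup M] [Module (ZMod 2) M] {x y : M}
    (h : x + y = 0) : x = y := by
  rw [eq_neg_of_add_eq_zero_left h, neg_eq_of_add_eq_zero_left (zmod_two_add_self y)]

/-- The terms of a double sum over faces of faces cancel in pairs. -/
lemma sum_faces_faces {M : Type*} [AddCommGroup M] [Module (ZMod 2) M] (n : ℕ) (F : ℕ → ℕ → M)
    (h : ∀ i j, j < i → i < n + 3 → F i j = F j (i - 1)) :
    ∑ i ∈ Finset.range (n + 3), ∑ j ∈ Finset.range (n + 2), F i j = 0 := by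
  rw [← Finset.sum_product']
  -- The relation between iterated faces pairs `(i, j)`, for `j < i`, with `(j, i - 1)`.
  refine Finset.sum_involution
    (fun a _ => if a.2 < a.1 then (a.2, a.1 - 1) else (a.2 + 1, a.1)) ?_ ?_ ?_ ?_
  · rintro ⟨i, j⟩ ha
    simp only [Finset.mem_product, Finset.mem_range] at ha
    by_cases hji : j < i
    · simp only [hji, if_true]
      rw [h i j hji ha.1]; exact zmod_two_add_self _
    · simp only [hji, if_false]
      rw [h (j + 1) i (by omega) (by omega), Nat.add_sub_cancel]; exact zmod_two_add_self _
  · rintro ⟨i, j⟩ ha - heq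
    by_cases hji : j < i
    · simp only [hji, if_true, Prod.mk.injEq] at heq; omega
    · simp only [hji, if_false, Prod.mk.injEq] at heq; omega
  · rintro ⟨i, j⟩ ha
    simp only [Finset.mem_product, Finset.mem_range] at ha
    by_cases hji : j < i
    · simp only [hji, if_true, Finset.mem_product, Finset.mem_range]; omega
    · simp only [hji, if_false, Finset.mem_product, Finset.mem_range]; omega
  · rintro ⟨i, j⟩ ha
    by_cases hji : j < i
    · have h1 : ¬ (i - 1 < j) := by omega
      simp only [hji, if_true, h1, if_false, Prod.mk.injEq, and_true]; omega
    · have h1 : i < j + 1 := by omega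
      simp only [hji, if_false, h1, if_true, Prod.mk.injEq, true_and]; omega

lemma Simp.face_face {n : ℕ} (σ : Simp (n + 2) X) {i j : ℕ} (hj : j < i) (hi : i < n + 3) :
    (σ.face i).face j = (σ.face j).face (i - 1) := by
  rw [face, face, face, face, pull_pull, pull_pull]
  refine pull_congr σ fun l => ?_
  have := l.2
  simp only [Function.comp, clamp]
  grind

lemma Simp.comp_face {n : ℕ} (f : C(X, Y)) (σ : Simp (n + 1) X) (i : ℕ) :
    Simp.face (f.comp σ) i = f.comp (σ.face i) := rfl

/-- The inclusion of the `i`-th face of the standard simplex. -/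
def coface (n i : ℕ) : C(stdSimplex ℝ (Fin (n + 1)), stdSimplex ℝ (Fin (n + 2))) :=
  Simp.face (ContinuousMap.id (stdSimplex ℝ (Fin (n + 2)))) i

lemma Simp.face_eq_comp {n : ℕ} (σ : Simp (n + 1) X) (i : ℕ) :
    σ.face i = σ.comp (coface n i) := rfl

/-- The boundary operator. -/
def bd {n : ℕ} : Chain (n + 1) X →ₗ[ZMod 2] Chain n X :=
  Finsupp.linearCombination (ZMod 2)
    fun σ => ∑ i ∈ Finset.range (n + 2), Finsupp.single (σ.face i) 1

lemma bd_single {n : ℕ} (σ : Simp (n + 1) X) :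
    bd (Finsupp.single σ 1) = ∑ i ∈ Finset.range (n + 2), Finsupp.single (σ.face i) (1 : ZMod 2) := by
  simp [bd]

lemma bd_bd {n : ℕ} (ζ : Chain (n + 2) X) : bd (bd ζ) = 0 := by
  refine LinearMap.congr_fun (f := bd ∘ₗ bd) (g := 0) (Finsupp.lhom_ext' fun σ =>
    LinearMap.ext_ring ?_) ζ
  simp only [LinearMap.comp_apply, Finsupp.lsingle_apply, LinearMap.zero_apply]
  rw [bd_single, map_sum]
  simp only [bd_single]
  exact sum_faces_faces n (fun i j => Finsupp.single ((σ.face i).face j) (1 : ZMod 2))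
    fun i j hj hi => by rw [Simp.face_face σ hj hi]

/-- The chain map induced by a continuous map. -/
def push {n : ℕ} (f : C(X, Y)) : Chain n X →ₗ[ZMod 2] Chain n Y :=
  Finsupp.lmapDomain (ZMod 2) (ZMod 2) fun σ => f.comp σ

@[simp] lemma push_single {n : ℕ} (f : C(X, Y)) (σ : Simp n X) (r : ZMod 2) :
    push f (Finsupp.single σ r) = Finsupp.single (f.comp σ) r := Finsupp.mapDomain_single

lemma bd_push {n : ℕ} (f : C(X, Y)) (ζ : Chain (n + 1) X) : bd (push f ζ) = push f (bd ζ) := by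
  refine LinearMap.congr_fun (f := bd ∘ₗ push f) (g := push f ∘ₗ bd)
    (Finsupp.lhom_ext' fun σ => LinearMap.ext_ring ?_) ζ
  simp only [LinearMap.comp_apply, Finsupp.lsingle_apply, push_single, bd_single, map_sum]
  rfl

lemma push_push {n : ℕ} (f : C(X, Y)) (g : C(Y, Z)) (ζ : Chain n X) :
    push g (push f ζ) = push (g.comp f) ζ := by
  refine LinearMap.congr_fun (f := push g ∘ₗ push f) (g := push (g.comp f))
    (Finsupp.lhom_ext' fun σ => LinearMap.ext_ring ?_) ζ
  simp [ContinuousMap.comp_assoc]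

lemma push_id {n : ℕ} (ζ : Chain n X) : push (ContinuousMap.id X) ζ = ζ := by
  refine LinearMap.congr_fun (f := push (ContinuousMap.id X)) (g := LinearMap.id)
    (Finsupp.lhom_ext' fun σ => LinearMap.ext_ring ?_) ζ
  simp

/-- The evaluation of a cochain on chains. -/
def pair {n : ℕ} (c : Simp n X → ZMod 2) : Chain n X →ₗ[ZMod 2] ZMod 2 :=
  Finsupp.linearCombination (ZMod 2) c

@[simp] lemma pair_single {n : ℕ} (c : Simp n X → ZMod 2) (σ : Simp n X) :
    pair c (Finsupp.single σ 1) = c σ := by simp [pair]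

lemma pair_push {n : ℕ} (c : Simp n Y → ZMod 2) (f : C(X, Y)) (ζ : Chain n X) :
    pair c (push f ζ) = pair (fun σ => c (f.comp σ)) ζ := by
  refine LinearMap.congr_fun (f := pair c ∘ₗ push f) (g := pair (fun σ => c (f.comp σ)))
    (Finsupp.lhom_ext' fun σ => LinearMap.ext_ring ?_) ζ
  simp

lemma pair_bd (a : Cochain (ZMod 2) X) (n : ℕ) (ζ : Chain (n + 1) X) :
    pair (a n) (bd ζ) = pair (Cochain.delta a (n + 1)) ζ := by
  refine LinearMap.congr_fun (f := pair (a n) ∘ₗ bd) (g := pair (Cochain.delta a (n + 1)))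
    (Finsupp.lhom_ext' fun σ => LinearMap.ext_ring ?_) ζ
  simp only [LinearMap.comp_apply, Finsupp.lsingle_apply, bd_single, map_sum, pair_single,
    Cochain.delta_succ]
  refine Finset.sum_congr rfl fun i _ => ?_
  rw [show (-1 : ZMod 2) = 1 from rfl, one_pow, one_mul]

lemma pair_bd_one (w : Simp 1 X → ZMod 2)
    (hw : ∀ σ : Simp 2 X, w (σ.face 0) + w (σ.face 1) + w (σ.face 2) = 0) (ζ : Chain 2 X) :
    pair w (bd ζ) = 0 := by
  refine LinearMap.congr_fun (f := pair w ∘ₗ bd) (g := 0)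
    (Finsupp.lhom_ext' fun σ => LinearMap.ext_ring ?_) ζ
  simp only [LinearMap.comp_apply, Finsupp.lsingle_apply, bd_single, map_sum, pair_single,
    LinearMap.zero_apply, ← hw σ]
  simp [Finset.sum_range_succ]

end Chains

/-! ### Cones and the acyclicity of contractible spaces -/

section Cone

lemma stdSimplex_map_apply {n m : ℕ} (f : Fin (m + 1) → Fin (n + 1))
    (s : stdSimplex ℝ (Fin (m + 1))) (l : Fin (n + 1)) :
    stdSimplex.map f s l = ∑ j, if f j = l then s j else 0 := by
  rw [stdSimplex.map_coe, FunOnFinite.linearMap_apply_apply, ← Finset.sum_filter]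

/-- The join of the vertex `0` and the opposite face of the standard `(n + 1)`-simplex. -/
def joinMap (n : ℕ) : C(unitInterval × stdSimplex ℝ (Fin (n + 1)), stdSimplex ℝ (Fin (n + 2))) where
  toFun p := ⟨Fin.cons (1 - p.1) fun j => p.1 * p.2 j, fun i => by
    refine Fin.cases ?_ (fun j => ?_) i
    · simpa using p.1.2.2
    · simpa using mul_nonneg p.1.2.1 (stdSimplex.zero_le p.2 j), by
    rw [Fin.sum_univ_succ]
    simp only [Fin.cons_zero, Fin.cons_succ]
    rw [← Finset.mul_sum, stdSimplex.sum_eq_one]; ring⟩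
  continuous_toFun := by
    refine Continuous.subtype_mk (continuous_pi fun i => ?_) _
    refine Fin.cases ?_ (fun j => ?_) i
    · simp only [Fin.cons_zero]; fun_prop
    · simp only [Fin.cons_succ]
      exact (continuous_subtype_val.comp continuous_fst).mul
        ((continuous_apply j).comp (continuous_subtype_val.comp continuous_snd))

lemma joinMap_zero {n : ℕ} (u : unitInterval) (x : stdSimplex ℝ (Fin (n + 1))) :
    joinMap n (u, x) 0 = 1 - u := rfl

lemma joinMap_succ {n : ℕ} (u : unitInterval) (x : stdSimplex ℝ (Fin (n + 1))) (j : Fin (n + 1)) :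
    joinMap n (u, x) j.succ = u * x j := rfl

lemma joinMap_surjective (n : ℕ) : Function.Surjective (joinMap n) := by
  intro s
  have hs : s 0 + ∑ j : Fin (n + 1), s j.succ = 1 := by
    rw [← Fin.sum_univ_succ]; exact stdSimplex.sum_eq_one s
  by_cases h : s 0 = 1
  · refine ⟨(0, stdSimplex.vertex 0), stdSimplex.ext (funext fun i => ?_)⟩
    refine Fin.cases ?_ (fun j => ?_) i
    · rw [joinMap_zero, h]; simp
    · rw [joinMap_succ]
      have h0 : ∑ j : Fin (n + 1), s j.succ = 0 := by linarith
      rw [Finset.sum_eq_zero_iff_of_nonneg fun j _ => stdSimplex.zero_le s _] at h0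
      rw [h0 j (Finset.mem_univ _)]; simp
  · have hlt : 0 < 1 - s 0 := by
      have := stdSimplex.le_one s 0
      rcases this.lt_or_eq with h' | h'
      · linarith
      · exact absurd h' h
    refine ⟨(⟨1 - s 0, hlt.le, by linarith [stdSimplex.zero_le s 0]⟩,
      ⟨fun j => s j.succ / (1 - s 0), fun j => div_nonneg (stdSimplex.zero_le s _) hlt.le, ?_⟩),
      stdSimplex.ext (funext fun i => ?_)⟩
    · rw [← Finset.sum_div, div_eq_one_iff_eq hlt.ne']; linarith
    · refine Fin.cases ?_ (fun j => ?_) i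
      · rw [joinMap_zero]; simp
      · rw [joinMap_succ]; exact mul_div_cancel₀ _ hlt.ne'

/-- A surjection from a compact space to a Hausdorff space. Cones on simplices are constructed by
descending maps along it. -/
lemma isQuotientMap_joinMap (n : ℕ) : Topology.IsQuotientMap (joinMap n) :=
  (joinMap n).continuous.isClosedMap.isQuotientMap (joinMap n).continuous (joinMap_surjective n)

lemma coface_zero {n : ℕ} (x : stdSimplex ℝ (Fin (n + 1))) : coface n 0 x = joinMap n (1, x) := by
  refine stdSimplex.ext (funext fun l => ?_)
  refine (stdSimplex_map_apply _ x l).trans ?_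
  have hc : ∀ j : Fin (n + 1), clamp (n + 1) (if (j : ℕ) < 0 then (j : ℕ) else j + 1) = j.succ :=
    fun j => Fin.ext (by simp [clamp]; omega)
  simp only [hc]
  refine Fin.cases ?_ (fun j => ?_) l
  · rw [joinMap_zero]; simp [Fin.succ_ne_zero]
  · rw [joinMap_succ]; simp

/-- A face that contains the cone vertex is again a join of that vertex with a face of the base.
This makes coning commute with faces in positive degrees. -/
lemma coface_succ {n i : ℕ} (u : unitInterval) (x : stdSimplex ℝ (Fin (n + 1))) :
    coface (n + 1) (i + 1) (joinMap n (u, x)) = joinMap (n + 1) (u, coface n i x) := by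
  refine stdSimplex.ext (funext fun l => ?_)
  refine (stdSimplex_map_apply _ _ l).trans ?_
  rw [Fin.sum_univ_succ]
  have hc0 : clamp (n + 2) (if ((0 : Fin (n + 2)) : ℕ) < i + 1 then ((0 : Fin (n + 2)) : ℕ)
      else (0 : Fin (n + 2)) + 1) = 0 := by simp [clamp]
  have hc : ∀ j : Fin (n + 1), clamp (n + 2) (if (j.succ : ℕ) < i + 1 then (j.succ : ℕ)
      else j.succ + 1) = (clamp (n + 1) (if (j : ℕ) < i then (j : ℕ) else j + 1)).succ :=
    fun j => Fin.ext (by simp only [clamp, Fin.val_succ]; grind)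
  simp only [hc, hc0]
  have hx : ∀ l, coface n i x l = ∑ j : Fin (n + 1), if clamp (n + 1)
      (if (j : ℕ) < i then (j : ℕ) else j + 1) = l then x j else 0 :=
    fun l => stdSimplex_map_apply _ x l
  refine Fin.cases ?_ (fun m => ?_) l
  · rw [joinMap_zero]; simp [Fin.succ_ne_zero, joinMap_zero]
  · rw [joinMap_succ, hx]
    simp [joinMap_succ, Finset.mul_sum, (Fin.succ_ne_zero _).symm]

variable {Z : Type*} [TopologicalSpace Z]

/-- A contraction of `Z` to a point. -/
structure Contraction (Z : Type*) [TopologicalSpace Z] where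
  pt : Z
  H : C(unitInterval × Z, Z)
  H_zero : ∀ z, H (0, z) = pt
  H_one : ∀ z, H (1, z) = z

lemma nonempty_contraction (Z : Type*) [TopologicalSpace Z] [ContractibleSpace Z] :
    Nonempty (Contraction Z) := by
  obtain ⟨p, ⟨H⟩⟩ := id_nullhomotopic Z
  exact ⟨⟨p, H.symm.toContinuousMap, fun z => by simp, fun z => by simp⟩⟩

namespace Contraction

variable (K : Contraction Z)

/-- The join identifies different points only at parameter `0`, where the contraction is constant.
-/
lemma factorsThrough_joinMap {n : ℕ} (σ : Simp n Z) : Function.FactorsThrough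
    (K.H.comp ((ContinuousMap.id unitInterval).prodMap σ)) (joinMap n) := by
  rintro ⟨u, x⟩ ⟨u', x'⟩ h
  have h0 : (u : ℝ) = u' := by
    have := DFunLike.congr_fun h 0
    rw [joinMap_zero, joinMap_zero] at this; linarith
  obtain rfl : u = u' := Subtype.ext h0
  by_cases hu : u = 0
  · subst hu
    exact (K.H_zero _).trans (K.H_zero _).symm
  · have : x = x' := stdSimplex.ext (funext fun j => by
      have := DFunLike.congr_fun h j.succ
      rw [joinMap_succ, joinMap_succ] at this
      exact mul_left_cancel₀ (fun h => hu (Subtype.ext h)) this)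
    rw [this]

/-- The cone on a singular simplex. -/
def cone {n : ℕ} (σ : Simp n Z) : Simp (n + 1) Z :=
  (isQuotientMap_joinMap n).lift _ (K.factorsThrough_joinMap σ)

lemma cone_joinMap {n : ℕ} (σ : Simp n Z) (u : unitInterval) (x : stdSimplex ℝ (Fin (n + 1))) :
    K.cone σ (joinMap n (u, x)) = K.H (u, σ x) :=
  DFunLike.congr_fun ((isQuotientMap_joinMap n).lift_comp _ (K.factorsThrough_joinMap σ)) (u, x)

lemma cone_face_zero {n : ℕ} (σ : Simp n Z) : (K.cone σ).face 0 = σ := by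
  ext x
  rw [Simp.face_eq_comp, ContinuousMap.comp_apply, coface_zero, cone_joinMap, K.H_one]

lemma cone_face_succ {n : ℕ} (σ : Simp (n + 1) Z) (i : ℕ) :
    (K.cone σ).face (i + 1) = K.cone (σ.face i) := by
  ext y
  obtain ⟨⟨u, x⟩, rfl⟩ := joinMap_surjective _ y
  rw [Simp.face_eq_comp, ContinuousMap.comp_apply, coface_succ, cone_joinMap, cone_joinMap]
  rfl

/-- On a `0`-simplex the second face of the cone is the cone point rather than a cone. This is the
source of the augmentation term in `bd_coneChain_zero`. -/
lemma cone_face_one (σ : Simp 0 Z) : (K.cone σ).face 1 = ContinuousMap.const _ K.pt := by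
  ext y
  have : coface 0 1 y = joinMap 0 (0, y) := by
    refine stdSimplex.ext (funext fun l => ?_)
    refine (stdSimplex_map_apply _ _ l).trans ?_
    fin_cases l
    · change _ = joinMap 0 (0, y) 0
      rw [joinMap_zero]; simp [clamp]
    · change _ = joinMap 0 (0, y) (Fin.succ 0)
      rw [joinMap_succ]; simp [clamp]
  rw [Simp.face_eq_comp, ContinuousMap.comp_apply, this, cone_joinMap, K.H_zero]; rfl

/-- The cone operator on chains. -/
def coneChain {n : ℕ} : Chain n Z →ₗ[ZMod 2] Chain (n + 1) Z :=
  Finsupp.lmapDomain (ZMod 2) (ZMod 2) K.cone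

@[simp] lemma coneChain_single {n : ℕ} (σ : Simp n Z) (r : ZMod 2) :
    K.coneChain (Finsupp.single σ r) = Finsupp.single (K.cone σ) r := Finsupp.mapDomain_single

/-- Face `0` of a cone returns the simplex and the other faces give the cone on its boundary, so
coning is a contracting homotopy; modulo `2` no signs occur. -/
lemma bd_coneChain {n : ℕ} (ζ : Chain (n + 1) Z) :
    bd (K.coneChain ζ) = ζ + K.coneChain (bd ζ) := by
  refine LinearMap.congr_fun (f := bd ∘ₗ K.coneChain) (g := LinearMap.id + K.coneChain ∘ₗ bd)
    (Finsupp.lhom_ext' fun σ => LinearMap.ext_ring ?_) ζ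
  simp only [LinearMap.comp_apply, Finsupp.lsingle_apply, LinearMap.add_apply, LinearMap.id_apply,
    coneChain_single, bd_single, map_sum]
  rw [Finset.sum_range_succ', cone_face_zero]
  simp only [cone_face_succ]
  exact add_comm _ _

lemma bd_coneChain_zero (ζ : Chain 0 Z) :
    bd (K.coneChain ζ) = ζ + pair (fun _ => 1) ζ •
      Finsupp.single (ContinuousMap.const _ K.pt : Simp 0 Z) (1 : ZMod 2) := by
  refine LinearMap.congr_fun (f := bd ∘ₗ K.coneChain) (g := LinearMap.id +
    (pair fun _ => 1).smulRight (Finsupp.single (ContinuousMap.const _ K.pt : Simp 0 Z) 1))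
    (Finsupp.lhom_ext' fun σ => LinearMap.ext_ring ?_) ζ
  simp only [LinearMap.comp_apply, Finsupp.lsingle_apply, LinearMap.add_apply, LinearMap.id_apply,
    coneChain_single, bd_single, LinearMap.smulRight_apply, pair_single]
  simp [Finset.sum_range_succ, cone_face_zero, cone_face_one]

end Contraction

variable [ContractibleSpace Z]

lemma exists_bd_eq {n : ℕ} (ζ : Chain (n + 1) Z) (h : bd ζ = 0) : ∃ ξ, bd ξ = ζ := by
  obtain ⟨K⟩ := nonempty_contraction Z
  exact ⟨K.coneChain ζ, by rw [K.bd_coneChain, h, map_zero, add_zero]⟩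

lemma exists_bd_eq_zero (ζ : Chain 0 Z) (h : pair (fun _ => 1) ζ = 0) : ∃ ξ, bd ξ = ζ := by
  obtain ⟨K⟩ := nonempty_contraction Z
  exact ⟨K.coneChain ζ, by rw [K.bd_coneChain_zero, h, zero_smul, add_zero]⟩

/-- The primitive is the value of `w` on the cone over a point; the cocycle relation on the cone
over `η` is the required identity. -/
lemma exists_primitive (w : Simp 1 Z → ZMod 2)
    (hw : ∀ σ : Simp 2 Z, w (σ.face 0) + w (σ.face 1) + w (σ.face 2) = 0) :
    ∃ g : Simp 0 Z → ZMod 2, ∀ η, w η = g (η.face 0) + g (η.face 1) := by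
  obtain ⟨K⟩ := nonempty_contraction Z
  refine ⟨fun σ => w (K.cone σ), fun η => ?_⟩
  have := hw (K.cone η)
  rw [K.cone_face_zero, K.cone_face_succ, K.cone_face_succ η 1, add_assoc] at this
  exact zmod_two_eq_of_add_eq_zero this

end Cone

instance (n : ℕ) : ContractibleSpace (stdSimplex ℝ (Fin (n + 1))) :=
  (convex_stdSimplex ℝ _).contractibleSpace ⟨_, (stdSimplex.vertex 0 : stdSimplex ℝ (Fin (n + 1))).2⟩

lemma exists_int_const {X : Type*} [TopologicalSpace X] [PreconnectedSpace X] [Nonempty X]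
    (θ : C(X, ℝ)) (h : ∀ x, ∃ n : ℤ, θ x = n) : ∃ n : ℤ, ∀ x, θ x = n := by
  choose f hf using h
  have hc : Continuous f := by
    rw [Int.isClosedEmbedding_coe_real.isInducing.continuous_iff]
    exact θ.continuous.congr hf
  obtain ⟨x₀⟩ := ‹Nonempty X›
  exact ⟨f x₀, fun x => by rw [hf, PreconnectedSpace.constant ‹_› hc (x := x) (y := x₀)]⟩

/-! ### Circle bundles with vanishing Euler class modulo 2 -/

section FlowQuotient

variable {Y B : Type*} [TopologicalSpace Y] [TopologicalSpace B]

/-- `q : Y → B` behaves on singular simplices like the orbit map of a flow on `Y` all of whose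
orbits are circles of period `1`. -/
structure IsFlowQuotient (q : C(Y, B)) (act : C(ℝ × Y, Y)) : Prop where
  zero : ∀ y, act (0, y) = y
  add : ∀ a b y, act (a + b, y) = act (a, act (b, y))
  proj : ∀ a y, q (act (a, y)) = q y
  period : ∀ y, act (1, y) = y
  free : ∀ a y, act (a, y) = y → ∃ n : ℤ, a = n
  lift : ∀ n (σ : Simp n B), ∃ σ' : Simp n Y, q.comp σ' = σ
  diff : ∀ n (η η' : Simp n Y), q.comp η = q.comp η' →
    ∃ θ : C(stdSimplex ℝ (Fin (n + 1)), ℝ), ∀ x, act (θ x, η x) = η' x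

/-- Translation by `a` in the second factor. -/
def shift (X : Type*) [TopologicalSpace X] (a : ℝ) : C(X × ℝ, X × ℝ) :=
  ⟨fun p => (p.1, p.2 + a), by fun_prop⟩

lemma shift_comp_shift {X : Type*} [TopologicalSpace X] (a b : ℝ) :
    (shift X a).comp (shift X b) = shift X (a + b) := by
  ext p
  · rfl
  · change p.2 + b + a = p.2 + (a + b)
    ring

lemma shift_zero {X : Type*} [TopologicalSpace X] : shift X 0 = ContinuousMap.id _ := by
  ext p <;> simp [shift]

/-- A simplex of `Δ^m × Y` lies in the pullback of `q : Y → B` along `σ : Δ^m → B`. -/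
def Over (q : C(Y, B)) {m : ℕ} (σ : Simp m B) {j : ℕ}
    (η : Simp j (stdSimplex ℝ (Fin (m + 1)) × Y)) : Prop := ∀ x, q (η x).2 = σ (η x).1

/-- All simplices of a chain of `Δ^m × Y` lie in the pullback of `q` along `σ`. -/
def OverChain (q : C(Y, B)) {m : ℕ} (σ : Simp m B) {j : ℕ}
    (ζ : Chain j (stdSimplex ℝ (Fin (m + 1)) × Y)) : Prop := ∀ η ∈ ζ.support, Over q σ η

lemma OverChain.add {q : C(Y, B)} {m : ℕ} {σ : Simp m B} {j : ℕ}
    {ζ ζ' : Chain j (stdSimplex ℝ (Fin (m + 1)) × Y)} (h : OverChain q σ ζ)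
    (h' : OverChain q σ ζ') : OverChain q σ (ζ + ζ') := fun η hη => by
  classical
  rcases Finset.mem_union.1 (Finsupp.support_add hη) with h1 | h1
  exacts [h η h1, h' η h1]

lemma OverChain.sum {q : C(Y, B)} {m : ℕ} {σ : Simp m B} {j : ℕ} {ι : Type*} (s : Finset ι)
    {ζ : ι → Chain j (stdSimplex ℝ (Fin (m + 1)) × Y)} (h : ∀ i ∈ s, OverChain q σ (ζ i)) :
    OverChain q σ (∑ i ∈ s, ζ i) := by
  classical
  induction s using Finset.induction_on with
  | empty => intro η hη; simp at hη
  | insert i s hi ih =>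
    rw [Finset.sum_insert hi]
    exact (h i (by simp)).add (ih fun j hj => h j (by simp [hj]))

lemma OverChain.single {q : C(Y, B)} {m : ℕ} {σ : Simp m B} {j : ℕ}
    {η : Simp j (stdSimplex ℝ (Fin (m + 1)) × Y)} (h : Over q σ η) :
    OverChain q σ (Finsupp.single η 1) := fun η' hη' => by
  rw [Finset.mem_singleton.1 (Finsupp.support_single_subset hη')]; exact h

lemma OverChain.push {q : C(Y, B)} {m l : ℕ} {σ : Simp m B} {τ : Simp l B} {j : ℕ}
    {ζ : Chain j (stdSimplex ℝ (Fin (l + 1)) × Y)} (h : OverChain q τ ζ)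
    (f : C(stdSimplex ℝ (Fin (l + 1)) × Y, stdSimplex ℝ (Fin (m + 1)) × Y))
    (hf : ∀ η : Simp j _, Over q τ η → Over q σ (f.comp η)) : OverChain q σ (push f ζ) := by
  classical
  intro η hη
  obtain ⟨η', h', rfl⟩ := Finset.mem_image.1 (Finsupp.mapDomain_support hη)
  exact hf η' (h η' h')

lemma OverChain.bd {q : C(Y, B)} {m : ℕ} {σ : Simp m B} {j : ℕ}
    {ζ : Chain (j + 1) (stdSimplex ℝ (Fin (m + 1)) × Y)} (h : OverChain q σ ζ) :
    OverChain q σ (bd ζ) := by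
  have : EquivClass.bd ζ = ∑ η ∈ ζ.support, ∑ i ∈ Finset.range (j + 2),
      Finsupp.single (η.face i) (1 : ZMod 2) := by
    rw [EquivClass.bd, Finsupp.linearCombination_apply, Finsupp.sum]
    refine Finset.sum_congr rfl fun η hη => ?_
    have h1 : ∀ a : ZMod 2, a ≠ 0 → a = 1 := by decide
    rw [h1 _ (Finsupp.mem_support_iff.1 hη), one_smul]
  rw [this]
  exact OverChain.sum _ fun η hη => OverChain.sum _ fun i _ => OverChain.single
    fun x => h η hη (coface j i x)

namespace IsFlowQuotient

variable {q : C(Y, B)} {act : C(ℝ × Y, Y)}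

/-- The trivialization of the pullback of `q` along `q ∘ σ`, up to integer translations. -/
def triv (act : C(ℝ × Y, Y)) {m : ℕ} (σ : Simp m Y) :
    C(stdSimplex ℝ (Fin (m + 1)) × ℝ, stdSimplex ℝ (Fin (m + 1)) × Y) :=
  ⟨fun p => (p.1, act (p.2, σ p.1)), by fun_prop⟩

variable {m : ℕ} (σ : Simp m Y)

lemma over_triv (h : IsFlowQuotient q act) {j : ℕ} (η : Simp j (stdSimplex ℝ (Fin (m + 1)) × ℝ)) :
    Over q (q.comp σ) ((triv act σ).comp η) := fun _ => h.proj _ _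

lemma overChain_push_triv (h : IsFlowQuotient q act) {j : ℕ}
    (ζ : Chain j (stdSimplex ℝ (Fin (m + 1)) × ℝ)) :
    OverChain q (q.comp σ) (push (triv act σ) ζ) := by
  classical
  intro η hη
  obtain ⟨η', -, rfl⟩ := Finset.mem_image.1 (Finsupp.mapDomain_support hη)
  exact h.over_triv σ η'

/-- `triv` presents the pullback of `q` along `q ∘ σ` as the quotient of `Δ^m × ℝ` by integer
translations; the height of the lift is the angle supplied by `diff`. -/
lemma exists_triv_lift (h : IsFlowQuotient q act) {j : ℕ}
    {η : Simp j (stdSimplex ℝ (Fin (m + 1)) × Y)} (hη : Over q (q.comp σ) η) :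
    ∃ η', (triv act σ).comp η' = η := by
  obtain ⟨θ, hθ⟩ := h.diff j (σ.comp (ContinuousMap.fst.comp η)) (ContinuousMap.snd.comp η)
    (ContinuousMap.ext fun x => (hη x).symm)
  exact ⟨(ContinuousMap.fst.comp η).prodMk θ, ContinuousMap.ext fun x => Prod.ext rfl (hθ x)⟩

lemma exists_chain_lift (h : IsFlowQuotient q act) {j : ℕ}
    {ζ : Chain j (stdSimplex ℝ (Fin (m + 1)) × Y)} (hζ : OverChain q (q.comp σ) ζ) :
    ∃ ζ', push (triv act σ) ζ' = ζ := by
  classical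
  have hex : ∀ η : Simp j (stdSimplex ℝ (Fin (m + 1)) × Y), ∃ η',
      Over q (q.comp σ) η → (triv act σ).comp η' = η := fun η => by
    by_cases hη : Over q (q.comp σ) η
    · obtain ⟨η', h'⟩ := h.exists_triv_lift σ hη; exact ⟨η', fun _ => h'⟩
    · exact ⟨ContinuousMap.const _ (stdSimplex.vertex 0, 0), fun h => absurd h hη⟩
  choose L hL using hex
  refine ⟨Finsupp.mapDomain L ζ, ?_⟩
  change Finsupp.mapDomain _ (Finsupp.mapDomain L ζ) = ζ
  rw [← Finsupp.mapDomain_comp]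
  conv_rhs => rw [← Finsupp.mapDomain_id (v := ζ)]
  exact Finsupp.mapDomain_congr fun η hη => hL η (hζ η hη)

lemma triv_comp_shift (h : IsFlowQuotient q act) :
    (triv act σ).comp (shift _ 1) = triv act σ := by
  ext p
  · rfl
  · change act (p.2 + 1, σ p.1) = act (p.2, σ p.1)
    rw [h.add, h.period]

/-- By `free` the difference of the two heights is an integer at every point, and it is constant
because a simplex is connected. -/
lemma exists_shift_of_triv_eq (h : IsFlowQuotient q act) {j : ℕ}
    {η η' : Simp j (stdSimplex ℝ (Fin (m + 1)) × ℝ)}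
    (he : (triv act σ).comp η = (triv act σ).comp η') :
    ∃ n : ℤ, η' = (shift _ (n : ℝ)).comp η := by
  have h1 : ∀ x, (η x).1 = (η' x).1 := fun x =>
    congrArg (fun f => (f x).1) he
  have h2 : ∀ x, act ((η x).2, σ (η x).1) = act ((η' x).2, σ (η' x).1) :=
    fun x => congrArg (fun f => (f x).2) he
  obtain ⟨n, hn⟩ := exists_int_const
    (⟨fun x => (η' x).2 - (η x).2, by fun_prop⟩ : C(stdSimplex ℝ (Fin (j + 1)), ℝ)) fun x => by
      refine h.free _ (act ((η x).2, σ (η x).1)) ?_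
      have h3 := h2 x
      rw [← h1 x] at h3
      rw [← h.add]
      change act ((η' x).2 - (η x).2 + (η x).2, _) = _
      rw [sub_add_cancel, ← h3]
  refine ⟨n, ContinuousMap.ext fun x => Prod.ext (h1 x).symm ?_⟩
  have := hn x
  change (η' x).2 = (η x).2 + n
  rw [← this]; simp

/-- The kernel of the projection from chains of the covering consists of the chains
`ξ + tξ`, where `t` is the generating translation. -/
lemma exists_of_push_triv_eq_zero (h : IsFlowQuotient q act) {j : ℕ}
    {ζ : Chain j (stdSimplex ℝ (Fin (m + 1)) × ℝ)} (hζ : push (triv act σ) ζ = 0) :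
    ∃ ξ, ζ = ξ + push (shift _ 1) ξ := by
  classical
  let Z := stdSimplex ℝ (Fin (m + 1)) × ℝ
  let D : Chain j Z →ₗ[ZMod 2] Chain j Z := LinearMap.id + push (shift _ 1)
  -- Integer translates of a simplex agree modulo the image of `1 + t`, by telescoping in unit
  -- steps.
  have hstep : ∀ (n : ℤ) (η : Simp j Z), Finsupp.single ((shift _ (n : ℝ)).comp η) (1 : ZMod 2) +
      Finsupp.single η 1 ∈ LinearMap.range D := by
    have hone : ∀ η : Simp j Z, Finsupp.single ((shift _ 1).comp η) (1 : ZMod 2) +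
        Finsupp.single η 1 ∈ LinearMap.range D := fun η =>
      ⟨Finsupp.single η 1, by simp [D, add_comm]⟩
    intro n
    induction n using Int.induction_on with
    | zero =>
      intro η
      rw [Int.cast_zero, shift_zero, ContinuousMap.id_comp, zmod_two_add_self]
      exact zero_mem _
    | succ i ih =>
      intro η
      have := add_mem (ih ((shift _ 1).comp η)) (hone η)
      rw [← ContinuousMap.comp_assoc, shift_comp_shift] at this
      rw [show ∀ a b c : Chain j Z, a + b + (b + c) = (a + c) + (b + b) from fun a b c => by abel,
        zmod_two_add_self, add_zero] at this
      simpa using this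
    | pred i ih =>
      intro η
      have := add_mem (ih ((shift _ (-1)).comp η)) (hone ((shift _ (-1)).comp η))
      rw [← ContinuousMap.comp_assoc, shift_comp_shift, ← ContinuousMap.comp_assoc,
        shift_comp_shift, add_neg_cancel, shift_zero, ContinuousMap.id_comp] at this
      rw [show ∀ a b c : Chain j Z, a + b + (c + b) = (a + c) + (b + b) from fun a b c => by abel,
        zmod_two_add_self, add_zero] at this
      simpa [sub_eq_add_neg] using this
  -- `R` will choose one preimage of each simplex. Replacing every simplex of `ζ` by the chosen one
  -- changes `ζ` by an element of the image of `1 + t`, and gives `0` if the projection of `ζ` is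
  -- `0`.
  have hex : ∀ η : Simp j (stdSimplex ℝ (Fin (m + 1)) × Y), ∃ η' : Simp j Z,
      ∀ η'', (triv act σ).comp η'' = η → (triv act σ).comp η' = η := fun η => by
    by_cases hη : ∃ η', (triv act σ).comp η' = η
    · obtain ⟨η', h'⟩ := hη; exact ⟨η', fun _ _ => h'⟩
    · exact ⟨ContinuousMap.const _ (stdSimplex.vertex 0, 0), fun η'' h => absurd ⟨η'', h⟩ hη⟩
  choose R hR using hex
  have key : ∀ ζ : Chain j Z, Finsupp.mapDomain R (push (triv act σ) ζ) + ζ ∈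
      LinearMap.range D := by
    intro ζ
    induction ζ using Finsupp.induction_linear with
    | zero => simp
    | add a b ha hb =>
      have := add_mem ha hb
      rw [map_add, Finsupp.mapDomain_add]
      rwa [show ∀ a b c d : Chain j Z, a + b + (c + d) = a + c + (b + d) from
        fun a b c d => by abel] at this
    | single η r =>
      have h1 : ∀ r : ZMod 2, r = 0 ∨ r = 1 := by decide
      rcases h1 r with rfl | rfl
      · simp
      · rw [push_single, Finsupp.mapDomain_single]
        obtain ⟨n, hn⟩ := h.exists_shift_of_triv_eq σ (hR _ η rfl).symm
        rw [hn]
        exact hstep n η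
  have := key ζ
  rw [hζ, Finsupp.mapDomain_zero, zero_add] at this
  obtain ⟨ξ, hξ⟩ := this
  exact ⟨ξ, hξ.symm⟩

/-- `1 + t` is injective: the support of a chain in its kernel is closed under upward translation,
but it is finite, so it would have a simplex with highest initial vertex. -/
lemma eq_zero_of_add_shift_eq_zero {X : Type*} [TopologicalSpace X] {j : ℕ}
    {ξ : Chain j (X × ℝ)} (hξ : ξ + push (shift _ 1) ξ = 0) : ξ = 0 := by
  classical
  by_contra hne
  obtain ⟨η, hη, hmax⟩ := ξ.support.exists_max_image (fun η => (η (stdSimplex.vertex 0)).2)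
    (Finsupp.support_nonempty_iff.2 hne)
  have hinj : Function.Injective fun η : Simp j (X × ℝ) => (shift X 1).comp η := fun a b hab => by
    have := congrArg ((shift X (-1)).comp ·) hab
    simpa only [← ContinuousMap.comp_assoc, shift_comp_shift, neg_add_cancel, shift_zero,
      ContinuousMap.id_comp] using this
  have heq : ξ ((shift X 1).comp η) = ξ η := by
    conv_lhs => rw [zmod_two_eq_of_add_eq_zero hξ]
    exact Finsupp.mapDomain_apply hinj ξ η
  have := hmax ((shift X 1).comp η) (by
    rw [Finsupp.mem_support_iff, heq]; exact Finsupp.mem_support_iff.1 hη)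
  have h2 : (((shift X 1).comp η) (stdSimplex.vertex 0)).2 = (η (stdSimplex.vertex 0)).2 + 1 := rfl
  rw [h2] at this
  linarith

/-- A primitive `w` of the class of a circle: a cocycle with value `1` on the orbits. -/
structure IsOrbitCocycle (act : C(ℝ × Y, Y)) (w : Simp 1 Y → ZMod 2) : Prop where
  cocycle : ∀ σ : Simp 2 Y, w (σ.face 0) + w (σ.face 1) + w (σ.face 2) = 0
  loop : ∀ (y : Y) (γ : Simp 1 Y), (∀ s, γ s = act (s 1, y)) → w γ = 1

/-- The chain is a cycle. -/
def IsCycleChain {X : Type*} [TopologicalSpace X] : ∀ j : ℕ, Chain j X → Prop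
  | 0, _ => True
  | _ + 1, ζ => bd ζ = 0

/-- If the chain has degree `1`, then `w` vanishes on it. -/
def VanishesOn (w : Simp 1 Y → ZMod 2) {X : Type*} [TopologicalSpace X] :
    ∀ j : ℕ, Chain j (X × Y) → Prop
  | 1, ζ => pair (fun η => w (ContinuousMap.snd.comp η)) ζ = 0
  | _, _ => True

lemma IsCycleChain.add_bd {X : Type*} [TopologicalSpace X] {j : ℕ} {ζ : Chain j X}
    (h : IsCycleChain j ζ) (β : Chain (j + 1) X) : IsCycleChain j (ζ + bd β) := by
  match j, ζ, β, h with
  | 0, _, _, _ => trivial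
  | j + 1, ζ, β, h =>
    change bd (ζ + bd β) = 0
    rw [map_add, bd_bd, add_zero]; exact h

lemma VanishesOn.add_bd {w : Simp 1 Y → ZMod 2} {X : Type*} [TopologicalSpace X]
    (hw : ∀ σ : Simp 2 Y, w (σ.face 0) + w (σ.face 1) + w (σ.face 2) = 0) {j : ℕ}
    {ζ : Chain j (X × Y)} (h : VanishesOn w j ζ) (β : Chain (j + 1) (X × Y)) :
    VanishesOn w j (ζ + bd β) := by
  match j, ζ, β, h with
  | 0, _, _, _ => trivial
  | 1, ζ, β, h =>
    change pair _ _ = 0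
    rw [map_add, pair_bd_one (fun η => w (ContinuousMap.snd.comp η))
      (fun η => hw (ContinuousMap.snd.comp η)), add_zero]
    exact h
  | j + 2, _, _, _ => trivial

/-- The homology of a circle times a simplex, read off from the cover `Δ^m × ℝ` with its unit
translation `t`. If the image of `κ` is a cycle of positive degree, then `bd κ = ξ + tξ`. As soon as
`ξ = bd μ`, the chain `κ + μ + tμ` is a cycle in a contractible space, and it has the same image as
`κ`. The hypotheses on the projection and on `w` remove the obstructions in degrees `0` and `1`. -/
lemma exists_primitive_chain (h : IsFlowQuotient q act) {w : Simp 1 Y → ZMod 2}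
    (hw : IsOrbitCocycle act w) {j : ℕ} {κ : Chain j (stdSimplex ℝ (Fin (m + 1)) × ℝ)}
    (hfst : push ContinuousMap.fst κ = 0) (hκ : IsCycleChain j (push (triv act σ) κ))
    (hv : VanishesOn w j (push (triv act σ) κ)) :
    ∃ β : Chain (j + 1) (stdSimplex ℝ (Fin (m + 1)) × ℝ), push ContinuousMap.fst (bd β) = 0 ∧
      push (triv act σ) (bd β) = push (triv act σ) κ := by
  have hfs : ∀ {i : ℕ} (μ : Chain i (stdSimplex ℝ (Fin (m + 1)) × ℝ)),
      push ContinuousMap.fst (push (shift _ 1) μ) = push ContinuousMap.fst μ := fun μ => by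
    rw [push_push]; rfl
  have main : ∀ {i : ℕ} (κ : Chain (i + 1) (stdSimplex ℝ (Fin (m + 1)) × ℝ))
      (_ : push ContinuousMap.fst κ = 0)
      (_ : ∃ μ : Chain (i + 1) (stdSimplex ℝ (Fin (m + 1)) × ℝ),
        bd κ = bd μ + push (shift _ 1) (bd μ)),
      ∃ β : Chain (i + 2) (stdSimplex ℝ (Fin (m + 1)) × ℝ), push ContinuousMap.fst (bd β) = 0 ∧
        push (triv act σ) (bd β) = push (triv act σ) κ := by
    rintro i κ hfst ⟨μ, hμ⟩
    obtain ⟨β, hβ⟩ := exists_bd_eq (κ + (μ + push (shift _ 1) μ)) (by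
      rw [map_add, map_add, bd_push, hμ, zmod_two_add_self])
    refine ⟨β, ?_, ?_⟩
    · rw [hβ, map_add, map_add, hfst, hfs, zmod_two_add_self, zero_add]
    · rw [hβ, map_add, map_add, push_push (shift _ 1), h.triv_comp_shift, zmod_two_add_self,
        add_zero]
  match j, κ, hfst, hκ, hv with
  | 0, κ, hfst, _, _ =>
    obtain ⟨β, hβ⟩ := exists_bd_eq_zero κ (by
      have := pair_push (fun _ => (1 : ZMod 2)) ContinuousMap.fst κ
      rw [hfst, map_zero] at this
      exact this.symm)
    exact ⟨β, by rw [hβ, hfst], by rw [hβ]⟩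
  -- Here `ξ` is a `0`-chain, and it bounds exactly when it has an even number of simplices. This
  -- parity is the value of `w` on the image of `κ`.
  | 1, κ, hfst, h1, h2 =>
    refine main κ hfst ?_
    change bd _ = 0 at h1
    change pair _ _ = 0 at h2
    rw [bd_push] at h1
    obtain ⟨ξ, hξ⟩ := h.exists_of_push_triv_eq_zero σ h1
    obtain ⟨g, hg⟩ := exists_primitive
      (fun η : Simp 1 (stdSimplex ℝ (Fin (m + 1)) × ℝ) =>
        w (ContinuousMap.snd.comp ((triv act σ).comp η))) fun η =>
          hw.cocycle (ContinuousMap.snd.comp ((triv act σ).comp η))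
    have hgb : ∀ κ : Chain 1 (stdSimplex ℝ (Fin (m + 1)) × ℝ),
        pair (fun η => w (ContinuousMap.snd.comp ((triv act σ).comp η))) κ = pair g (bd κ) := by
      refine fun κ => LinearMap.congr_fun (g := pair g ∘ₗ bd)
        (Finsupp.lhom_ext' fun η => LinearMap.ext_ring ?_) κ
      simp [bd_single, hg, Finset.sum_range_succ]
    -- The primitive `g` of `w` on the cover jumps by `1` under translation, since the vertical unit
    -- path maps to a full orbit.
    have hgs : ∀ z : Simp 0 (stdSimplex ℝ (Fin (m + 1)) × ℝ),
        g ((shift _ 1).comp z) = g z + 1 := fun z => by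
      set x₀ : stdSimplex ℝ (Fin 1) := stdSimplex.vertex 0
      have hz : ∀ x, z x = z x₀ := fun x => congrArg z (Subsingleton.elim _ _)
      let γ : Simp 1 (stdSimplex ℝ (Fin (m + 1)) × ℝ) :=
        ⟨fun s => ((z x₀).1, (z x₀).2 + s 1), by
          have : Continuous fun s : stdSimplex ℝ (Fin 2) => s 1 :=
            (continuous_apply (1 : Fin 2)).comp continuous_subtype_val
          exact continuous_const.prodMk (continuous_const.add this)⟩
      have h01 : ∀ x : stdSimplex ℝ (Fin 1), coface 0 0 x 1 = 1 ∧ coface 0 1 x 1 = 0 := fun x => by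
        constructor
        · refine (stdSimplex_map_apply _ _ _).trans ?_
          simp [clamp]
        · refine (stdSimplex_map_apply _ _ _).trans ?_
          simp [clamp]
      have e0 : γ.face 0 = (shift _ 1).comp z := ContinuousMap.ext fun x => by
        change ((z x₀).1, (z x₀).2 + coface 0 0 x 1) = ((z x).1, (z x).2 + 1)
        rw [(h01 x).1, hz x]
      have e1 : γ.face 1 = z := ContinuousMap.ext fun x => by
        change ((z x₀).1, (z x₀).2 + coface 0 1 x 1) = z x
        rw [(h01 x).2, hz x, add_zero]
      have h3 := hg γ
      rw [e0, e1] at h3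
      have h4 := hw.loop (act ((z x₀).2, σ (z x₀).1))
        (ContinuousMap.snd.comp ((triv act σ).comp γ)) fun s => by
          refine Eq.trans ?_ (h.add _ _ _)
          exact congrArg (fun a => act (a, σ (z x₀).1)) (add_comm _ _)
      rw [h4] at h3
      rw [h3]
      generalize g _ = a
      generalize g z = b
      revert a b; decide
    have hcount : pair (fun _ => 1) ξ = 0 := by
      rw [pair_push, hgb, hξ, map_add, pair_push] at h2
      have h5 : pair (fun z => g ((shift _ 1).comp z)) ξ = pair g ξ + pair (fun _ => 1) ξ := by
        refine LinearMap.congr_fun (f := pair _) (g := pair g + pair (fun _ => 1))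
          (Finsupp.lhom_ext' fun z => LinearMap.ext_ring ?_) ξ
        simp [hgs]
      rwa [h5, ← add_assoc, zmod_two_add_self, zero_add] at h2
    obtain ⟨μ, rfl⟩ := exists_bd_eq_zero ξ hcount
    exact ⟨μ, hξ⟩
  | j + 2, κ, hfst, h1, _ =>
    refine main κ hfst ?_
    change bd _ = 0 at h1
    rw [bd_push] at h1
    obtain ⟨ξ, hξ⟩ := h.exists_of_push_triv_eq_zero σ h1
    -- `bd ξ + t (bd ξ) = bd (bd κ) = 0`, and `1 + t` is injective.
    have hξ0 : bd ξ = 0 := by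
      refine eq_zero_of_add_shift_eq_zero ?_
      rw [← bd_push, ← map_add, ← hξ, bd_bd]
    obtain ⟨μ, rfl⟩ := exists_bd_eq ξ hξ0
    exact ⟨μ, hξ⟩

/-- After adding the boundary of the graph of a lift of `σ`, the chain `κ` lifts to the cover with
zero projection to the simplex, and `exists_primitive_chain` applies. The control of `w` on the
filling in degree `1` is what allows the next degree to be filled. -/
lemma exists_filling (h : IsFlowQuotient q act) {w : Simp 1 Y → ZMod 2}
    (hw : IsOrbitCocycle act w) {j : ℕ} (σ : Simp (j + 1) B)
    {κ : Chain j (stdSimplex ℝ (Fin (j + 2)) × Y)} (hover : OverChain q σ κ)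
    (hfst : push ContinuousMap.fst κ = bd (Finsupp.single (ContinuousMap.id _) 1))
    (hκ : IsCycleChain j κ) (hv : VanishesOn w j κ) :
    ∃ β : Chain (j + 1) (stdSimplex ℝ (Fin (j + 2)) × Y), OverChain q σ β ∧
      push ContinuousMap.fst β = Finsupp.single (ContinuousMap.id _) 1 ∧ bd β = κ ∧
      VanishesOn w (j + 1) β := by
  obtain ⟨σ, rfl⟩ := h.lift _ σ
  set G : Simp (j + 1) (stdSimplex ℝ (Fin (j + 2)) × Y) := (ContinuousMap.id _).prodMk σ
  have hG : Over q (q.comp σ) G := fun _ => rfl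
  have hGf : push ContinuousMap.fst (Finsupp.single G 1) =
      Finsupp.single (ContinuousMap.id _) (1 : ZMod 2) := push_single _ _ _
  obtain ⟨κ', hκ'⟩ := h.exists_chain_lift σ (hover.add (OverChain.single hG).bd)
  have hpf : ∀ {i : ℕ} (ζ : Chain i (stdSimplex ℝ (Fin (j + 2)) × ℝ)),
      push ContinuousMap.fst (push (triv act σ) ζ) = push ContinuousMap.fst ζ := fun ζ => by
    rw [push_push]; rfl
  have hf' : push ContinuousMap.fst κ' = 0 := by
    rw [← hpf, hκ', map_add, hfst, ← bd_push, hGf, zmod_two_add_self]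
  obtain ⟨β, hβ1, hβ2⟩ := h.exists_primitive_chain σ hw hf' (by rw [hκ']; exact hκ.add_bd _)
    (by rw [hκ']; exact hv.add_bd hw.cocycle _)
  rw [hκ'] at hβ2
  -- The projection of `β` to the simplex is a cycle, hence equal to `bd ν`. Adding the boundary of
  -- `ν` placed at height `0` kills the projection and leaves `bd β` unchanged.
  obtain ⟨ν, hν⟩ := exists_bd_eq (push ContinuousMap.fst β) (by rw [bd_push, hβ1])
  let i₀ : C(stdSimplex ℝ (Fin (j + 2)), stdSimplex ℝ (Fin (j + 2)) × ℝ) :=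
    (ContinuousMap.id _).prodMk (ContinuousMap.const _ 0)
  set β' := β + bd (push i₀ ν)
  have hβ'f : push ContinuousMap.fst β' = 0 := by
    have : push ContinuousMap.fst (push i₀ ν) = ν := by rw [push_push]; exact push_id ν
    rw [map_add, ← bd_push, this, hν, zmod_two_add_self]
  have hβ'b : push (triv act σ) (bd β') = κ + bd (Finsupp.single G 1) := by
    rw [map_add, bd_bd, add_zero, hβ2]
  have main : ∀ μ : Chain (j + 1) (stdSimplex ℝ (Fin (j + 2)) × ℝ), push ContinuousMap.fst μ = 0 →
      push (triv act σ) (bd μ) = 0 → VanishesOn w (j + 1)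
        (Finsupp.single G 1 + push (triv act σ) β' + push (triv act σ) μ) →
      ∃ β : Chain (j + 1) (stdSimplex ℝ (Fin (j + 2)) × Y), OverChain q (q.comp σ) β ∧
      push ContinuousMap.fst β = Finsupp.single (ContinuousMap.id _) 1 ∧ bd β = κ ∧
      VanishesOn w (j + 1) β := fun μ h1 h2 h3 =>
    ⟨_, ((OverChain.single hG).add (h.overChain_push_triv σ _)).add (h.overChain_push_triv σ _),
      by rw [map_add, map_add, hGf, hpf, hpf, hβ'f, h1, add_zero, add_zero],
      by rw [map_add, map_add, bd_push, bd_push, hβ'b, h2, add_zero, add_left_comm,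
        zmod_two_add_self, add_zero], h3⟩
  cases j with
  | succ j => exact main 0 (map_zero _) (by rw [map_zero, map_zero]) trivial
  | zero =>
    have h01 : ∀ a : ZMod 2, a = 0 ∨ a = 1 := by decide
    rcases h01 (pair (fun η => w (ContinuousMap.snd.comp η))
      (Finsupp.single G 1 + push (triv act σ) β')) with h0 | h1
    · refine main 0 (map_zero _) (by rw [map_zero, map_zero]) ?_
      change pair _ _ = 0
      rw [map_zero, add_zero, h0]
    -- If `w` has the wrong value, a full orbit `γ` and a constant path `ε` are added. Together
    -- their image has no boundary and projects to `0`, and it changes the value of `w` by `1`.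
    · set x₀ : stdSimplex ℝ (Fin 2) := stdSimplex.vertex 0
      let γ : Simp 1 (stdSimplex ℝ (Fin 2) × ℝ) := ⟨fun s => (x₀, s 1),
        continuous_const.prodMk ((continuous_apply (1 : Fin 2)).comp continuous_subtype_val)⟩
      let ε : Simp 1 (stdSimplex ℝ (Fin 2) × ℝ) := ContinuousMap.const _ (x₀, 0)
      have hγε : ∀ i, (triv act σ).comp (γ.face i) = (triv act σ).comp (ε.face i) := fun i => by
        refine ContinuousMap.ext fun x => Prod.ext rfl ?_
        change act (coface 0 i x 1, σ x₀) = act (0, σ x₀)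
        have : coface 0 i x 1 = 0 ∨ coface 0 i x 1 = 1 := by
          have h2 : coface 0 i x 1 = _ := stdSimplex_map_apply _ _ _
          have h3 : x 0 = 1 := stdSimplex.eq_one_of_unique (X := Fin 1) x 0
          rw [h2, Fin.sum_univ_one, h3]
          split_ifs <;> simp
        rcases this with h2 | h2
        · rw [h2]
        · rw [h2, h.period, h.zero]
      refine main (Finsupp.single γ 1 + Finsupp.single ε 1) ?_ ?_ ?_
      · rw [map_add, push_single, push_single]
        exact zmod_two_add_self _
      · simp only [map_add, bd_single, map_sum, push_single, hγε]
        exact zmod_two_add_self _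
      · change pair _ _ = 0
        rw [map_add, h1, map_add, push_single, push_single, map_add, pair_single, pair_single]
        have hl : w (ContinuousMap.snd.comp ((triv act σ).comp γ)) = 1 :=
          hw.loop (σ x₀) _ fun s => rfl
        have hc : w (ContinuousMap.snd.comp ((triv act σ).comp ε)) = 0 := by
          have := hw.cocycle (ContinuousMap.const _ (act (0, σ x₀)))
          change w (ContinuousMap.snd.comp ((triv act σ).comp ε)) +
            w (ContinuousMap.snd.comp ((triv act σ).comp ε)) +
            w (ContinuousMap.snd.comp ((triv act σ).comp ε)) = 0 at this
          rwa [zmod_two_add_self, zero_add] at this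
        rw [hl, hc]; decide

/-- The conditions on the degree `n` part of a chain-level section of `q`. -/
structure IsPartialSection (q : C(Y, B)) (w : Simp 1 Y → ZMod 2) (n : ℕ)
    (S : Simp n B → Chain n (stdSimplex ℝ (Fin (n + 1)) × Y)) : Prop where
  isOver : ∀ σ, OverChain q σ (S σ)
  fst : ∀ σ, push ContinuousMap.fst (S σ) = Finsupp.single (ContinuousMap.id _) 1
  vanishes : ∀ σ, VanishesOn w n (S σ)
  cycle : ∀ σ : Simp (n + 1) B, IsCycleChain n (∑ i ∈ Finset.range (n + 2),
    push ((coface n i).prodMap (ContinuousMap.id Y)) (S (σ.face i)))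

lemma exists_partialSection_zero (h : IsFlowQuotient q act) (w : Simp 1 Y → ZMod 2) :
    ∃ S, IsPartialSection q w 0 S := by
  choose L hL using h.lift 0
  refine ⟨fun σ => Finsupp.single ((ContinuousMap.id _).prodMk (L σ)) 1,
    fun σ => OverChain.single fun x => DFunLike.congr_fun (hL σ) x, fun σ => ?_,
    fun _ => trivial, fun _ => trivial⟩
  rw [push_single]; rfl

/-- Over each simplex, the chains already chosen over its faces are filled. The new chains satisfy
the cycle condition because faces of faces cancel in pairs. -/
lemma IsPartialSection.exists_succ (h : IsFlowQuotient q act) {w : Simp 1 Y → ZMod 2}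
    (hw : IsOrbitCocycle act w) {n : ℕ} {S : Simp n B → Chain n (stdSimplex ℝ (Fin (n + 1)) × Y)}
    (hS : IsPartialSection q w n S) : ∃ S', IsPartialSection q w (n + 1) S' ∧
      ∀ σ, bd (S' σ) = ∑ i ∈ Finset.range (n + 2),
        push ((coface n i).prodMap (ContinuousMap.id Y)) (S (σ.face i)) := by
  have key : ∀ σ : Simp (n + 1) B, ∃ β : Chain (n + 1) (stdSimplex ℝ (Fin (n + 2)) × Y),
      OverChain q σ β ∧ push ContinuousMap.fst β = Finsupp.single (ContinuousMap.id _) 1 ∧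
      bd β = ∑ i ∈ Finset.range (n + 2),
        push ((coface n i).prodMap (ContinuousMap.id Y)) (S (σ.face i)) ∧
      VanishesOn w (n + 1) β := by
    intro σ
    refine h.exists_filling hw σ ?_ ?_ (hS.cycle σ) ?_
    · exact OverChain.sum _ fun i _ => (hS.isOver _).push _ fun η hη x => hη x
    · rw [map_sum, bd_single]
      refine Finset.sum_congr rfl fun i _ => ?_
      have : (ContinuousMap.fst.comp ((coface n i).prodMap (ContinuousMap.id Y))) =
        (coface n i).comp ContinuousMap.fst := rfl
      rw [push_push, this, ← push_push, hS.fst, push_single]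
      rfl
    · match n, S, hS with
      | 0, _, _ => trivial
      | 1, S, hS =>
        change pair _ _ = 0
        rw [map_sum]
        refine Finset.sum_eq_zero fun i _ => ?_
        rw [pair_push]
        exact hS.vanishes _
      | n + 2, _, _ => trivial
  choose S' h1 h2 h3 h4 using key
  refine ⟨S', ⟨h1, h2, h4, fun σ => ?_⟩, h3⟩
  change bd _ = 0
  rw [map_sum]
  simp only [bd_push, h3, map_sum, push_push]
  refine sum_faces_faces n (fun i j => push
    (((coface (n + 1) i).prodMap (ContinuousMap.id Y)).comp
      ((coface n j).prodMap (ContinuousMap.id Y))) (S ((σ.face i).face j))) fun i j hj hi => ?_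
  have : (coface (n + 1) i).comp (coface n j) = (coface (n + 1) j).comp (coface n (i - 1)) :=
    Simp.face_face (ContinuousMap.id _) hj hi
  have h5 : ((coface (n + 1) i).prodMap (ContinuousMap.id Y)).comp
      ((coface n j).prodMap (ContinuousMap.id Y)) =
      ((coface (n + 1) i).comp (coface n j)).prodMap (ContinuousMap.id Y) := rfl
  have h6 : ((coface (n + 1) j).prodMap (ContinuousMap.id Y)).comp
      ((coface n (i - 1)).prodMap (ContinuousMap.id Y)) =
      ((coface (n + 1) j).comp (coface n (i - 1))).prodMap (ContinuousMap.id Y) := rfl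
  simp only [h5, h6, this, Simp.face_face σ hj hi]

lemma exists_dependent_seq {α : ℕ → Type*} {P : ∀ n, α n → Prop}
    {R : ∀ n, α n → α (n + 1) → Prop} (h0 : ∃ a, P 0 a)
    (hs : ∀ n a, P n a → ∃ b, P (n + 1) b ∧ R n a b) :
    ∃ f : ∀ n, α n, ∀ n, P n (f n) ∧ R n (f n) (f (n + 1)) := by
  choose a ha using h0
  choose b hb using hs
  let F : ∀ n, {x : α n // P n x} := fun n =>
    Nat.rec ⟨a, ha⟩ (fun n x => ⟨b n x.1 x.2, (hb n x.1 x.2).1⟩) n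
  exact ⟨fun n => (F n).1, fun n => ⟨(F n).2, (hb n (F n).1 (F n).2).2⟩⟩

/-- The pullback along an oriented circle bundle with vanishing Euler class modulo `2` is injective
on cohomology modulo `2`. -/
theorem coh_map_injective (h : IsFlowQuotient q act) {w : Simp 1 Y → ZMod 2}
    (hw : IsOrbitCocycle act w) :
    Function.Injective (Coh.map q : Coh (ZMod 2) B →+* Coh (ZMod 2) Y) := by
  obtain ⟨S, hS⟩ := exists_dependent_seq
    (α := fun n => Simp n B → Chain n (stdSimplex ℝ (Fin (n + 1)) × Y))
    (P := fun n S => IsPartialSection q w n S)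
    (R := fun n S S' => ∀ σ, bd (S' σ) = ∑ i ∈ Finset.range (n + 2),
        push ((coface n i).prodMap (ContinuousMap.id Y)) (S (σ.face i)))
    (h.exists_partialSection_zero w) fun n S hS => IsPartialSection.exists_succ h hw hS
  rw [injective_iff_map_eq_zero]
  intro x hx
  obtain ⟨z, rfl⟩ := Ideal.Quotient.mk_surjective (I := Cochain.coboundaries (ZMod 2) B) x
  obtain ⟨c, hc⟩ : ∃ c, Cochain.delta c = Cochain.map q z.1 := Ideal.Quotient.eq_zero_iff_mem.1 hx
  -- The second components of `S` form a chain map that is a section of `q` on chains. Evaluating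
  -- along it a primitive `c` of the pullback of `z` gives a primitive of `z`.
  let b : Cochain (ZMod 2) B := fun n σ => pair (c n) (push ContinuousMap.snd (S n σ))
  refine Ideal.Quotient.eq_zero_iff_mem.2 ⟨b, ?_⟩
  have hsec : ∀ n (σ : Simp n B), push q (push ContinuousMap.snd (S n σ)) =
      Finsupp.single σ (1 : ZMod 2) := fun n σ => by
    have h1 : push q (push ContinuousMap.snd (S n σ)) = push σ (push ContinuousMap.fst (S n σ)) := by
      rw [push_push, push_push]
      refine Finsupp.mapDomain_congr fun η hη => ?_
      exact ContinuousMap.ext fun x => (hS n).1.isOver σ η hη x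
    rw [h1, (hS n).1.fst, push_single]; rfl
  have hval : ∀ n (σ : Simp n B), z.1 n σ =
      pair (Cochain.delta c n) (push ContinuousMap.snd (S n σ)) := fun n σ => by
    rw [hc]
    refine Eq.trans ?_ (pair_push (z.1 n) q _)
    rw [hsec, pair_single]
  ext n σ
  rw [hval]
  cases n with
  | zero =>
    have : (Cochain.delta c 0) = fun _ => 0 := rfl
    rw [this, pair, Finsupp.linearCombination_apply]
    simp
  | succ n =>
    rw [Cochain.delta_succ, ← pair_bd, bd_push, (hS n).2, map_sum, map_sum]
    refine Finset.sum_congr rfl fun i _ => ?_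
    rw [show (-1 : ZMod 2) = 1 from rfl, one_pow, one_mul, push_push]
    rfl

end IsFlowQuotient

end FlowQuotient

/-! ### Cochains concentrated in one degree -/

namespace Cochain

variable {R X Y : Type*} [Ring R] [TopologicalSpace X] [TopologicalSpace Y]

@[simp] lemma single_self (d : ℕ) (c : Simp d X → R) : single d c d = c := by
  simp [single]

lemma single_of_ne {d n : ℕ} (h : n ≠ d) (c : Simp d X → R) : single d c n = fun _ => 0 := by
  simp only [single, Pi.single_eq_of_ne h]; rfl

lemma eq_single_of {d : ℕ} {a : Cochain R X} (h : ∀ n ≠ d, ∀ σ, a n σ = 0) :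
    a = single d (a d) := by
  ext n σ
  by_cases hn : n = d
  · subst hn; rw [single_self]
  · rw [h n hn, single_of_ne hn]

lemma single_add (d : ℕ) (c c' : Simp d X → R) :
    single d (fun σ => c σ + c' σ) = single d c + single d c' := by
  ext n σ
  by_cases hn : n = d
  · subst hn; simp
  · simp [single_of_ne hn]

lemma single_neg (d : ℕ) (c : Simp d X → R) :
    single d (fun σ => -c σ) = -single d c := by
  ext n σ
  by_cases hn : n = d
  · subst hn; simp
  · simp [single_of_ne hn]

lemma delta_single_of_ne {d n : ℕ} (h : n ≠ d + 1) (c : Simp d X → R) (σ : Simp n X) :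
    delta (single d c) n σ = 0 := by
  cases n with
  | zero => rfl
  | succ n =>
    rw [delta_succ, single_of_ne (by omega)]
    simp

lemma delta_single_zero (c : Simp 0 X → R) (σ : Simp 1 X) :
    delta (single 0 c) 1 σ = c (σ.face 0) - c (σ.face 1) := by
  rw [delta_succ, single_self]
  simp [Finset.sum_range_succ, sub_eq_add_neg]

lemma delta_single_one (c : Simp 1 X → R) (σ : Simp 2 X) :
    delta (single 1 c) 2 σ = c (σ.face 0) - c (σ.face 1) + c (σ.face 2) := by
  rw [delta_succ, single_self]
  simp [Finset.sum_range_succ, sub_eq_add_neg]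

lemma delta_single_two (c : Simp 2 X → R) (σ : Simp 3 X) :
    delta (single 2 c) 3 σ = c (σ.face 0) - c (σ.face 1) + c (σ.face 2) - c (σ.face 3) := by
  rw [delta_succ, single_self]
  simp [Finset.sum_range_succ, sub_eq_add_neg, pow_succ]

lemma delta_single_eq_iff {d : ℕ} {c : Simp d X → R} {z : Cochain R X}
    (hz : z = single (d + 1) (z (d + 1))) :
    delta (single d c) = z ↔ ∀ σ, delta (single d c) (d + 1) σ = z (d + 1) σ := by
  refine ⟨fun h σ => by rw [h], fun h => ?_⟩
  ext n σ
  by_cases hn : n = d + 1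
  · subst hn; exact h σ
  · rw [delta_single_of_ne hn, hz, single_of_ne hn]

lemma map_single (f : C(X, Y)) (d : ℕ) (c : Simp d Y → R) :
    map f (single d c) = single d fun σ => c (f.comp σ) := by
  ext n σ
  by_cases hn : n = d
  · subst hn; rw [single_self]; change single n c n _ = _; rw [single_self]
  · rw [single_of_ne hn]; change single d c n _ = _; rw [single_of_ne hn]

end Cochain

lemma Coh.mk_eq_mk {R X : Type*} [Ring R] [TopologicalSpace X] {a b : Cochain.cocycles R X}
    (c : Cochain R X) (h : Cochain.delta c = a.1 - b.1) : Coh.mk a = Coh.mk b :=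
  Ideal.Quotient.eq.2 ⟨c, h⟩

lemma Coh.mk_surjective {R X : Type*} [Ring R] [TopologicalSpace X] :
    Function.Surjective (Coh.mk : Cochain.cocycles R X →+* Coh R X) :=
  Ideal.Quotient.mk_surjective

lemma Coh.map_comp {R X Y Z : Type*} [Ring R] [TopologicalSpace X] [TopologicalSpace Y]
    [TopologicalSpace Z] (f : C(X, Y)) (g : C(Y, Z)) (x : Coh R Z) :
    Coh.map (g.comp f) x = Coh.map f (Coh.map g x) := by
  obtain ⟨z, rfl⟩ := Coh.mk_surjective x
  rfl

lemma Coh.map_id {R X : Type*} [Ring R] [TopologicalSpace X] (x : Coh R X) :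
    Coh.map (ContinuousMap.id X) x = x := by
  obtain ⟨z, rfl⟩ := Coh.mk_surjective x
  rfl

/-- A vertex of the standard simplex. -/
abbrev vtx {n : ℕ} (i : Fin (n + 1)) : stdSimplex ℝ (Fin (n + 1)) := stdSimplex.vertex i

namespace Simp

variable {X Y : Type*} [TopologicalSpace X] [TopologicalSpace Y]

lemma pull_vtx {n m : ℕ} (σ : Simp n X) (f : Fin (m + 1) → Fin (n + 1)) (j : Fin (m + 1)) :
    σ.pull f (vtx j) = σ (vtx (f j)) := by
  change σ (stdSimplex.map f (vtx j)) = _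
  rw [stdSimplex.map_vertex]

lemma pull_const {n m : ℕ} (σ : Simp n X) (i : Fin (n + 1)) :
    (σ.pull fun _ : Fin (m + 1) => i) = ContinuousMap.const _ (σ (vtx i)) := by
  ext x
  refine congrArg σ (stdSimplex.ext (funext fun l => ?_))
  refine (stdSimplex_map_apply _ _ _).trans ?_
  by_cases h : i = l
  · subst h; simp [stdSimplex.sum_eq_one]
  · simp [h, Ne.symm h]

/-- Faces of degenerate simplices are thereby reduced to identities between maps of vertices, which
`decide` can check. -/
lemma face_pull {n m : ℕ} (τ : Simp n X)
    (f : Fin (m + 2) → Fin (n + 1)) (g : Fin (m + 1) → Fin (n + 1)) (i : ℕ)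
    (h : ∀ j : Fin (m + 1), f (clamp (m + 1) (if (j : ℕ) < i then j else j + 1)) = g j) :
    (τ.pull f).face i = τ.pull g := by
  rw [Simp.face, Simp.pull_pull]
  exact Simp.pull_congr τ fun j => congrArg _ (h j)

lemma eq_const (σ : Simp 0 X) : σ = ContinuousMap.const _ (σ (vtx 0)) :=
  ContinuousMap.ext fun x => congrArg σ
    (Subsingleton.elim (α := stdSimplex ℝ (Fin 1)) x (vtx 0))

end Simp

/-! ### The exponential map of the torus -/

section TorusExp

variable {k : ℕ}

/-- The exponential map of the torus. -/
def torusExp (v : Fin k → ℝ) : Torus k := fun l => Circle.exp (2 * Real.pi * v l)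

lemma continuous_torusExp : Continuous (torusExp : (Fin k → ℝ) → Torus k) :=
  continuous_pi fun l => Circle.exp.continuous.comp (by fun_prop)

lemma torusExp_add (v w : Fin k → ℝ) : torusExp (v + w) = torusExp v * torusExp w :=
  funext fun l => by simp [torusExp, mul_add, Circle.exp_add]

@[simp] lemma torusExp_zero : torusExp (0 : Fin k → ℝ) = 1 := funext fun l => by simp [torusExp]

lemma circle_exp_two_pi_eq_iff {a b : ℝ} :
    Circle.exp (2 * Real.pi * a) = Circle.exp (2 * Real.pi * b) ↔ ∃ n : ℤ, a = b + n := by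
  rw [Circle.exp_eq_exp]
  refine exists_congr fun n => ?_
  have : 2 * Real.pi ≠ 0 := by positivity
  constructor
  · intro h; apply mul_left_cancel₀ this; rw [h]; ring
  · rintro rfl; ring

lemma torusExp_int (n : Fin k → ℤ) : torusExp (fun l => (n l : ℝ)) = 1 := funext fun l => by
  have := (circle_exp_two_pi_eq_iff (a := n l) (b := 0)).2 ⟨n l, by simp⟩
  simpa [torusExp] using this

lemma exists_torusExp_eq (t : Torus k) :
    ∃ v : Fin k → ℝ, torusExp v = t ∧ ∀ l, 0 ≤ v l ∧ v l < 1 := by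
  have : ∀ l, ∃ a : ℝ, Circle.exp (2 * Real.pi * a) = t l ∧ 0 ≤ a ∧ a < 1 := fun l => by
    obtain ⟨b, hb⟩ := Circle.exp_surjective (t l)
    refine ⟨Int.fract (b / (2 * Real.pi)), ?_, Int.fract_nonneg _, Int.fract_lt_one _⟩
    rw [← hb]
    conv_rhs => rw [← mul_div_cancel₀ b (show (2 * Real.pi) ≠ 0 by positivity)]
    exact circle_exp_two_pi_eq_iff.2 ⟨-⌊b / (2 * Real.pi)⌋, by
      rw [Int.fract]; push_cast; ring⟩
  choose v hv using this
  exact ⟨v, funext fun l => (hv l).1, fun l => (hv l).2⟩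

lemma exists_torus_lift {n : ℕ} (g : C(stdSimplex ℝ (Fin (n + 1)), Torus k)) :
    ∃ θ : C(stdSimplex ℝ (Fin (n + 1)), Fin k → ℝ), ∀ x, torusExp (θ x) = g x := by
  choose θ hθ using fun l => exists_circle_lift (⟨fun x => g x l, by fun_prop⟩ :
    C(stdSimplex ℝ (Fin (n + 1)), Circle))
  exact ⟨⟨fun x l => θ l x, by fun_prop⟩, fun x => funext fun l => hθ l x⟩

end TorusExp

/-! ### Transgressions: additivity and normalization -/

section Transgression

variable {k : ℕ} {E : Type*} [TopologicalSpace E] [MulAction (Torus k) E]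

lemma IsTransgression.add {a b : Fin k → ℤ} {x y : Coh ℤ (OrbitSpace (Torus k) E)}
    (hx : IsTransgression a x) (hy : IsTransgression b y) : IsTransgression (a + b) (x + y) := by
  obtain ⟨c, ⟨z, rfl, hz1, hz2⟩, hc⟩ := hx
  obtain ⟨d, ⟨w, rfl, hw1, hw2⟩, hd⟩ := hy
  refine ⟨fun γ => c γ + d γ, ⟨z + w, map_add _ _ _, ?_, ?_⟩, fun e l γ hγ => ?_⟩
  · change z.1 + w.1 = Cochain.single 2 fun σ => z.1 2 σ + w.1 2 σ
    rw [Cochain.single_add]; exact congrArg₂ (· + ·) hz1 hw1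
  · rw [Cochain.single_add, map_add, hz2, hw2]; exact (map_add _ _ _).symm
  · rw [Pi.add_apply, ← hc e l γ hγ, ← hd e l γ hγ]; ring

lemma IsTransgression.neg {a : Fin k → ℤ} {x : Coh ℤ (OrbitSpace (Torus k) E)}
    (hx : IsTransgression a x) : IsTransgression (-a) (-x) := by
  obtain ⟨c, ⟨z, rfl, hz1, hz2⟩, hc⟩ := hx
  refine ⟨fun γ => -c γ, ⟨-z, map_neg _ _, ?_, ?_⟩, fun e l γ hγ => ?_⟩
  · change -z.1 = Cochain.single 2 fun σ => -z.1 2 σ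
    rw [Cochain.single_neg]; exact congrArg (- ·) hz1
  · rw [Cochain.single_neg, map_neg, hz2]; exact (map_neg _ _).symm
  · rw [Pi.neg_apply, ← hc e l γ hγ]; ring

lemma IsTransgression.zero :
    IsTransgression (0 : Fin k → ℤ) (0 : Coh ℤ (OrbitSpace (Torus k) E)) := by
  have h0 : ∀ {X : Type _} [TopologicalSpace X] (d : ℕ),
      Cochain.single d (fun _ : Simp d X => (0 : ℤ)) = 0 := fun d => by
    ext n σ
    by_cases hn : n = d
    · subst hn; simp
    · simp [Cochain.single_of_ne hn]
  refine ⟨fun _ => 0, ⟨0, map_zero _, (h0 2).symm, ?_⟩, fun e l γ hγ => by simp⟩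
  rw [h0, map_zero]; exact (map_zero _).symm

/-- The pairs of a weight and a transgression of it form a subgroup, which contains the integral
combinations of the pairs `(e_l, u_l)`. -/
lemma IsTransgression.weightClass {u : Fin k → Coh ℤ (OrbitSpace (Torus k) E)}
    (hu : ∀ l, IsTransgression (Pi.single l 1) (u l)) (a : Fin k → ℤ) :
    IsTransgression a (weightClass u a) := by
  let S : AddSubgroup ((Fin k → ℤ) × Coh ℤ (OrbitSpace (Torus k) E)) :=
    { carrier := {p | IsTransgression p.1 p.2}
      zero_mem' := IsTransgression.zero
      add_mem' := fun h h' => IsTransgression.add h h'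
      neg_mem' := fun h => IsTransgression.neg h }
  have : ∑ l, a l • ((Pi.single l 1 : Fin k → ℤ), u l) ∈ S :=
    sum_mem fun l _ => zsmul_mem (show (_, _) ∈ S from hu l) _
  have h2 : ∑ l, a l • ((Pi.single l 1 : Fin k → ℤ), u l) = (a, EquivClass.weightClass u a) := by
    refine Prod.ext ?_ ?_
    · rw [Prod.fst_sum]
      simp only [Prod.smul_mk]
      funext j
      simp [Finset.sum_apply, Pi.single_apply]
    · rw [Prod.snd_sum]; rfl
  rw [h2] at this
  exact this

variable [ContinuousSMul (Torus k) E]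

/-- A straight path in an orbit of the torus. -/
def vertPath (e : E) (v : Fin k → ℝ) : Simp 1 E :=
  ⟨fun s => torusExp (s 1 • v) • e, by
    have h1 : Continuous fun s : stdSimplex ℝ (Fin 2) => s 1 :=
      (continuous_apply (1 : Fin 2)).comp continuous_subtype_val
    exact (continuous_torusExp.comp (h1.smul continuous_const)).smul continuous_const⟩

/-- A simplex moved by a simplex of the torus. -/
def moveSimp {n : ℕ} (σ : Simp n E) (θ : C(stdSimplex ℝ (Fin (n + 1)), Fin k → ℝ)) : Simp n E :=
  ⟨fun x => torusExp (θ x) • σ x, (continuous_torusExp.comp θ.continuous).smul σ.continuous⟩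

/-- A normalized cochain `c` on `E` whose coboundary is the pullback of `z`, with value `a l` on
the `l`-th coordinate circle. -/
structure IsNormalized (c : Simp 1 E → ℤ) (z : Simp 2 (OrbitSpace (Torus k) E) → ℤ)
    (a : Fin k → ℤ) : Prop where
  delta : ∀ σ : Simp 2 E, c (σ.face 0) - c (σ.face 1) + c (σ.face 2) = z ((orbitMk _).comp σ)
  degen_left : ∀ τ : Simp 1 (OrbitSpace (Torus k) E), z (τ.pull ![0, 0, 1]) = 0
  degen_right : ∀ τ : Simp 1 (OrbitSpace (Torus k) E), z (τ.pull ![0, 1, 1]) = 0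
  loop : ∀ e l, c (vertPath e (Pi.single l 1)) = a l

/-- Representing cocycles need not vanish on degenerate simplices. On constant triangles `z` is a
function `K` of the point, and the cocycle relation on degenerate tetrahedra shows that on a
degenerate triangle `z` is the value of `K` at the repeated vertex. Subtracting the coboundary of `τ
↦ K (τ v₀)` removes exactly these values. -/
lemma IsTransgression.exists_isNormalized {a : Fin k → ℤ}
    {x : Coh ℤ (OrbitSpace (Torus k) E)} (hx : IsTransgression a x) :
    ∃ (z : Cochain.cocycles ℤ (OrbitSpace (Torus k) E)) (c : Simp 1 E → ℤ), Coh.mk z = x ∧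
      z.1 = Cochain.single 2 (z.1 2) ∧ IsNormalized c (z.1 2) a := by
  obtain ⟨c, ⟨z, rfl, hz1, hz2⟩, hc⟩ := hx
  let B := OrbitSpace (Torus k) E
  set ζ : Simp 2 B → ℤ := z.1 2
  have hδ : ∀ σ : Simp 2 E, c (σ.face 0) - c (σ.face 1) + c (σ.face 2) =
      ζ ((orbitMk _).comp σ) := fun σ => by
    rw [← Cochain.delta_single_one, hz2]; rfl
  have hcoc : ∀ σ : Simp 3 B, ζ (σ.face 0) - ζ (σ.face 1) + ζ (σ.face 2) - ζ (σ.face 3) = 0 :=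
    fun σ => by
      rw [← Cochain.delta_single_two, ← hz1, show Cochain.delta z.1 = 0 from z.2]; rfl
  let K : B → ℤ := fun b => ζ (ContinuousMap.const _ b)
  let b₀ : Simp 1 B → ℤ := fun τ => K (τ (vtx 0))
  have hcK : ∀ e, c (ContinuousMap.const _ e) = K (orbitMk _ e) := fun e => by
    have := hδ (ContinuousMap.const _ e)
    change c (ContinuousMap.const _ e) - c (ContinuousMap.const _ e) +
      c (ContinuousMap.const _ e) = _ at this
    rw [sub_self, zero_add] at this
    exact this
  have hb : Cochain.delta (Cochain.delta (Cochain.single 1 b₀)) = 0 := by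
    ext n σ
    cases n with
    | zero => rfl
    | succ n =>
      rw [Cochain.delta_succ]
      by_cases hn : n = 2
      · subst hn
        simp only [Cochain.delta_single_one, Finset.sum_range_succ, Finset.range_zero,
          Finset.sum_empty, b₀]
        simp only [Simp.face, Simp.pull_pull, Simp.pull_vtx]
        simp [clamp]
      · simp only [Cochain.delta_single_of_ne hn]; simp
  let w : Cochain.cocycles ℤ B := ⟨Cochain.delta (Cochain.single 1 b₀), hb⟩
  have hw : w.1 = Cochain.single 2 (w.1 2) :=
    Cochain.eq_single_of fun n hn σ => Cochain.delta_single_of_ne hn _ _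
  have hwv : ∀ σ : Simp 2 B, w.1 2 σ = K (σ (vtx 1)) := fun σ => by
    have : w.1 2 σ = _ := Cochain.delta_single_one b₀ σ
    rw [this]
    simp only [b₀, Simp.face, Simp.pull_vtx]
    simp [clamp]
  refine ⟨z - w, fun γ => c γ - b₀ ((orbitMk _).comp γ), ?_, ?_, ?_, ?_, ?_, ?_⟩
  · exact Coh.mk_eq_mk (-Cochain.single 1 b₀) (by
      rw [map_neg]; change -w.1 = z.1 - w.1 - z.1; abel)
  · refine Cochain.eq_single_of fun n hn σ => ?_
    change z.1 n σ - w.1 n σ = 0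
    rw [hz1, hw, Cochain.single_of_ne hn, Cochain.single_of_ne hn, sub_zero]
  · intro σ
    change _ = ζ _ - w.1 2 _
    rw [← hδ, show w.1 2 _ = _ from Cochain.delta_single_one b₀ ((orbitMk _).comp σ)]
    simp only [Simp.comp_face]
    ring
  · intro τ
    change ζ _ - w.1 2 _ = 0
    rw [hwv, Simp.pull_vtx]
    have h1 := hcoc (τ.pull ![0, 0, 0, 1])
    rw [Simp.face_pull τ _ ![0, 0, 1] 0 (by decide), Simp.face_pull τ _ ![0, 0, 1] 1 (by decide),
      Simp.face_pull τ _ ![0, 0, 1] 2 (by decide), Simp.face_pull τ _ (fun _ => 0) 3 (by decide),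
      Simp.pull_const] at h1
    change _ - ζ (ContinuousMap.const _ (τ (vtx 0))) = 0
    linarith
  · intro τ
    change ζ _ - w.1 2 _ = 0
    rw [hwv, Simp.pull_vtx]
    have h1 := hcoc (τ.pull ![0, 1, 1, 1])
    rw [Simp.face_pull τ _ (fun _ => 1) 0 (by decide), Simp.face_pull τ _ ![0, 1, 1] 1 (by decide),
      Simp.face_pull τ _ ![0, 1, 1] 2 (by decide), Simp.face_pull τ _ ![0, 1, 1] 3 (by decide),
      Simp.pull_const] at h1
    change _ - ζ (ContinuousMap.const _ (τ (vtx 1))) = 0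
    linarith
  · intro e l
    rw [← hc e l (vertPath e (Pi.single l 1)) fun s => ?_, hcK]
    · have h2 : b₀ ((orbitMk _).comp (vertPath e (Pi.single l 1))) = K (orbitMk _ e) :=
        congrArg K (orbitMk_smul _ _)
      rw [h2]
    · change torusExp (s 1 • Pi.single l 1) • e = _
      congr 1
      funext j
      by_cases hj : j = l
      · subst hj; simp [torusExp]
      · simp [torusExp, hj]

end Transgression

/-! ### Descent of invariant cochains to the base -/

section Descend

variable {G E R : Type*} [Group G] [TopologicalSpace G] [IsTopologicalGroup G]
  [TopologicalSpace E] [MulAction G E] [ContinuousSMul G E] [Ring R]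

/-- The function on simplices of the base of a principal bundle induced by an invariant function
on simplices of the total space. -/
def descend (hE : IsPrincipalBundle G E) {n : ℕ} (F : Simp n E → R) (τ : Simp n (OrbitSpace G E)) :
    R := F (hE.exists_lift τ).choose

lemma descend_apply (hE : IsPrincipalBundle G E) {n : ℕ} {F : Simp n E → R}
    (hF : ∀ σ σ' : Simp n E, (orbitMk G).comp σ = (orbitMk G).comp σ' → F σ = F σ')
    (σ : Simp n E) : descend hE F ((orbitMk G).comp σ) = F σ :=
  hF _ _ (hE.exists_lift ((orbitMk G).comp σ)).choose_spec

/-- Simplices of the base lift, so a primitive upstairs that is constant on the lifts of each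
simplex is the pullback of a primitive of `z`. -/
lemma mk_eq_zero_of_descend (hE : IsPrincipalBundle G E) {z : Cochain.cocycles R (OrbitSpace G E)}
    (hz : z.1 = Cochain.single 2 (z.1 2)) {F : Simp 1 E → R}
    (hF : ∀ σ σ' : Simp 1 E, (orbitMk G).comp σ = (orbitMk G).comp σ' → F σ = F σ')
    (h : ∀ σ : Simp 2 E, F (σ.face 0) - F (σ.face 1) + F (σ.face 2) = z.1 2 ((orbitMk G).comp σ)) :
    Coh.mk z = 0 := by
  rw [← map_zero Coh.mk]
  refine Coh.mk_eq_mk (Cochain.single 1 (descend hE F)) ?_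
  change _ = z.1 - 0
  rw [sub_zero, Cochain.delta_single_eq_iff hz]
  intro τ
  obtain ⟨σ, rfl⟩ := hE.exists_lift τ
  have := descend_apply hE hF
  rw [Cochain.delta_single_one, Simp.comp_face, Simp.comp_face, Simp.comp_face, this, this, this, h]

end Descend

/-! ### A transgression is determined by its weight -/

section Vertical

variable {k : ℕ} {E : Type*} [TopologicalSpace E] [MulAction (Torus k) E]

lemma coface_one_apply (i : ℕ) (x : stdSimplex ℝ (Fin 2)) (l : Fin 3) :
    coface 1 i x l = (if clamp 2 (if 0 < i then 0 else 1) = l then x 0 else 0) +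
      if clamp 2 (if 1 < i then 1 else 2) = l then x 1 else 0 := by
  refine (stdSimplex_map_apply _ _ _).trans ?_
  rw [Fin.sum_univ_two]; rfl

lemma map_coface_one (f : Fin 3 → Fin 2) (g : Fin 2 → Fin 2) (i : ℕ)
    (h : ∀ j : Fin 2, f (clamp 2 (if (j : ℕ) < i then j else j + 1)) = g j)
    (x : stdSimplex ℝ (Fin 2)) : stdSimplex.map f (coface 1 i x) = stdSimplex.map g x := by
  refine (stdSimplex.map_comp_apply _ _ _).trans ?_
  congr 1; funext j; exact h j

lemma map_const_fin_two (i : Fin 2) (x : stdSimplex ℝ (Fin 2)) :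
    stdSimplex.map (fun _ : Fin 2 => i) x = vtx i :=
  DFunLike.congr_fun (Simp.pull_const (m := 1) (n := 1) (ContinuousMap.id _) i) x

/-- A chosen point of the orbit of `e`. -/
def orbitRep (e : E) : E := (orbitMk_surjective (G := Torus k) (orbitMk (Torus k) e)).choose

lemma orbitMk_orbitRep (e : E) :
    orbitMk (Torus k) (orbitRep (k := k) e) = orbitMk (Torus k) e :=
  (orbitMk_surjective (G := Torus k) (orbitMk (Torus k) e)).choose_spec

lemma orbitRep_congr {e e' : E} (h : orbitMk (Torus k) e = orbitMk (Torus k) e') :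
    orbitRep (k := k) e = orbitRep (k := k) e' := by
  unfold orbitRep; simp only [h]

lemma exists_coord (e : E) : ∃ v : Fin k → ℝ, torusExp v • orbitRep (k := k) e = e ∧
    ∀ l, 0 ≤ v l ∧ v l < 1 := by
  obtain ⟨t, ht⟩ := orbitMk_eq_iff.1 (orbitMk_orbitRep (k := k) e).symm
  obtain ⟨v, rfl, hv⟩ := exists_torusExp_eq t
  exact ⟨v, ht, hv⟩

/-- The coordinates in `[0, 1)^k` of `e` with respect to the chosen point of its orbit. -/
def coord (k : ℕ) {E : Type*} [TopologicalSpace E] [MulAction (Torus k) E] (e : E) : Fin k → ℝ :=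
  (exists_coord e).choose

lemma torusExp_coord (e : E) : torusExp (coord k e) • orbitRep (k := k) e = e :=
  (exists_coord e).choose_spec.1

lemma coord_mem (e : E) (l : Fin k) : 0 ≤ coord k e l ∧ coord k e l < 1 :=
  (exists_coord e).choose_spec.2 l

variable [ContinuousSMul (Torus k) E] {c : Simp 1 E → ℤ}
  {z : Simp 2 (OrbitSpace (Torus k) E) → ℤ} {a : Fin k → ℤ}

lemma continuous_simplex_apply {n : ℕ} (l : Fin (n + 1)) :
    Continuous fun s : stdSimplex ℝ (Fin (n + 1)) => s l :=
  (continuous_apply l).comp continuous_subtype_val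

/-- The triangle `s ↦ exp(u(s) θ(f(s))) σ(f(s))`. -/
def moveTriangle (σ : Simp 1 E) (θ : C(stdSimplex ℝ (Fin 2), Fin k → ℝ)) (f : Fin 3 → Fin 2)
    (u : C(stdSimplex ℝ (Fin 3), ℝ)) : Simp 2 E :=
  ⟨fun s => torusExp (u s • θ (stdSimplex.map f s)) • σ (stdSimplex.map f s), by
    have hf := stdSimplex.continuous_map (S := ℝ) f
    exact (continuous_torusExp.comp (u.continuous.smul (θ.continuous.comp hf))).smul
      (σ.continuous.comp hf)⟩

namespace IsNormalized

/-- The strip swept out by `exp(u θ) σ` for `0 ≤ u ≤ 1` is cut along its diagonal `D` into two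
triangles. Both project to degenerate triangles, where `z` vanishes, so the values on the four sides
of the strip balance. -/
lemma move_sub (h : IsNormalized c z a) (σ : Simp 1 E) (θ : C(stdSimplex ℝ (Fin 2), Fin k → ℝ)) :
    c (moveSimp σ θ) - c σ =
      c (vertPath (σ (vtx 1)) (θ (vtx 1))) - c (vertPath (σ (vtx 0)) (θ (vtx 0))) := by
  let u₁ : C(stdSimplex ℝ (Fin 3), ℝ) := ⟨fun s => s 2, continuous_simplex_apply 2⟩
  let u₂ : C(stdSimplex ℝ (Fin 3), ℝ) :=
    ⟨fun s => s 1 + s 2, (continuous_simplex_apply 1).add (continuous_simplex_apply 2)⟩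
  let D : Simp 1 E := moveSimp σ ⟨fun s => s 1 • θ s, (continuous_simplex_apply 1).smul θ.continuous⟩
  have hu₁ : ∀ i x, u₁ (coface 1 i x) = coface 1 i x 2 := fun _ _ => rfl
  have hu₂ : ∀ i x, u₂ (coface 1 i x) = coface 1 i x 1 + coface 1 i x 2 := fun _ _ => rfl
  have hid : ∀ x : stdSimplex ℝ (Fin 2), stdSimplex.map id x = x := fun x =>
    stdSimplex.map_id_apply x
  have hsum : ∀ x : stdSimplex ℝ (Fin 2), x 0 + x 1 = 1 := fun x => stdSimplex.add_eq_one x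
  have hface : ∀ (f : Fin 3 → Fin 2) (u : C(stdSimplex ℝ (Fin 3), ℝ)) (i : ℕ)
      (x : stdSimplex ℝ (Fin 2)), (moveTriangle σ θ f u).face i x =
      torusExp (u (coface 1 i x) • θ (stdSimplex.map f (coface 1 i x))) •
        σ (stdSimplex.map f (coface 1 i x)) := fun _ _ _ _ => rfl
  have e10 : (moveTriangle σ θ ![0, 1, 1] u₁).face 0 = vertPath (σ (vtx 1)) (θ (vtx 1)) := by
    ext x
    rw [hface, map_coface_one _ (fun _ => 1) 0 (by decide), map_const_fin_two, hu₁,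
      coface_one_apply]
    simp [clamp]; rfl
  have e11 : (moveTriangle σ θ ![0, 1, 1] u₁).face 1 = D := by
    ext x
    rw [hface, map_coface_one _ id 1 (by decide), hid, hu₁, coface_one_apply]
    simp [clamp]; rfl
  have e12 : (moveTriangle σ θ ![0, 1, 1] u₁).face 2 = σ := by
    ext x
    rw [hface, map_coface_one _ id 2 (by decide), hid, hu₁, coface_one_apply]
    simp [clamp]
  have e20 : (moveTriangle σ θ ![0, 0, 1] u₂).face 0 = moveSimp σ θ := by
    ext x
    rw [hface, map_coface_one _ id 0 (by decide), hid, hu₂, coface_one_apply, coface_one_apply]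
    simp [clamp, hsum]; rfl
  have e21 : (moveTriangle σ θ ![0, 0, 1] u₂).face 1 = D := by
    ext x
    rw [hface, map_coface_one _ id 1 (by decide), hid, hu₂, coface_one_apply, coface_one_apply]
    simp [clamp]; rfl
  have e22 : (moveTriangle σ θ ![0, 0, 1] u₂).face 2 = vertPath (σ (vtx 0)) (θ (vtx 0)) := by
    ext x
    rw [hface, map_coface_one _ (fun _ => 0) 2 (by decide), map_const_fin_two, hu₂,
      coface_one_apply, coface_one_apply]
    simp [clamp]; rfl
  have hproj : ∀ f u, (orbitMk (Torus k)).comp (moveTriangle σ θ f u) =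
      Simp.pull ((orbitMk (Torus k)).comp σ) f := fun f u =>
    ContinuousMap.ext fun x => orbitMk_smul _ _
  have h1 := h.delta (moveTriangle σ θ ![0, 1, 1] u₁)
  have h2 := h.delta (moveTriangle σ θ ![0, 0, 1] u₂)
  rw [hproj, h.degen_right, e10, e11, e12] at h1
  rw [hproj, h.degen_left, e20, e21, e22] at h2
  linarith

/-- The triangle with these three sides lies in one orbit, so it projects to a constant triangle, on
which `z` vanishes. -/
lemma vertPath_add (h : IsNormalized c z a) (e : E) (v w : Fin k → ℝ) :
    c (vertPath e (v + w)) = c (vertPath e v) + c (vertPath (torusExp v • e) w) := by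
  let T : Simp 2 E := ⟨fun s => torusExp (s 1 • v + s 2 • (v + w)) • e, by
    exact (continuous_torusExp.comp (((continuous_simplex_apply 1).smul continuous_const).add
      ((continuous_simplex_apply 2).smul continuous_const))).smul continuous_const⟩
  have hsum : ∀ x : stdSimplex ℝ (Fin 2), x 0 + x 1 = 1 := fun x => stdSimplex.add_eq_one x
  have hface : ∀ (i : ℕ) (x : stdSimplex ℝ (Fin 2)), T.face i x =
      torusExp (coface 1 i x 1 • v + coface 1 i x 2 • (v + w)) • e := fun _ _ => rfl
  have e0 : T.face 0 = vertPath (torusExp v • e) w := by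
    ext x
    rw [hface, coface_one_apply, coface_one_apply]
    change _ = torusExp (x 1 • w) • torusExp v • e
    rw [← mul_smul, ← torusExp_add]
    congr 2
    simp only [clamp]
    simp
    have := hsum x
    rw [show x 0 = 1 - x 1 by linarith]
    module
  have e1 : T.face 1 = vertPath e (v + w) := by
    ext x
    rw [hface, coface_one_apply, coface_one_apply]
    simp [clamp]
    rw [← smul_add]; rfl
  have e2 : T.face 2 = vertPath e v := by
    ext x
    rw [hface, coface_one_apply, coface_one_apply]
    simp [clamp]; rfl
  have hT : (orbitMk (Torus k)).comp T =
      Simp.pull (ContinuousMap.const _ (orbitMk _ e) : Simp 1 _) ![0, 0, 1] :=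
    ContinuousMap.ext fun x => orbitMk_smul _ _
  have := h.delta T
  rw [hT, h.degen_left, e0, e1, e2] at this
  linarith

/-- Paths of integral vectors are closed, so `vertPath_add` makes the value additive in the vector;
it is then determined by the coordinate circles. -/
lemma vertPath_int (h : IsNormalized c z a) (e : E) (n : Fin k → ℤ) :
    c (vertPath e fun l => (n l : ℝ)) = ∑ l, a l * n l := by
  let f : (Fin k → ℤ) →+ ℤ := AddMonoidHom.mk' (fun n => c (vertPath e fun l => (n l : ℝ)))
    fun n n' => by
      have h1 := h.vertPath_add e (fun l => (n l : ℝ)) (fun l => (n' l : ℝ))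
      rw [torusExp_int, one_smul] at h1
      rw [← h1]
      congr 2; funext l; simp
  have h1 := LinearMap.pi_apply_eq_sum_univ f.toIntLinearMap n
  have h2 : ∀ l, f (fun j => if l = j then 1 else 0) = a l := fun l => by
    rw [← h.loop e l]
    change c (vertPath e _) = _
    congr 2; funext j
    by_cases hj : l = j
    · subst hj; simp
    · simp [hj, Ne.symm hj]
  change f n = _
  refine h1.trans (Finset.sum_congr rfl fun l _ => ?_)
  change n l • f _ = _
  rw [h2, smul_eq_mul, mul_comm]

end IsNormalized

lemma torusExp_coord_smul (hE : IsPrincipalBundle (Torus k) E) (t : Torus k) (e : E) :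
    torusExp (coord k (t • e)) = t * torusExp (coord k e) := by
  refine hE.smul_left_cancel (e := orbitRep (k := k) e) ?_
  rw [mul_smul, torusExp_coord, orbitRep_congr (orbitMk_smul t e).symm, torusExp_coord]

/-- The correction of a normalized cochain by its values on the paths from the chosen points. -/
def corrected (k : ℕ) {E : Type*} [TopologicalSpace E] [MulAction (Torus k) E]
    [ContinuousSMul (Torus k) E] (c : Simp 1 E → ℤ) (γ : Simp 1 E) : ℤ :=
  c γ - c (vertPath (orbitRep (k := k) (γ (vtx 1))) (coord k (γ (vtx 1)))) +
    c (vertPath (orbitRep (k := k) (γ (vtx 0))) (coord k (γ (vtx 0))))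

namespace IsNormalized

/-- The correction is the difference of one function at the two end points, hence a coboundary. -/
lemma corrected_delta (h : IsNormalized c z a) (σ : Simp 2 E) :
    corrected k c (σ.face 0) - corrected k c (σ.face 1) +
      corrected k c (σ.face 2) = z ((orbitMk _).comp σ) := by
  rw [← h.delta]
  simp only [corrected]
  simp only [Simp.face, Simp.pull_vtx]
  simp only [clamp]
  norm_num
  abel

/-- The coordinates of the end points change by `θ` up to the integers `n i`, and by `vertPath_int`
only these integers survive in the corrected cochain. For weight `0` nothing is left; for half turns
the remaining terms account for the square of a sign class. -/
lemma corrected_move (h : IsNormalized c z a) (σ : Simp 1 E)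
    (θ : C(stdSimplex ℝ (Fin 2), Fin k → ℝ)) (n : Fin 2 → Fin k → ℤ)
    (hn : ∀ i l, coord k (σ (vtx i)) l + θ (vtx i) l = coord k (moveSimp σ θ (vtx i)) l + n i l) :
    corrected k c (moveSimp σ θ) =
      corrected k c σ + ∑ l, a l * n 1 l - ∑ l, a l * n 0 l := by
  have key : ∀ i, c (vertPath (orbitRep (k := k) (moveSimp σ θ (vtx i)))
      (coord k (moveSimp σ θ (vtx i)))) + ∑ l, a l * n i l =
      c (vertPath (orbitRep (k := k) (σ (vtx i))) (coord k (σ (vtx i)))) +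
        c (vertPath (σ (vtx i)) (θ (vtx i))) := fun i => by
    have hr : orbitRep (k := k) (moveSimp σ θ (vtx i)) = orbitRep (k := k) (σ (vtx i)) :=
      orbitRep_congr (orbitMk_smul _ _)
    have h1 := h.vertPath_add (orbitRep (k := k) (σ (vtx i))) (coord k (σ (vtx i))) (θ (vtx i))
    rw [torusExp_coord] at h1
    rw [← h1, ← h.vertPath_int (moveSimp σ θ (vtx i)) (n i)]
    have h2 := h.vertPath_add (orbitRep (k := k) (moveSimp σ θ (vtx i)))
      (coord k (moveSimp σ θ (vtx i))) (fun l => (n i l : ℝ))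
    rw [torusExp_coord] at h2
    rw [← h2, hr]
    congr 2
    funext l
    exact (hn i l).symm
  have h3 := h.move_sub σ θ
  have k0 := key 0
  have k1 := key 1
  simp only [corrected]
  linarith

end IsNormalized

lemma exists_int_coord (hE : IsPrincipalBundle (Torus k) E) (e : E) (v : Fin k → ℝ) :
    ∃ n : Fin k → ℤ, ∀ l, coord k e l + v l = coord k (torusExp v • e) l + n l := by
  have h := torusExp_coord_smul hE (torusExp v) e
  rw [← torusExp_add] at h
  choose n hn using fun l => circle_exp_two_pi_eq_iff.1 (congrFun h l).symm
  exact ⟨n, fun l => by rw [← hn l, Pi.add_apply, add_comm]⟩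

/-- For weight `0` the corrected cochain has the same value on all lifts of a path, so it descends
to a primitive. -/
lemma IsTransgression.eq_zero (hE : IsPrincipalBundle (Torus k) E)
    {x : Coh ℤ (OrbitSpace (Torus k) E)} (hx : IsTransgression 0 x) : x = 0 := by
  obtain ⟨z, c, rfl, hz, h⟩ := hx.exists_isNormalized
  refine mk_eq_zero_of_descend hE hz (F := corrected k c) (fun σ σ' hσ => ?_)
    h.corrected_delta
  obtain ⟨g, hg⟩ := hE.exists_simp_diff hσ
  obtain ⟨θ, hθ⟩ := exists_torus_lift g
  have hm : σ' = moveSimp σ θ := ContinuousMap.ext fun x => by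
    rw [← hg x, ← hθ x]; rfl
  choose n hn using fun i : Fin 2 => exists_int_coord hE (σ (vtx i)) (θ (vtx i))
  rw [hm, h.corrected_move σ θ n hn]
  simp

/-- A class of degree `2` which is a transgression is determined by its weight. -/
lemma IsTransgression.eq_weightClass (hE : IsPrincipalBundle (Torus k) E)
    {u : Fin k → Coh ℤ (OrbitSpace (Torus k) E)}
    (hu : ∀ l, IsTransgression (Pi.single l 1) (u l)) {a : Fin k → ℤ}
    {x : Coh ℤ (OrbitSpace (Torus k) E)} (hx : IsTransgression a x) :
    x = EquivClass.weightClass u a := by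
  have := hx.add (IsTransgression.weightClass hu a).neg
  rw [add_neg_cancel] at this
  rw [← sub_eq_zero, sub_eq_add_neg]
  exact IsTransgression.eq_zero hE this

end Vertical

/-! ### Signs as elements of the circle -/

section Signs

lemma circle_sq_eq_one_iff {z : Circle} : z ^ 2 = 1 ↔ z = 1 ∨ z = -1 := by
  constructor
  · intro h
    have h2 : (z : ℂ) ^ 2 = 1 := by rw [← Circle.coe_pow, h, Circle.coe_one]
    rcases mul_self_eq_one_iff.1 ((sq _).symm.trans h2) with h | h
    · exact Or.inl (Circle.ext h)
    · exact Or.inr (Circle.ext h)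
  · rintro (rfl | rfl) <;> simp

open Classical in
/-- The logarithm of a sign, in units of half a turn. -/
def signLog (z : Circle) : ℤ := if z = 1 then 0 else 1

@[simp] lemma signLog_one : signLog 1 = 0 := by simp [signLog]

@[simp] lemma signLog_neg_one : signLog (-1) = 1 := by
  rw [signLog, if_neg (Circle.neg_ne_self 1)]

lemma circle_exp_pi : Circle.exp Real.pi = -1 := Circle.ext (by simp)

lemma circle_exp_signLog {z : Circle} (h : z ^ 2 = 1) :
    Circle.exp (2 * Real.pi * ((signLog z : ℝ) / 2)) = z := by
  rcases circle_sq_eq_one_iff.1 h with rfl | rfl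
  · simp
  · rw [signLog_neg_one, ← circle_exp_pi]; congr 1; push_cast; ring

/-- The sign of the real part. -/
def reSign (z : Circle) : Circle := if 0 < (z : ℂ).re then 1 else -1

lemma reSign_sq (z : Circle) : reSign z ^ 2 = 1 := by
  unfold reSign; split_ifs <;> simp

lemma reSign_mul {s z : Circle} (hs : s ^ 2 = 1) (hz : (z : ℂ).re ≠ 0) :
    reSign (s * z) = s * reSign z := by
  rcases circle_sq_eq_one_iff.1 hs with rfl | rfl
  · simp
  · unfold reSign
    rcases lt_or_gt_of_ne hz with h | h
    · simp [h, not_lt.2 h.le]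
    · simp [h, not_lt.2 h.le]

lemma continuousAt_reSign {z : Circle} (hz : (z : ℂ).re ≠ 0) : ContinuousAt reSign z := by
  have hc : Continuous fun z : Circle => (z : ℂ).re :=
    Complex.continuous_re.comp continuous_subtype_val
  rcases lt_or_gt_of_ne hz with h | h
  · refine continuousAt_const (y := (-1 : Circle)) |>.congr ?_
    filter_upwards [hc.continuousAt.eventually_lt continuousAt_const h] with y hy
    simp [reSign, not_lt.2 hy.le]
  · refine continuousAt_const (y := (1 : Circle)) |>.congr ?_
    filter_upwards [continuousAt_const.eventually_lt hc.continuousAt h] with y hy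
    simp [reSign, hy]

/-- A continuous family of signs over a simplex is constant. -/
lemma sign_family_const {n : ℕ} (g : C(stdSimplex ℝ (Fin (n + 1)), Circle))
    (h : ∀ x, g x ^ 2 = 1) (x y : stdSimplex ℝ (Fin (n + 1))) : g x = g y := by
  have key : ∀ x, g x = 1 ∨ g x = -1 := fun x => circle_sq_eq_one_iff.1 (h x)
  obtain ⟨m, hm⟩ := exists_int_const (⟨fun x => (g x : ℂ).re, by fun_prop⟩ :
    C(stdSimplex ℝ (Fin (n + 1)), ℝ)) fun x => by
      rcases key x with hx | hx
      · exact ⟨1, by simp [hx]⟩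
      · exact ⟨-1, by simp [hx]⟩
  have h2 : (g x : ℂ).re = (g y : ℂ).re := (hm x).trans (hm y).symm
  rcases key x with hx | hx <;> rcases key y with hy | hy <;> rw [hx, hy] at h2 ⊢ <;>
    norm_num at h2

end Signs

/-! ### The effect of half turns on the orbit coordinates -/

section HalfCoord

variable {k : ℕ} {E : Type*} [TopologicalSpace E] [MulAction (Torus k) E]
  [ContinuousSMul (Torus k) E]

/-- The integer part of twice the `l`-th coordinate of `e`. -/
def halfCoord (l : Fin k) (e : E) : ℤ := if 1 / 2 ≤ coord k e l then 1 else 0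

/-- A half turn carries a coordinate in `[0, 1)` past `1` exactly when it is at least `1 / 2`, so
`halfCoord` counts the wrap-around. -/
lemma coord_signLog (hE : IsPrincipalBundle (Torus k) E) {t : Torus k} {l : Fin k}
    (ht : t l ^ 2 = 1) (e : E) : coord k e l + (signLog (t l) : ℝ) / 2 =
      coord k (t • e) l + (signLog (t l) * halfCoord l e : ℤ) := by
  have h := congrFun (torusExp_coord_smul hE t e) l
  change Circle.exp (2 * Real.pi * coord k (t • e) l) =
    t l * Circle.exp (2 * Real.pi * coord k e l) at h
  obtain ⟨a0, a1⟩ := coord_mem (k := k) e l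
  obtain ⟨b0, b1⟩ := coord_mem (k := k) (t • e) l
  replace h := h.trans (congrArg (· * _) (circle_exp_signLog ht).symm)
  beta_reduce at h
  rw [← Circle.exp_add, ← mul_add] at h
  obtain ⟨n, hn⟩ := circle_exp_two_pi_eq_iff.1 h
  rcases circle_sq_eq_one_iff.1 ht with h1 | h1 <;> rw [h1] at hn ⊢
  · simp only [signLog_one, Int.cast_zero, zero_div, zero_add, zero_mul, add_zero] at hn ⊢
    have h2 : (-1 : ℝ) < n := by linarith
    have h3 : (n : ℝ) < 1 := by linarith
    have h2 : -1 < n := by exact_mod_cast h2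
    have h3 : n < 1 := by exact_mod_cast h3
    obtain rfl : n = 0 := by omega
    simp at hn; linarith
  · simp only [signLog_neg_one, Int.cast_one, one_mul, halfCoord] at hn ⊢
    have h2 : (-2 : ℝ) < n := by linarith
    have h3 : (n : ℝ) < 1 := by linarith
    have h2 : -2 < n := by exact_mod_cast h2
    have h3 : n < 1 := by exact_mod_cast h3
    obtain rfl | rfl : n = 0 ∨ n = -1 := by omega
    · rw [if_neg (by push Not; simp at hn; linarith)]; simp at hn ⊢; linarith
    · rw [if_pos (by simp at hn; linarith)]; simp at hn ⊢; linarith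

/-- A half turn exchanges the two halves of `[0, 1)`. -/
lemma halfCoord_smul (hE : IsPrincipalBundle (Torus k) E) {t : Torus k} {l : Fin k}
    (ht : t l ^ 2 = 1) (e : E) :
    (halfCoord l (t • e) : ZMod 2) = halfCoord l e + signLog (t l) := by
  have h := coord_signLog hE ht e
  obtain ⟨a0, a1⟩ := coord_mem (k := k) e l
  obtain ⟨b0, b1⟩ := coord_mem (k := k) (t • e) l
  rcases circle_sq_eq_one_iff.1 ht with h1 | h1 <;> rw [h1] at h ⊢ <;> simp [halfCoord] at h ⊢
  · rw [h]
  · split_ifs at h ⊢ <;> norm_num at h ⊢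
    · linarith
    · exact (zmod_two_add_self (1 : ZMod 2)).symm
    · linarith

end HalfCoord

/-! ### The tower of circle bundles between the torus and its group of signs -/

section Subgroups

variable {k : ℕ} {E : Type*} [TopologicalSpace E] [MulAction (Torus k) E]

/-- The subgroup of elements of the torus whose first `i` coordinates are signs. -/
def signSubgroup (k i : ℕ) : Subgroup (Torus k) where
  carrier := {t | ∀ l : Fin k, (l : ℕ) < i → t l ^ 2 = 1}
  mul_mem' := fun {a b} ha hb l hl => by rw [Pi.mul_apply, mul_pow, ha l hl, hb l hl, one_mul]
  one_mem' := fun l _ => one_pow 2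
  inv_mem' := fun {a} ha l hl => by rw [Pi.inv_apply, inv_pow, ha l hl, inv_one]

/-- A chart coordinate that has to become a sign is replaced by the sign of its real part, measured
relative to `e`. The chart shrinks to the points where these real parts do not vanish, a condition
stable under signs. -/
lemma IsPrincipalBundle.signSubgroup (hE : IsPrincipalBundle (Torus k) E) (i : ℕ) :
    IsPrincipalBundle (signSubgroup k i) E := by
  intro e
  obtain ⟨U, hU, heU, hinv, τ, hτc, hτ⟩ := hE e
  have hc : ∀ l, ContinuousOn (fun x => τ x l * (τ e l)⁻¹) U := fun l =>
    ((continuous_apply l).comp_continuousOn hτc).mul continuousOn_const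
  have hcr : Continuous fun z : Circle => (z : ℂ).re :=
    Complex.continuous_re.comp continuous_subtype_val
  let σ : E → Torus k := fun x l =>
    if (l : ℕ) < i then reSign (τ x l * (τ e l)⁻¹) else τ x l * (τ e l)⁻¹
  have hσ : ∀ x, σ x ∈ EquivClass.signSubgroup k i := fun x l hl => by
    simp only [σ, if_pos hl]; exact reSign_sq _
  refine ⟨{x | x ∈ U ∧ ∀ l : Fin k, (l : ℕ) < i → ((τ x l * (τ e l)⁻¹ : Circle) : ℂ).re ≠ 0},
    ?_, ⟨heU, fun l _ => by simp⟩, ?_, fun x => ⟨σ x, hσ x⟩, ?_, ?_⟩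
  · rw [isOpen_iff_mem_nhds]
    rintro x ⟨hx, hx'⟩
    have h1 : ∀ l : Fin k, ∀ᶠ y in 𝓝 x,
        (l : ℕ) < i → ((τ y l * (τ e l)⁻¹ : Circle) : ℂ).re ≠ 0 := fun l => by
      by_cases hl : (l : ℕ) < i
      · have h2 := (hcr.continuousAt.comp ((hc l).continuousAt (hU.mem_nhds hx))).eventually_ne
          (hx' l hl)
        filter_upwards [h2] with y hy _
        exact hy
      · exact Filter.Eventually.of_forall fun y h => absurd h hl
    filter_upwards [hU.mem_nhds hx, Filter.eventually_all.2 h1] with y h2 h3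
    exact ⟨h2, h3⟩
  · rintro ⟨g, hg⟩ x ⟨hx, hx'⟩
    refine ⟨hinv g x hx, fun l hl => ?_⟩
    change ((τ (g • x) l * (τ e l)⁻¹ : Circle) : ℂ).re ≠ 0
    rw [hτ g x hx, Pi.mul_apply, mul_assoc]
    rcases circle_sq_eq_one_iff.1 (hg l hl) with h | h <;> rw [h]
    · rw [one_mul]; exact hx' l hl
    · rw [neg_mul, one_mul, Circle.coe_neg, Complex.neg_re]; exact neg_ne_zero.2 (hx' l hl)
  · refine Topology.IsInducing.subtypeVal.continuousOn_iff.2 (continuousOn_pi.2 fun l => ?_)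
    change ContinuousOn (fun x => σ x l) _
    simp only [σ]
    split_ifs with hl
    · rintro x ⟨hx, hx'⟩
      refine ContinuousAt.continuousWithinAt ?_
      exact (continuousAt_reSign (hx' l hl)).comp (f := fun x => τ x l * (τ e l)⁻¹)
        ((hc l).continuousAt (hU.mem_nhds hx))
    · exact (hc l).mono fun x hx => hx.1
  · rintro ⟨g, hg⟩ x ⟨hx, hx'⟩
    refine Subtype.ext (funext fun l => ?_)
    change σ (g • x) l = g l * σ x l
    simp only [σ]
    rw [hτ g x hx, Pi.mul_apply, mul_assoc]
    split_ifs with hl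
    · exact reSign_mul (hg l hl) (hx' l hl)
    · rfl

/-- The projection between the orbit spaces of two subgroups. -/
def orbitProj (E : Type*) [TopologicalSpace E] [MulAction (Torus k) E] {H H' : Subgroup (Torus k)}
    (h : H ≤ H') : C(OrbitSpace H E, OrbitSpace H' E) :=
  orbitLift H (orbitMk H') fun g e => orbitMk_smul (⟨g.1, h g.2⟩ : H') e

/-- The projection from the orbit space of a subgroup to that of the torus. -/
def orbitBase (E : Type*) [TopologicalSpace E] [MulAction (Torus k) E] (H : Subgroup (Torus k)) :
    C(OrbitSpace H E, OrbitSpace (Torus k) E) :=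
  orbitLift H (orbitMk (Torus k)) fun g e => orbitMk_smul g.1 e

variable [ContinuousSMul (Torus k) E]

/-- The action of an element of the torus on the orbit space of a subgroup. -/
def orbitMove (H : Subgroup (Torus k)) (t : Torus k) : C(OrbitSpace H E, OrbitSpace H E) :=
  orbitLift H ((orbitMk H).comp ⟨fun e => t • e, continuous_const_smul t⟩) fun g e => by
    change orbitMk H (t • g.1 • e) = orbitMk H (t • e)
    rw [smul_comm]; exact orbitMk_smul g (t • e)

/-- The rotation of the `l`-th coordinate through `a / 2`. -/
def halfTurn (l : Fin k) (a : ℝ) : Torus k := Pi.mulSingle l (Circle.exp (Real.pi * a))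

lemma continuous_halfTurn (l : Fin k) : Continuous (halfTurn l) :=
  (continuous_mulSingle l).comp (Circle.exp.continuous.comp (by fun_prop))

lemma halfTurn_add (l : Fin k) (a b : ℝ) : halfTurn l (a + b) = halfTurn l a * halfTurn l b := by
  rw [halfTurn, mul_add, Circle.exp_add, Pi.mulSingle_mul]; rfl

/-- The flow on the orbit space of a subgroup given by the `l`-th coordinate. -/
def orbitFlow (E : Type*) [TopologicalSpace E] [MulAction (Torus k) E]
    [ContinuousSMul (Torus k) E] (H : Subgroup (Torus k)) (l : Fin k) :
    C(ℝ × OrbitSpace H E, OrbitSpace H E) where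
  toFun p := orbitMove H (halfTurn l p.1) p.2
  continuous_toFun := by
    have hq : IsOpenQuotientMap (Prod.map id (orbitMk H : C(E, OrbitSpace H E)) : ℝ × E → _) :=
      IsOpenQuotientMap.id.prodMap ⟨orbitMk_surjective, (orbitMk H).continuous, isOpenMap_orbitMk⟩
    rw [hq.isQuotientMap.continuous_iff]
    exact (orbitMk H).continuous.comp
      (((continuous_halfTurn l).comp continuous_fst).smul continuous_snd)

lemma orbitFlow_mk (H : Subgroup (Torus k)) (l : Fin k) (a : ℝ) (e : E) :
    orbitFlow E H l (a, orbitMk H e) = orbitMk H (halfTurn l a • e) := rfl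

variable {i : ℕ} (hi : i < k)

lemma signSubgroup_le (k i : ℕ) : signSubgroup k (i + 1) ≤ signSubgroup k i :=
  fun _ ht l hl => ht l (hl.trans (Nat.lt_succ_self i))

/-- The smaller subgroup differs from the larger one only in allowing just signs in coordinate `i`.
The fibre is therefore the circle modulo `±1`, and the flow in this coordinate closes up after half
a turn, which is one unit of the parameter of `halfTurn`. -/
lemma isFlowQuotient_orbitProj (hE : IsPrincipalBundle (Torus k) E) :
    IsFlowQuotient (orbitProj E (signSubgroup_le k i))
      (orbitFlow E (signSubgroup k (i + 1)) ⟨i, hi⟩) where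
  zero y := by
    obtain ⟨e, rfl⟩ := orbitMk_surjective y
    rw [orbitFlow_mk]; simp [halfTurn]
  add a b y := by
    obtain ⟨e, rfl⟩ := orbitMk_surjective y
    rw [orbitFlow_mk, orbitFlow_mk, orbitFlow_mk, halfTurn_add, mul_smul]
  proj a y := by
    obtain ⟨e, rfl⟩ := orbitMk_surjective y
    rw [orbitFlow_mk]
    refine orbitMk_smul (G := signSubgroup k i) ⟨halfTurn _ a, fun l hl => ?_⟩ e
    have : l ≠ ⟨i, hi⟩ := by rintro rfl; simp at hl
    simp [halfTurn, this]
  period y := by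
    obtain ⟨e, rfl⟩ := orbitMk_surjective y
    rw [orbitFlow_mk]
    refine orbitMk_smul (G := signSubgroup k (i + 1)) ⟨halfTurn _ 1, fun l hl => ?_⟩ e
    by_cases h : l = ⟨i, hi⟩
    · subst h; simp [halfTurn, circle_exp_pi]
    · simp [halfTurn, h]
  free a y h := by
    obtain ⟨e, rfl⟩ := orbitMk_surjective y
    rw [orbitFlow_mk] at h
    obtain ⟨g, hg⟩ := orbitMk_eq_iff.1 h
    have h1 : g.1 = halfTurn ⟨i, hi⟩ a := hE.smul_left_cancel hg
    have h2 := g.2 ⟨i, hi⟩ (Nat.lt_succ_self i)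
    rw [h1] at h2
    simp only [halfTurn, Pi.mulSingle_eq_same] at h2
    obtain ⟨n, hn⟩ := (circle_exp_two_pi_eq_iff (a := a) (b := 0)).1 (by
      rw [mul_zero, Circle.exp_zero, ← h2, sq, ← Circle.exp_add]; congr 1; ring)
    exact ⟨n, by simpa using hn⟩
  lift n σ := by
    obtain ⟨σ', rfl⟩ := (hE.signSubgroup i).exists_lift σ
    exact ⟨(orbitMk _).comp σ', rfl⟩
  diff n η η' h := by
    obtain ⟨σ, rfl⟩ := (hE.signSubgroup (i + 1)).exists_lift η
    obtain ⟨σ', rfl⟩ := (hE.signSubgroup (i + 1)).exists_lift η'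
    obtain ⟨g, hg⟩ := (hE.signSubgroup i).exists_simp_diff (σ := σ) (σ' := σ') h
    obtain ⟨θ, hθ⟩ := exists_circle_lift (⟨fun x => (g x).1 ⟨i, hi⟩,
      (continuous_apply _).comp (continuous_subtype_val.comp g.continuous)⟩ :
      C(stdSimplex ℝ (Fin (n + 1)), Circle))
    -- `θ` counts full turns and the flow counts half turns.
    refine ⟨⟨fun x => 2 * θ x, by fun_prop⟩, fun x => ?_⟩
    change orbitMk _ (halfTurn ⟨i, hi⟩ (2 * θ x) • σ x) = orbitMk _ (σ' x)
    have hx : halfTurn ⟨i, hi⟩ (2 * θ x) = Pi.mulSingle ⟨i, hi⟩ ((g x).1 ⟨i, hi⟩) := by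
      rw [halfTurn]; congr 1
      rw [show Real.pi * (2 * θ x) = 2 * Real.pi * θ x by ring]
      exact hθ x
    -- Dividing out coordinate `i` of `g` leaves signs in all of the first `i + 1` coordinates.
    have hm : (g x).1 * (halfTurn ⟨i, hi⟩ (2 * θ x))⁻¹ ∈ signSubgroup k (i + 1) := fun l hl => by
      rw [hx]
      by_cases h : l = ⟨i, hi⟩
      · subst h; simp
      · have h3 : (l : ℕ) < i := by
          have : (l : ℕ) ≠ i := fun h' => h (Fin.ext h')
          omega
        simp [h, (g x).2 l h3]
    refine (orbitMk_eq_iff.2 ⟨⟨_, hm⟩, ?_⟩).symm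
    rw [← hg x]
    change ((g x).1 * (halfTurn ⟨i, hi⟩ (2 * θ x))⁻¹) • halfTurn ⟨i, hi⟩ (2 * θ x) • σ x = _
    rw [smul_smul, inv_mul_cancel_right]; rfl

end Subgroups

/-! ### Degree one classes of the double coverings and their squares -/

section SignClass

variable {k : ℕ} {E : Type*} [TopologicalSpace E] [MulAction (Torus k) E]
  [ContinuousSMul (Torus k) E]

/-- The difference of the half coordinates of the end points of a path. -/
def halfDiff (l : Fin k) (γ : Simp 1 E) : ZMod 2 :=
  halfCoord l (γ (vtx 1)) - halfCoord l (γ (vtx 0))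

lemma halfDiff_face (l : Fin k) (σ : Simp 2 E) :
    halfDiff l (σ.face 0) + halfDiff l (σ.face 1) + halfDiff l (σ.face 2) = 0 := by
  simp only [halfDiff, Simp.face, Simp.pull_vtx]
  simp only [clamp]
  norm_num
  rw [sub_add_sub_comm, sub_add_sub_comm]
  generalize (halfCoord l (σ _) : ZMod 2) = a, (halfCoord l (σ _) : ZMod 2) = b,
    (halfCoord l (σ _) : ZMod 2) = c
  revert a b c; decide

variable {H : Subgroup (Torus k)} {l : Fin k}

lemma sign_const_of_orbit (hH : IsPrincipalBundle H E) (hl : ∀ t ∈ H, t l ^ 2 = 1) {n : ℕ}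
    {σ σ' : Simp n E} (h : (orbitMk H).comp σ = (orbitMk H).comp σ') :
    ∃ g : C(stdSimplex ℝ (Fin (n + 1)), H), (∀ x, g x • σ x = σ' x) ∧
      ∀ x y, (g x).1 l = (g y).1 l := by
  obtain ⟨g, hg⟩ := hH.exists_simp_diff h
  exact ⟨g, hg, sign_family_const ⟨fun x => (g x).1 l,
    (continuous_apply _).comp (continuous_subtype_val.comp g.continuous)⟩
    fun x => hl _ (g x).2⟩

/-- Coordinate `l` of the element of `H` relating the two paths is a sign, constant along the path,
so both half coordinates change by the same amount. -/
lemma halfDiff_congr (hE : IsPrincipalBundle (Torus k) E) (hH : IsPrincipalBundle H E)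
    (hl : ∀ t ∈ H, t l ^ 2 = 1) (γ γ' : Simp 1 E) (h : (orbitMk H).comp γ = (orbitMk H).comp γ') :
    halfDiff l γ = halfDiff l γ' := by
  obtain ⟨g, hg, hc⟩ := sign_const_of_orbit hH hl h
  have key : ∀ x, (halfCoord l (γ' x) : ZMod 2) = halfCoord l (γ x) + signLog ((g x).1 l) :=
    fun x => by rw [← hg x]; exact halfCoord_smul hE (hl _ (g x).2) (γ x)
  rw [halfDiff, halfDiff, key, key, hc (vtx 1) (vtx 0)]; ring

/-- The cocycle on the orbit space of a subgroup on which the `l`-th coordinate is a sign. -/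
def signCochain (hH : IsPrincipalBundle H E) (l : Fin k) : Simp 1 (OrbitSpace H E) → ZMod 2 :=
  descend hH (halfDiff l)

lemma signCochain_comp (hE : IsPrincipalBundle (Torus k) E) (hH : IsPrincipalBundle H E)
    (hl : ∀ t ∈ H, t l ^ 2 = 1) (γ : Simp 1 E) :
    signCochain hH l ((orbitMk H).comp γ) = halfDiff l γ :=
  descend_apply hH (halfDiff_congr hE hH hl) γ

/-- During one period of the flow coordinate `l` makes half a turn and changes halves, which gives
the value `1`. -/
lemma isOrbitCocycle_signCochain (hE : IsPrincipalBundle (Torus k) E)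
    (hH : IsPrincipalBundle H E) (hl : ∀ t ∈ H, t l ^ 2 = 1) :
    IsFlowQuotient.IsOrbitCocycle (orbitFlow E H l) (signCochain hH l) where
  cocycle σ := by
    obtain ⟨σ, rfl⟩ := hH.exists_lift σ
    rw [Simp.comp_face, Simp.comp_face, Simp.comp_face, signCochain_comp hE hH hl,
      signCochain_comp hE hH hl, signCochain_comp hE hH hl, halfDiff_face]
  loop y γ h := by
    obtain ⟨e, rfl⟩ := orbitMk_surjective y
    have h1 : γ = (orbitMk H).comp ⟨fun s => halfTurn l (s 1) • e,
        ((continuous_halfTurn l).comp (continuous_simplex_apply 1)).smul continuous_const⟩ :=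
      ContinuousMap.ext h
    rw [h1, signCochain_comp hE hH hl]
    change (halfCoord l (halfTurn l ((vtx 1 : stdSimplex ℝ (Fin 2)) 1) • e) : ZMod 2) -
      halfCoord l (halfTurn l ((vtx 0 : stdSimplex ℝ (Fin 2)) 1) • e) = 1
    have e0 : (vtx 0 : stdSimplex ℝ (Fin 2)) 1 = 0 := by simp [vtx]
    have e1 : (vtx 1 : stdSimplex ℝ (Fin 2)) 1 = 1 := by simp [vtx]
    have e2 : halfTurn l 1 l = -1 := by simp [halfTurn, circle_exp_pi]
    rw [e0, e1, halfCoord_smul hE (by rw [e2]; simp), e2]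
    simp [halfTurn]

/-- The pullback to the orbit space of the group of signs is injective on cohomology
modulo `2`. -/
lemma coh_map_orbitBase_injective (hE : IsPrincipalBundle (Torus k) E) {i : ℕ} (hi : i ≤ k) :
    Function.Injective (Coh.map (orbitBase E (signSubgroup k i)) :
      Coh (ZMod 2) (OrbitSpace (Torus k) E) →+* _) := by
  induction i with
  | zero =>
    -- For `i = 0` the subgroup is the whole torus, so the projection has a section.
    let s : C(OrbitSpace (Torus k) E, OrbitSpace (signSubgroup k 0) E) :=
      orbitLift (Torus k) (orbitMk _) fun g e =>
        orbitMk_smul (G := signSubgroup k 0) ⟨g, fun l hl => absurd hl (Nat.not_lt_zero _)⟩ e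
    have hs : (orbitBase E (signSubgroup k 0)).comp s = ContinuousMap.id _ :=
      ContinuousMap.ext fun x => by obtain ⟨e, rfl⟩ := orbitMk_surjective x; rfl
    refine Function.LeftInverse.injective (g := Coh.map s) fun x => ?_
    rw [← Coh.map_comp, hs, Coh.map_id]
  | succ i ih =>
    have h1 : orbitBase E (signSubgroup k (i + 1)) =
        (orbitBase E (signSubgroup k i)).comp (orbitProj E (signSubgroup_le k i)) :=
      ContinuousMap.ext fun x => by obtain ⟨e, rfl⟩ := orbitMk_surjective x; rfl
    have h2 := (isFlowQuotient_orbitProj (E := E) (i := i) (by omega) hE).coh_map_injective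
      (isOrbitCocycle_signCochain hE (hE.signSubgroup (i + 1))
        (l := ⟨i, by omega⟩) fun t ht => ht _ (Nat.lt_succ_self i))
    intro x y hxy
    rw [h1, Coh.map_comp, Coh.map_comp] at hxy
    exact ih (by omega) (h2 hxy)

lemma delta_single_signCochain (hE : IsPrincipalBundle (Torus k) E)
    (hH : IsPrincipalBundle H E) (hl : ∀ t ∈ H, t l ^ 2 = 1) :
    Cochain.delta (Cochain.single 1 (signCochain hH l)) = 0 := by
  ext n σ
  by_cases hn : n = 2
  · subst hn
    rw [Cochain.delta_single_one, sub_eq_add_neg, ZMod.neg_eq_self_mod_two]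
    exact (isOrbitCocycle_signCochain hE hH hl).cocycle σ
  · exact Cochain.delta_single_of_ne hn _ _

/-- The cohomology class of the double covering given by the `l`-th coordinate. -/
def signClass (hE : IsPrincipalBundle (Torus k) E) (hH : IsPrincipalBundle H E)
    (hl : ∀ t ∈ H, t l ^ 2 = 1) : Coh (ZMod 2) (OrbitSpace H E) :=
  Coh.mk ⟨_, delta_single_signCochain hE hH hl⟩

lemma Cochain.single_one_mul_apply {R X : Type*} [Ring R] [TopologicalSpace X]
    (a b : Simp 1 X → R) (σ : Simp 2 X) :
    (Cochain.single 1 a * Cochain.single 1 b) 2 σ = a (σ.sub 1 0) * b (σ.sub 1 1) := by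
  rw [Cochain.mul_apply]
  simp [Finset.sum_range_succ, Cochain.single_of_ne]

lemma Cochain.single_one_mul {R X : Type*} [Ring R] [TopologicalSpace X]
    (a b : Simp 1 X → R) : Cochain.single 1 a * Cochain.single 1 b =
      Cochain.single 2 ((Cochain.single 1 a * Cochain.single 1 b) 2) := by
  refine Cochain.eq_single_of fun n hn σ => ?_
  rw [Cochain.mul_apply]
  refine Finset.sum_eq_zero fun i hi => ?_
  by_cases h1 : i = 1
  · subst h1
    rw [Cochain.single_of_ne (n := n - 1) (by omega), mul_zero]
  · rw [Cochain.single_of_ne h1, zero_mul]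

lemma Simp.sub_one_zero {X : Type*} [TopologicalSpace X] (σ : Simp 2 X) :
    σ.sub 1 0 = σ.face 2 := Simp.pull_congr σ fun j => by fin_cases j <;> rfl

lemma Simp.sub_one_one {X : Type*} [TopologicalSpace X] (σ : Simp 2 X) :
    σ.sub 1 1 = σ.face 0 := Simp.pull_congr σ fun j => by fin_cases j <;> rfl

/-- The pointwise product of two cocycles of degree one is their cup-1 product: modulo `2` its
coboundary is the commutator of their cup products. -/
lemma signClass_commute (hE : IsPrincipalBundle (Torus k) E) (hH : IsPrincipalBundle H E)
    {l' : Fin k} (hl : ∀ t ∈ H, t l ^ 2 = 1) (hl' : ∀ t ∈ H, t l' ^ 2 = 1) :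
    Commute (signClass hE hH hl) (signClass hE hH hl') := by
  change _ * _ = _ * _
  rw [signClass, signClass, ← map_mul, ← map_mul]
  set w := signCochain hH l
  set w' := signCochain hH l'
  refine Coh.mk_eq_mk (Cochain.single 1 fun γ => w γ * w' γ) ?_
  change _ = Cochain.single 1 w * Cochain.single 1 w' - Cochain.single 1 w' * Cochain.single 1 w
  ext n σ
  by_cases hn : n = 2
  · subst hn
    rw [Cochain.delta_single_one, Cochain.sub_apply, Cochain.single_one_mul_apply,
      Cochain.single_one_mul_apply, Simp.sub_one_zero, Simp.sub_one_one]
    have h1 := (isOrbitCocycle_signCochain hE hH hl).cocycle σ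
    have h2 := (isOrbitCocycle_signCochain hE hH hl').cocycle σ
    revert h1 h2
    change w _ + w _ + w _ = 0 → w' _ + w' _ + w' _ = 0 → _
    generalize w (σ.face 0) = a0, w (σ.face 1) = a1, w (σ.face 2) = a2,
      w' (σ.face 0) = b0, w' (σ.face 1) = b1, w' (σ.face 2) = b2
    revert a0 a1 a2 b0 b1 b2
    decide
  · rw [Cochain.delta_single_of_ne hn, Cochain.single_one_mul, Cochain.single_one_mul w',
      Cochain.sub_apply, Cochain.single_of_ne hn, Cochain.single_of_ne hn, sub_zero]

/-- The pullback of a generator is the square of the sign class. -/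
lemma map_orbitBase_eq_signClass_sq (hE : IsPrincipalBundle (Torus k) E)
    (hH : IsPrincipalBundle H E) (hl : ∀ t ∈ H, ∀ l, t l ^ 2 = 1)
    {x : Coh ℤ (OrbitSpace (Torus k) E)} (hx : IsTransgression (Pi.single l 1) x) :
    Coh.map (orbitBase E H) (Coh.coeff (Int.castRingHom (ZMod 2)) x) =
      signClass hE hH (l := l) (fun t ht => hl t ht l) *
        signClass hE hH (l := l) (fun t ht => hl t ht l) := by
  obtain ⟨z, c, rfl, hz, h⟩ := hx.exists_isNormalized
  set w := signCochain hH l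
  have hwc : ∀ γ, w ((orbitMk H).comp γ) = halfDiff l γ :=
    signCochain_comp hE hH (fun t ht => hl t ht l)
  have hw0 := delta_single_signCochain hE hH (l := l) (fun t ht => hl t ht l)
  let y : Cochain.cocycles (ZMod 2) (OrbitSpace H E) := ⟨_, hw0⟩
  let z' : Cochain.cocycles (ZMod 2) (OrbitSpace H E) :=
    ⟨Cochain.map (orbitBase E H) (Cochain.coeff (Int.castRingHom (ZMod 2)) z.1), by
      change Cochain.delta _ = 0
      rw [Cochain.delta_map, Cochain.delta_coeff, show Cochain.delta z.1 = 0 from z.2, map_zero,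
        map_zero]⟩
  have hz' : Coh.mk (z' - y * y) = 0 := by
    -- Write `h` for `halfCoord l`. Under a sign with logarithm `s` the corrected cochain changes by
    -- `s (h(γ₁) - h(γ₀))`. Since `h` itself changes by `s` modulo `2`, the term `h(γ₀) (h(γ₁) -
    -- h(γ₀))` changes by the same amount, and the difference is invariant. The coboundary of this
    -- term is the cup square of the sign cocycle.
    refine mk_eq_zero_of_descend hH ?_ (F := fun γ => (corrected k c γ : ZMod 2) -
      halfCoord l (γ (vtx 0)) * halfDiff l γ) (fun σ σ' hσ => ?_) fun σ => ?_
    · refine Cochain.eq_single_of fun n hn σ => ?_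
      change Int.castRingHom (ZMod 2) (z.1 n _) -
        (Cochain.single 1 w * Cochain.single 1 w) n σ = 0
      rw [hz, Cochain.single_of_ne hn, Cochain.single_one_mul, Cochain.single_of_ne hn, map_zero,
        sub_zero]
    · obtain ⟨g, hg⟩ := hH.exists_simp_diff hσ
      have hgc : ∀ j x, (g x).1 j = (g (vtx 0)).1 j := fun j x =>
        sign_family_const ⟨fun x => (g x).1 j,
          (continuous_apply _).comp (continuous_subtype_val.comp g.continuous)⟩
          (fun x => hl _ (g x).2 j) x _
      set t : Torus k := (g (vtx 0)).1
      have ht : ∀ j, t j ^ 2 = 1 := hl t (g (vtx 0)).2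
      have hm : σ' = moveSimp σ (ContinuousMap.const _ fun j => (signLog (t j) : ℝ) / 2) :=
        ContinuousMap.ext fun x => by
          rw [← hg x]
          change (g x).1 • σ x = torusExp (fun j => (signLog (t j) : ℝ) / 2) • σ x
          refine congrArg (fun s : Torus k => s • σ x) (funext fun j => ?_)
          rw [hgc j x]
          exact (circle_exp_signLog (ht j)).symm
      have hm2 : ∀ x, σ' x = t • σ x := fun x => by
        rw [← hg x]
        change (g x).1 • σ x = _
        exact congrArg (fun s : Torus k => s • σ x) (funext fun j => hgc j x)
      have hc := h.corrected_move σ (ContinuousMap.const _ fun j => (signLog (t j) : ℝ) / 2)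
        (fun i j => signLog (t j) * halfCoord j (σ (vtx i))) fun i j => by
          rw [← hm, hm2]
          exact coord_signLog hE (ht j) _
      rw [← hm] at hc
      simp only [Pi.single_apply, ite_mul, one_mul, zero_mul, Finset.sum_ite_eq',
        Finset.mem_univ, if_true] at hc
      have hd := halfDiff_congr hE hH (fun t ht => hl t ht l) σ σ' hσ
      simp only [hc, ← hd, hm2, halfCoord_smul hE (ht l)]
      simp only [halfDiff]
      push_cast
      ring
    · change _ = Int.castRingHom (ZMod 2) (z.1 2 ((orbitMk (Torus k)).comp σ)) -
        (Cochain.single 1 w * Cochain.single 1 w) 2 ((orbitMk H).comp σ)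
      rw [← h.corrected_delta, Cochain.single_one_mul_apply, Simp.sub_one_zero, Simp.sub_one_one,
        Simp.comp_face, Simp.comp_face, hwc, hwc]
      simp only [halfDiff, Simp.face, Simp.pull_vtx]
      simp only [clamp]
      norm_num
      ring
  rw [map_sub, sub_eq_zero, map_mul] at hz'
  exact hz'

/-- The combination of the functions `halfCoord l` with coefficients `a l` jumps under `H` exactly
as `c` does. The difference descends to the base, where its coboundary compares the two cocycles. -/
lemma eq_sum_signClass (hE : IsPrincipalBundle (Torus k) E)
    (hH : IsPrincipalBundle H E) (hl : ∀ t ∈ H, ∀ l, t l ^ 2 = 1) (a : Fin k → ℤ)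
    {r : Coh (ZMod 2) (OrbitSpace H E)} {c : Simp 0 E → ZMod 2}
    (hr : Transgresses (orbitMk H) 0 c r)
    (hc : ∀ t ∈ H, ∀ e, c (ContinuousMap.const _ (t • e)) - c (ContinuousMap.const _ e) =
      ((∑ l, a l * signLog (t l) : ℤ) : ZMod 2)) :
    r = ∑ l, a l • signClass hE hH (l := l) (fun t ht => hl t ht l) := by
  obtain ⟨z, rfl, hz, hδ⟩ := hr
  let y : Fin k → Cochain.cocycles (ZMod 2) (OrbitSpace H E) := fun l =>
    ⟨_, delta_single_signCochain hE hH (l := l) (fun t ht => hl t ht l)⟩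
  have hy : ∑ l, a l • signClass hE hH (l := l) (fun t ht => hl t ht l) =
      Coh.mk (∑ l, a l • y l) := by
    rw [map_sum]
    exact Finset.sum_congr rfl fun l _ => (map_zsmul _ _ _).symm
  rw [hy]
  let G : Simp 0 E → ZMod 2 := fun σ => c σ - ∑ l, (a l : ZMod 2) * halfCoord l (σ (vtx 0))
  have hG : ∀ σ σ' : Simp 0 E, (orbitMk H).comp σ = (orbitMk H).comp σ' → G σ = G σ' := by
    intro σ σ' h
    obtain ⟨t, ht⟩ := orbitMk_eq_iff.1 (DFunLike.congr_fun h (vtx 0)).symm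
    have h1 := hc t.1 t.2 (σ (vtx 0))
    have ht : t.1 • σ (vtx 0) = σ' (vtx 0) := ht
    rw [ht, ← σ.eq_const, ← σ'.eq_const] at h1
    simp only [G, ← ht, halfCoord_smul hE (hl _ t.2 _)]
    rw [sub_eq_iff_eq_add.1 h1]
    push_cast
    simp only [mul_add, Finset.sum_add_distrib]
    ring
  refine Coh.mk_eq_mk (Cochain.single 0 (descend hH G)) ?_
  have hs : ∀ n τ, (∑ l, a l • y l).1 n τ = ∑ l, (a l : ZMod 2) * (y l).1 n τ := fun n τ => by
    have h1 : (∑ l, a l • y l).1 = ∑ l, a l • (y l).1 := by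
      rw [AddSubmonoidClass.coe_finsetSum]; rfl
    have h2 : (∑ l, a l • (y l).1) n τ = ∑ l, (a l • (y l).1) n τ := by
      let φ : Cochain (ZMod 2) (OrbitSpace H E) →+ ZMod 2 :=
        AddMonoidHom.mk' (fun c => c n τ) fun _ _ => rfl
      exact map_sum φ (fun l => a l • (y l).1) Finset.univ
    rw [h1, h2]
    exact Finset.sum_congr rfl fun l _ => zsmul_eq_mul _ _
  ext n τ
  change _ = z.1 n τ - (∑ l, a l • y l).1 n τ
  rw [hs]
  by_cases hn : n = 1
  · subst hn
    obtain ⟨σ, rfl⟩ := hH.exists_lift τ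
    have hzσ : z.1 1 ((orbitMk H).comp σ) = c (σ.face 0) - c (σ.face 1) := by
      rw [← Cochain.delta_single_zero, hδ]; rfl
    have hyσ : ∀ l, (y l).1 1 ((orbitMk H).comp σ) = halfDiff l σ := fun l => by
      change Cochain.single 1 (signCochain hH l) 1 ((orbitMk H).comp σ) = _
      rw [Cochain.single_self, signCochain_comp hE hH (fun t ht => hl t ht l)]
    rw [Cochain.delta_single_zero, Simp.comp_face, Simp.comp_face, descend_apply hH hG,
      descend_apply hH hG, hzσ]
    simp only [hyσ, G, halfDiff, mul_sub, Finset.sum_sub_distrib]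
    have e0 : (σ.face 0) (vtx 0) = σ (vtx 1) := Simp.pull_vtx _ _ _
    have e1 : (σ.face 1) (vtx 0) = σ (vtx 0) := Simp.pull_vtx _ _ _
    rw [e0, e1]
    ring
  · rw [Cochain.delta_single_of_ne hn, hz, Cochain.single_of_ne hn]
    simp only [y, Cochain.single_of_ne hn]
    simp

lemma Coh.add_self_zmod_two {X : Type*} [TopologicalSpace X] (x : Coh (ZMod 2) X) :
    x + x = 0 := by
  obtain ⟨z, rfl⟩ := Coh.mk_surjective x
  rw [← map_add, ← map_zero Coh.mk]
  exact congrArg Coh.mk (Subtype.ext (Cochain.ext fun n σ => zmod_two_add_self (z.1 n σ)))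

/-- `a * a` and `a` have the same parity. -/
lemma zsmul_sq_of_add_self {A : Type*} [Ring A] {x : A} (h : ∀ y : A, y + y = 0) (a : ℤ) :
    (a • x) * (a • x) = a • (x * x) := by
  rw [smul_mul_smul_comm]
  rcases Int.even_or_odd' a with ⟨b, rfl | rfl⟩
  · rw [two_mul, add_mul, add_smul, add_smul, h, h]
  · have : (2 * b + 1) * (2 * b + 1) = (2 * b * b + b) + (2 * b * b + b) + (2 * b + 1) := by ring
    rw [this, add_smul, add_smul, h, zero_add]

lemma sum_mul_self_of_commute {A ι : Type*} [Ring A] (h : ∀ y : A, y + y = 0) (s : Finset ι)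
    (f : ι → A) (hf : ∀ i j, Commute (f i) (f j)) :
    (∑ i ∈ s, f i) * ∑ i ∈ s, f i = ∑ i ∈ s, f i * f i := by
  classical
  induction s using Finset.induction_on with
  | empty => simp
  | insert i s hi ih =>
    rw [Finset.sum_insert hi, Finset.sum_insert hi, ← ih, add_mul, mul_add, mul_add,
      (Commute.sum_right s f (f i) fun j _ => hf i j).eq]
    rw [add_assoc, ← add_assoc ((∑ i ∈ s, f i) * f i), h, zero_add]

/-- The square of the combination of the sign classes with coefficients `a` is the pullback of the
class of the weight `a`. -/
lemma sum_signClass_sq (hE : IsPrincipalBundle (Torus k) E)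
    (hH : IsPrincipalBundle H E) (hl : ∀ t ∈ H, ∀ l, t l ^ 2 = 1)
    {u : Fin k → Coh ℤ (OrbitSpace (Torus k) E)}
    (hu : ∀ l, IsTransgression (Pi.single l 1) (u l)) (a : Fin k → ℤ) :
    (∑ l, a l • signClass hE hH (l := l) (fun t ht => hl t ht l)) *
      ∑ l, a l • signClass hE hH (l := l) (fun t ht => hl t ht l) =
    Coh.map (orbitBase E H) (Coh.coeff (Int.castRingHom (ZMod 2)) (weightClass u a)) := by
  rw [sum_mul_self_of_commute Coh.add_self_zmod_two, weightClass, map_sum, map_sum]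
  · refine Finset.sum_congr rfl fun l _ => ?_
    rw [zsmul_sq_of_add_self Coh.add_self_zmod_two, map_zsmul, map_zsmul,
      map_orbitBase_eq_signClass_sq hE hH hl (hu l)]
  · exact fun i j => ((signClass_commute hE hH (fun t ht => hl t ht i)
      (fun t ht => hl t ht j)).smul_left _).smul_right _

end SignClass

lemma Transgresses.comap {R P B P' B' : Type*} [Ring R] [TopologicalSpace P] [TopologicalSpace B]
    [TopologicalSpace P'] [TopologicalSpace B'] {q : C(P, B)} {q' : C(P', B')} {f : C(P, P')}
    {g : C(B, B')} (hfg : q'.comp f = g.comp q) {d : ℕ} {c : Simp d P' → R} {x : Coh R B'}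
    (h : Transgresses q' d c x) : Transgresses q d (fun σ => c (f.comp σ)) (Coh.map g x) := by
  obtain ⟨z, rfl, hz, hδ⟩ := h
  refine ⟨⟨Cochain.map g z.1, ?_⟩, rfl, ?_, ?_⟩
  · change Cochain.delta _ = 0
    rw [Cochain.delta_map, show Cochain.delta z.1 = 0 from z.2, map_zero]
  · refine Cochain.eq_single_of fun n hn σ => ?_
    change z.1 n _ = 0
    rw [hz, Cochain.single_of_ne hn]
  · rw [← Cochain.map_single, Cochain.delta_map, hδ]
    ext n σ
    change z.1 n ((q'.comp f).comp σ) = z.1 n ((g.comp q).comp σ)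
    rw [hfg]

/-! ### Values of a transgression cochain on multiple loops -/

section Loops

variable {N B : Type*} [TopologicalSpace N] [TopologicalSpace B] [MulAction ℂˣ N]

/-- A cochain with transgression has on the `n`-fold loop in an orbit of the circle the `n`-fold
value. -/
lemma Transgresses.loop_value {c : Simp 1 N → ℤ} {x : Coh ℤ (OrbitSpace ℂˣ N)}
    (h : Transgresses (orbitMk ℂˣ) 1 c x)
    (h1 : ∀ (v : N) (γ : Simp 1 N),
      (∀ s, γ s = Circle.toUnits (Circle.exp (2 * Real.pi * s 1)) • v) →
        c γ - c (ContinuousMap.const _ v) = -1)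
    {v : N} (hv : Continuous fun z : Circle => Circle.toUnits z • v) (n : ℤ) (γ : Simp 1 N)
    (hγ : ∀ s, γ s = Circle.toUnits (Circle.exp (2 * Real.pi * (n * s 1))) • v) :
    c γ - c (ContinuousMap.const _ v) = -n := by
  obtain ⟨z, -, hz, hδ⟩ := h
  have hd : ∀ σ : Simp 2 N, c (σ.face 0) - c (σ.face 1) + c (σ.face 2) =
      z.1 2 ((orbitMk _).comp σ) := fun σ => by
    rw [← Cochain.delta_single_one, hδ]; rfl
  let L : ℤ → Simp 1 N := fun n =>
    ⟨fun s => Circle.toUnits (Circle.exp (2 * Real.pi * (n * s 1))) • v, hv.comp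
      (Circle.exp.continuous.comp (continuous_const.mul
        (continuous_const.mul (continuous_simplex_apply 1))))⟩
  have hadd : ∀ n m, c (L (n + m)) - c (ContinuousMap.const _ v) =
      c (L n) - c (ContinuousMap.const _ v) + (c (L m) - c (ContinuousMap.const _ v)) := by
    intro n m
    -- A triangle in one orbit whose sides are the loops of degrees `n`, `m` and `n + m`. It has the
    -- same projection as the constant triangle at `v`, hence the same value of the coboundary.
    let T : Simp 2 N := ⟨fun s => Circle.toUnits
      (Circle.exp (2 * Real.pi * (n * s 1 + (n + m) * s 2))) • v, hv.comp
      (Circle.exp.continuous.comp (continuous_const.mul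
        ((continuous_const.mul (continuous_simplex_apply 1)).add
          (continuous_const.mul (continuous_simplex_apply 2)))))⟩
    have hsum : ∀ x : stdSimplex ℝ (Fin 2), x 0 + x 1 = 1 := fun x => stdSimplex.add_eq_one x
    have hface : ∀ (i : ℕ) (x : stdSimplex ℝ (Fin 2)), T.face i x = Circle.toUnits
      (Circle.exp (2 * Real.pi * (n * coface 1 i x 1 + (n + m) * coface 1 i x 2))) • v :=
      fun _ _ => rfl
    have e0 : T.face 0 = L m := by
      ext x
      rw [hface, coface_one_apply, coface_one_apply]
      refine congrArg (fun z => Circle.toUnits z • v) (circle_exp_two_pi_eq_iff.2 ⟨n, ?_⟩)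
      simp [clamp]
      rw [show x 0 = 1 - x 1 by linarith [hsum x]]
      ring
    have e1 : T.face 1 = L (n + m) := by
      ext x
      rw [hface, coface_one_apply, coface_one_apply]
      refine congrArg (fun z => Circle.toUnits z • v) (circle_exp_two_pi_eq_iff.2 ⟨0, ?_⟩)
      simp [clamp]
    have e2 : T.face 2 = L n := by
      ext x
      rw [hface, coface_one_apply, coface_one_apply]
      refine congrArg (fun z => Circle.toUnits z • v) (circle_exp_two_pi_eq_iff.2 ⟨0, ?_⟩)
      simp [clamp]
    have h2 := hd T
    have h3 := hd (ContinuousMap.const _ v)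
    have h4 : (orbitMk ℂˣ).comp T = (orbitMk ℂˣ).comp (ContinuousMap.const _ v) :=
      ContinuousMap.ext fun x => orbitMk_smul _ _
    rw [h4, ← h3, e0, e1, e2] at h2
    change _ = c (ContinuousMap.const _ v) - c (ContinuousMap.const _ v) +
      c (ContinuousMap.const _ v) at h2
    linarith
  let f : ℤ →+ ℤ := AddMonoidHom.mk' (fun n => c (L n) - c (ContinuousMap.const _ v)) hadd
  have h2 : f 1 = -1 := h1 v (L 1) fun s => by
    change Circle.toUnits (Circle.exp (2 * Real.pi * ((1 : ℤ) * s 1))) • v = _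
    simp
  have h3 : γ = L n := ContinuousMap.ext hγ
  rw [h3]
  have h4 : f n = n • f 1 := by rw [← map_zsmul]; simp
  change f n = _
  rw [h4, h2]; simp

end Loops

/-! ### Equivariant frames and the splitting into eigenlines -/

section Fibre

open Bundle

variable {k : ℕ} {ET B : Type*} [TopologicalSpace ET] [MulAction (Torus k) ET]
  [TopologicalSpace B]
  {𝕜 A : Type*} [Field 𝕜] [AddCommGroup A] [Module 𝕜 A] (F : Type*) {W : B → Type*}
  [∀ b, AddCommGroup (W b)] [∀ b, Module 𝕜 (W b)] [TopologicalSpace (TotalSpace F W)]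

/-- A linear equivariant trivialization `κ` of the pullback along `q : ET → B` of a vector bundle
over `B`, with fibre the representation `A`. -/
structure IsEquivariantFrame (q : C(ET, B)) (ρ : Torus k → A →ₗ[𝕜] A)
    (κ : ∀ e, A →ₗ[𝕜] W (q e)) : Prop where
  injective : ∀ e, Function.Injective (κ e)
  continuous : ∀ a, Continuous fun e => (⟨q e, κ e a⟩ : TotalSpace F W)
  equivariant : ∀ t e a, (⟨q (t • e), κ (t • e) (ρ t a)⟩ : TotalSpace F W) = ⟨q e, κ e a⟩

namespace IsEquivariantFrame

variable {F} {q : C(ET, B)} {ρ : Torus k → A →ₗ[𝕜] A} {κ : ∀ e, A →ₗ[𝕜] W (q e)}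

/-- The section given by a nonzero vector. -/
def vec (h : IsEquivariantFrame F q ρ κ) {a : A} (ha : a ≠ 0) : C(ET, NonzeroVec F W) :=
  ⟨fun e => ⟨⟨q e, κ e a⟩, (map_ne_zero_iff _ (h.injective e)).2 ha⟩,
    (h.continuous a).subtype_mk _⟩

/-- Equivariance reads `κ(te) ρ(t) = κ(e)`, so the section given by an eigenvector is multiplied by
the inverse of the eigenvalue. This inverse cancels the sign in the normalization of the first Chern
class. -/
lemma vec_smul (h : IsEquivariantFrame F q ρ κ) {a : A} (ha : a ≠ 0) {t : Torus k} {z : 𝕜ˣ}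
    (ht : ρ t a = z • a) (e : ET) : h.vec ha (t • e) = z⁻¹ • h.vec ha e := by
  refine Subtype.ext ?_
  change (⟨q (t • e), κ (t • e) a⟩ : TotalSpace F W) = ⟨q e, z⁻¹ • κ e a⟩
  have h1 : z⁻¹ • κ e a = κ e (z⁻¹ • a) := ((κ e).map_smul (↑z⁻¹ : 𝕜) a).symm
  have h2 : ρ t (z⁻¹ • a) = a := by
    refine ((ρ t).map_smul (↑z⁻¹ : 𝕜) a).trans ?_
    rw [ht]
    exact inv_smul_smul z a
  rw [h1, ← h.equivariant t e, h2]

variable {H : Subgroup (Torus k)}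

/-- The family of lines spanned by an eigenvector. -/
def line (h : IsEquivariantFrame F q ρ κ) {a : A} (ha : a ≠ 0) {Γ : Type*} [Group Γ]
    [MulAction Γ ET] (hΓ : ∀ (g : Γ) e, ∃ z : 𝕜ˣ, h.vec ha (g • e) = z • h.vec ha e) :
    C(OrbitSpace Γ ET, ProjBundle 𝕜 F W) :=
  orbitLift Γ ((orbitMk 𝕜ˣ).comp (h.vec ha)) fun g e => by
    obtain ⟨z, hz⟩ := hΓ g e
    exact (congrArg (orbitMk 𝕜ˣ) hz).trans (orbitMk_smul z _)

/-- The eigenlines lift `β` to the bundle of decompositions, and the defining product formula is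
pulled back along this lift. The product is over a list because the cohomology ring is not assumed
commutative. -/
lemma splitProduct (h : IsEquivariantFrame F q ρ κ) {n : ℕ} {a : Fin n → A}
    (ha : LinearIndependent 𝕜 a) {Γ : Type*} [Group Γ] [MulAction Γ ET]
    (hΓ : ∀ i (g : Γ) e, ∃ z : 𝕜ˣ, h.vec (ha.ne_zero i) (g • e) = z • h.vec (ha.ne_zero i) e)
    {R : Type*} [Ring R] {t : Coh R (ProjBundle 𝕜 F W)} {x : Coh R B}
    (hx : IsSplitProduct 𝕜 F W n t x) (β : C(OrbitSpace Γ ET, B))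
    (hβ : ∀ e, β (orbitMk Γ e) = q e) :
    Coh.map β x =
      (List.ofFn fun i => 1 + Coh.map (h.line (ha.ne_zero i) (hΓ i)) t).prod := by
  have hmem : ∀ y : OrbitSpace Γ ET, ∃ (v : Fin n → W (β y)) (hv : LinearIndependent 𝕜 v),
      ∀ i, h.line (ha.ne_zero i) (hΓ i) y =
        orbitMk 𝕜ˣ (NonzeroVec.of F (v i) (hv.ne_zero i)) := fun y => by
    obtain ⟨e, rfl⟩ := orbitMk_surjective y
    rw [hβ e]
    exact ⟨fun i => κ e (a i), ha.map' (κ e) (LinearMap.ker_eq_bot.2 (h.injective e)),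
      fun i => rfl⟩
  let s : C(OrbitSpace Γ ET, SplitBundle 𝕜 F W n) :=
    ⟨fun y => ⟨(β y, fun i => h.line (ha.ne_zero i) (hΓ i) y), hmem y⟩, by
      refine Continuous.subtype_mk (β.continuous.prodMk (continuous_pi fun i => ?_)) _
      exact (h.line (ha.ne_zero i) (hΓ i)).continuous⟩
  have h1 : β = (SplitBundle.base 𝕜 F W n).comp s := rfl
  have h2 : ∀ i, h.line (ha.ne_zero i) (hΓ i) = (SplitBundle.line 𝕜 F W n i).comp s :=
    fun i => rfl
  rw [h1, Coh.map_comp, hx, map_list_prod, List.map_ofFn]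
  congr 2
  funext i
  change Coh.map s (1 + _) = _
  rw [map_add, map_one, h2 i, Coh.map_comp]

end IsEquivariantFrame

end Fibre

/-! ### Chern classes of sums of weight lines -/

section Chern

open Bundle

variable {k : ℕ} {ET B : Type*} [TopologicalSpace ET] [MulAction (Torus k) ET]
  [ContinuousSMul (Torus k) ET] [TopologicalSpace B]
  {A : Type*} [AddCommGroup A] [Module ℂ A] {F : Type*} {W : B → Type*}
  [∀ b, AddCommGroup (W b)] [∀ b, Module ℂ (W b)] [TopologicalSpace (TotalSpace F W)]
  {q : C(ET, B)} {ρ : Torus k → A →ₗ[ℂ] A} {κ : ∀ e, A →ₗ[ℂ] W (q e)}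

/-- The character of a weight as an element of the circle. -/
def weightCircle (a : Fin k → ℤ) (t : Torus k) : Circle := ∏ l, t l ^ a l

lemma coe_weightCircle (a : Fin k → ℤ) (t : Torus k) : (weightCircle a t : ℂ) = weightChar a t :=
  rfl

lemma weightCircle_mulSingle (a : Fin k → ℤ) (l : Fin k) (z : Circle) :
    weightCircle a (Pi.mulSingle l z) = z ^ a l := by
  rw [weightCircle, Finset.prod_eq_single l]
  · simp
  · intro j _ hj; simp [hj]
  · simp

namespace IsEquivariantFrame

lemma vec_smul_weight (h : IsEquivariantFrame F q ρ κ) {a : A} (ha : a ≠ 0) {b : Fin k → ℤ}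
    (hb : ∀ t, ρ t a = weightChar b t • a) (t : Torus k) (e : ET) :
    h.vec ha (t • e) = Circle.toUnits (weightCircle b t)⁻¹ • h.vec ha e := by
  rw [map_inv]
  exact h.vec_smul ha (z := Circle.toUnits (weightCircle b t)) (hb t) e

/-- The eigenvector section carries the `l`-th coordinate circle to the `(-b l)`-fold loop in a
fibre of the tautological bundle, where the cochain, relative to the constant path, has the value `b
l`. -/
lemma isTransgression_line (h : IsEquivariantFrame F q ρ κ) {a : A} (ha : a ≠ 0) {b : Fin k → ℤ}
    (hb : ∀ t, ρ t a = weightChar b t • a)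
    (hc : ∀ e, Continuous fun z : Circle => (⟨q e, κ e ((z : ℂ) • a)⟩ : TotalSpace F W))
    {t : Coh ℤ (ProjBundle ℂ F W)} (ht : IsTautologicalChern F W t) :
    IsTransgression b (Coh.map
      (h.line ha (Γ := Torus k) fun g e => ⟨_, h.vec_smul_weight ha hb g e⟩) t) := by
  obtain ⟨c, hct, hc1⟩ := ht
  refine ⟨fun σ => c ((h.vec ha).comp σ), hct.comap (q := orbitMk (Torus k)) (f := h.vec ha)
    (g := h.line ha fun g e => ⟨_, h.vec_smul_weight ha hb g e⟩) (ContinuousMap.ext fun e => rfl),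
    fun e l γ hγ => ?_⟩
  have hv : Continuous fun z : Circle => Circle.toUnits z • h.vec ha e := by
    refine Continuous.subtype_mk (f := fun z : Circle =>
      (⟨q e, (z : ℂ) • κ e a⟩ : TotalSpace F W)) ?_ _
    refine (hc e).congr fun z => ?_
    rw [map_smul]
  have := hct.loop_value hc1 hv (-b l) ((h.vec ha).comp γ) fun s => by
    rw [ContinuousMap.comp_apply, hγ s, h.vec_smul_weight ha hb, weightCircle_mulSingle]
    congr 2
    rw [← Circle.exp_zsmul, ← Circle.exp_neg]
    congr 1
    simp; ring
  rw [neg_neg] at this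
  exact this

/-- The restriction of the total Chern class of a bundle that is a sum of line bundles given by
weights. -/
lemma chern_eq (h : IsEquivariantFrame F q ρ κ) (hE : IsPrincipalBundle (Torus k) ET)
    {u : Fin k → Coh ℤ (OrbitSpace (Torus k) ET)}
    (hu : ∀ l, IsTransgression (Pi.single l 1) (u l)) {n : ℕ} {a : Fin n → A}
    (ha : LinearIndependent ℂ a) {b : Fin n → Fin k → ℤ}
    (hb : ∀ i t, ρ t (a i) = weightChar (b i) t • a i)
    (hc : ∀ i e, Continuous fun z : Circle => (⟨q e, κ e ((z : ℂ) • a i)⟩ : TotalSpace F W))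
    {x : Coh ℤ B} (hx : IsTotalChern F W n x) (β : C(OrbitSpace (Torus k) ET, B))
    (hβ : ∀ e, β (orbitMk (Torus k) e) = q e) :
    Coh.map β x = (List.ofFn fun i => 1 + weightClass u (b i)).prod := by
  obtain ⟨t, ht, hx⟩ := hx
  rw [h.splitProduct ha (Γ := Torus k)
    (fun i g e => ⟨_, h.vec_smul_weight (ha.ne_zero i) (hb i) g e⟩) hx β hβ]
  congr 2
  funext i
  rw [(h.isTransgression_line (ha.ne_zero i) (hb i) (hc i) ht).eq_weightClass hE hu]

end IsEquivariantFrame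

end Chern

/-! ### Stiefel–Whitney classes over the group of signs -/

section SW

open Bundle

variable {k : ℕ} {ET B : Type*} [TopologicalSpace ET] [MulAction (Torus k) ET]
  [ContinuousSMul (Torus k) ET] [TopologicalSpace B]
  {A : Type*} [AddCommGroup A] [Module ℝ A] {F : Type*} {W : B → Type*}
  [∀ b, AddCommGroup (W b)] [∀ b, Module ℝ (W b)] [TopologicalSpace (TotalSpace F W)]
  {q : C(ET, B)} {ρ : Torus k → A →ₗ[ℝ] A} {κ : ∀ e, A →ₗ[ℝ] W (q e)} {H : Subgroup (Torus k)}

/-- The value of the character of a weight on a tuple of signs. -/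
def weightSign (b : Fin k → ℤ) (t : Torus k) : ℝˣ := (-1) ^ (∑ l, b l * signLog (t l))

namespace IsEquivariantFrame

lemma vec_smul_sign (h : IsEquivariantFrame F q ρ κ) {a : A} (ha : a ≠ 0) {b : Fin k → ℤ}
    (hb : ∀ t ∈ H, ρ t a = weightSign b t • a) (t : H) (e : ET) :
    h.vec ha (t • e) = (weightSign b t.1)⁻¹ • h.vec ha e :=
  h.vec_smul ha (hb t.1 t.2) e

/-- A tuple of signs multiplies the section by `±1`. The cochain jumps by `1` exactly in the case of
`-1`, that is, when the exponent in `weightSign` is odd. -/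
lemma transgresses_line (h : IsEquivariantFrame F q ρ κ) {a : A} (ha : a ≠ 0) {b : Fin k → ℤ}
    (hb : ∀ t ∈ H, ρ t a = weightSign b t • a)
    {r : Coh (ZMod 2) (ProjBundle ℝ F W)} (hr : IsTautologicalSW F W r) :
    ∃ c : Simp 0 ET → ZMod 2, Transgresses (orbitMk H) 0 c (Coh.map
      (h.line ha (Γ := H) fun g e => ⟨_, h.vec_smul_sign ha hb g e⟩) r) ∧
      ∀ t ∈ H, ∀ e, c (ContinuousMap.const _ (t • e)) - c (ContinuousMap.const _ e) =
        ((∑ l, b l * signLog (t l) : ℤ) : ZMod 2) := by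
  obtain ⟨c, hcr, hc1⟩ := hr
  refine ⟨fun σ => c ((h.vec ha).comp σ), hcr.comap (q := orbitMk H) (f := h.vec ha)
    (g := h.line ha fun g e => ⟨_, h.vec_smul_sign ha hb g e⟩) (ContinuousMap.ext fun e => rfl),
    fun t ht e => ?_⟩
  change c (ContinuousMap.const _ (h.vec ha (t • e))) - c (ContinuousMap.const _ (h.vec ha e)) = _
  have h1 : h.vec ha (t • e) = (weightSign b t)⁻¹ • h.vec ha e := h.vec_smul_sign ha hb ⟨t, ht⟩ e
  rw [h1, weightSign]
  rcases Int.even_or_odd (∑ l, b l * signLog (t l)) with hs | hs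
  · rw [hs.neg_one_zpow, inv_one, one_smul, sub_self]
    exact ((ZMod.intCast_zmod_eq_zero_iff_dvd _ 2).2 hs.two_dvd).symm
  · rw [hs.neg_one_zpow, inv_neg, inv_one, hc1]
    obtain ⟨n, hn⟩ := hs
    rw [hn]
    push_cast
    rw [show (2 : ZMod 2) = 0 from rfl, zero_mul, zero_add]

/-- The restriction of the total Stiefel-Whitney class of a bundle that is a sum of line bundles
given by weights, on the orbit space of a group of signs. -/
lemma sw_eq (h : IsEquivariantFrame F q ρ κ) (hE : IsPrincipalBundle (Torus k) ET)
    (hH : IsPrincipalBundle H ET) (hl : ∀ t ∈ H, ∀ l, t l ^ 2 = 1)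
    {u : Fin k → Coh ℤ (OrbitSpace (Torus k) ET)}
    (hu : ∀ l, IsTransgression (Pi.single l 1) (u l)) {n : ℕ} {a : Fin n → A}
    (ha : LinearIndependent ℝ a) {b : Fin n → Fin k → ℤ}
    (hb : ∀ i, ∀ t ∈ H, ρ t (a i) = weightSign (b i) t • a i)
    {x : Coh (ZMod 2) B} (hx : IsTotalSW F W n x) (β : C(OrbitSpace H ET, B))
    (hβ : ∀ e, β (orbitMk H e) = q e) :
    ∃ R : (Fin k → ℤ) → Coh (ZMod 2) (OrbitSpace H ET),
      (∀ b, R b * R b = Coh.map (orbitBase ET H)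
        (Coh.coeff (Int.castRingHom (ZMod 2)) (weightClass u b))) ∧
      Coh.map β x = (List.ofFn fun i => 1 + R (b i)).prod := by
  obtain ⟨r, hr, hx⟩ := hx
  -- `R b` is the first Stiefel–Whitney class of the real line bundle with sign character `b`. What
  -- matters later is that its square comes from `BT`.
  refine ⟨fun b => ∑ l, b l • signClass hE hH (l := l) (fun t ht => hl t ht l), fun b => ?_, ?_⟩
  · rw [sum_signClass_sq hE hH hl hu b]
  rw [h.splitProduct ha (Γ := H)
    (fun i g e => ⟨_, h.vec_smul_sign (ha.ne_zero i) (hb i) g e⟩) hx β hβ]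
  congr 2
  funext i
  obtain ⟨c, hc, hc'⟩ := h.transgresses_line (ha.ne_zero i) (hb i) hr
  rw [eq_sum_signClass hE hH hl (b i) hc hc']

end IsEquivariantFrame

end SW

open Bundle

/-! ### Maps into the total space of the Borel construction -/

section Continuity

variable {𝕜 G : Type*} [Field 𝕜] [Group G] (EG : Type*) [TopologicalSpace EG] [MulAction G EG]
  {M : Type*} [TopologicalSpace M] [MulAction G M] (F : Type*) {V : M → Type*}
  [∀ x, AddCommGroup (V x)] [∀ x, Module 𝕜 (V x)] [TopologicalSpace (TotalSpace F V)]
  (act : ∀ (g : G) (x : M), V x →ₗ[𝕜] V (g • x))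

/-- A map to the total space of the Borel construction of a bundle is continuous if it lifts to the
product with the universal bundle. -/
lemma continuous_borel {X : Type*} [TopologicalSpace X] {e : X → EG} {v : X → TotalSpace F V}
    (he : Continuous e) (hv : Continuous v) (f : X → TotalSpace F (BorelBundle EG act))
    (h : ∀ x, ∃ h : orbitMk G (e x, (v x).1) = (f x).1, (f x).2.1 ⟨(e x, (v x).1), h⟩ = (v x).2) :
    Continuous f := by
  -- The total space has the topology coinduced from the graph, so it is enough to lift `f`
  -- continuously to the graph.
  let _ : TopologicalSpace (BorelGraph EG F act) :=
    TopologicalSpace.induced (fun x : BorelGraph EG F act => x.1.1) inferInstance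
  have h1 : Continuous fun x : BorelGraph EG F act => x.1.2 := continuous_coinduced_rng
  let l : X → BorelGraph EG F act := fun x => ⟨((e x, v x), f x), h x⟩
  have h2 : Continuous l := continuous_induced_rng.2 (he.prodMk hv)
  exact h1.comp h2

/-- An equivariant family of vectors over an orbit is determined by one of its values. -/
lemma borel_ext {b b' : HomotopyQuotient G EG M} (y : EG × M) (hb : orbitMk G y = b)
    (hb' : orbitMk G y = b') (f : BorelBundle EG act b) (f' : BorelBundle EG act b')
    (h : f.1 ⟨y, hb⟩ = f'.1 ⟨y, hb'⟩) :
    (⟨b, f⟩ : TotalSpace F (BorelBundle EG act)) = ⟨b', f'⟩ := by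
  subst hb
  subst hb'
  congr 1
  refine Subtype.ext (funext ?_)
  rintro ⟨z, hz⟩
  obtain ⟨g, rfl⟩ := orbitMk_eq_iff.1 hz
  have h1 := f.2 g ⟨y, rfl⟩
  have h2 := f'.2 g ⟨y, rfl⟩
  rw [h] at h1
  exact h1.trans h2.symm

end Continuity

/-! ### The tangent frame over a fixed point -/

section Tangent

variable {k d : ℕ} {M : Type*} [TopologicalSpace M]
  [ChartedSpace (EuclideanSpace ℝ (Fin d)) M] [MulAction (Torus k) M]

/-- The differential of the action, as a map of the model space. -/
def modelAction (t : Torus k) (p : M) :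
    EuclideanSpace ℝ (Fin d) →ₗ[ℝ] EuclideanSpace ℝ (Fin d) :=
  tangentAction (d := d) t p

lemma mdifferentiable_smul
    (hsmooth : ContMDiff ((ModelWithCorners.pi fun _ : Fin k => 𝓡 1).prod (𝓡 d))
      (𝓡 d) ∞ (fun q : Torus k × M => q.1 • q.2)) (t : Torus k) :
    MDifferentiable (𝓡 d) (𝓡 d) fun p : M => t • p := by
  have h1 : ContMDiff (𝓡 d) ((ModelWithCorners.pi fun _ : Fin k => 𝓡 1).prod (𝓡 d)) ∞
      fun p : M => (t, p) := contMDiff_const.prodMk contMDiff_id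
  exact (hsmooth.comp h1).mdifferentiable (by simp)

lemma modelAction_mul
    (hsmooth : ContMDiff ((ModelWithCorners.pi fun _ : Fin k => 𝓡 1).prod (𝓡 d))
      (𝓡 d) ∞ (fun q : Torus k × M => q.1 • q.2)) (s t : Torus k) (p : M)
    (v : EuclideanSpace ℝ (Fin d)) :
    modelAction (s * t) p v = modelAction s (t • p) (modelAction t p v) := by
  have h1 : ∀ f f' : M → M, f = f' →
      (mfderiv (𝓡 d) (𝓡 d) f p : EuclideanSpace ℝ (Fin d) →L[ℝ] EuclideanSpace ℝ (Fin d)) =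
        mfderiv (𝓡 d) (𝓡 d) f' p := by rintro f _ rfl; rfl
  have h2 := h1 (fun q : M => (s * t) • q) ((fun q => s • q) ∘ fun q => t • q)
    (funext fun q => mul_smul s t q)
  have h3 := mfderiv_comp p (mdifferentiable_smul hsmooth s (t • p))
    (mdifferentiable_smul hsmooth t p)
  exact DFunLike.congr_fun (h2.trans h3) v

lemma modelAction_one (p : M) (v : EuclideanSpace ℝ (Fin d)) :
    modelAction (1 : Torus k) p v = v := by
  have h1 : ∀ f f' : M → M, f = f' →
      (mfderiv (𝓡 d) (𝓡 d) f p : EuclideanSpace ℝ (Fin d) →L[ℝ] EuclideanSpace ℝ (Fin d)) =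
        mfderiv (𝓡 d) (𝓡 d) f' p := by rintro f _ rfl; rfl
  have h2 := h1 (fun q : M => (1 : Torus k) • q) id (funext fun q => one_smul _ q)
  exact DFunLike.congr_fun (h2.trans mfderiv_id) v

/-- Every tangent space is the same model space, so the transport along `t • p = p` does nothing.
`modelAction` avoids it. -/
lemma isotropyRep_apply (p : MulAction.fixedPoints (Torus k) M) (t : Torus k)
    (v : EuclideanSpace ℝ (Fin d)) : isotropyRep p t v = modelAction t p.1 v := by
  have key : ∀ (q q' : M) (h : q = q')
      (f : TangentSpace (𝓡 d) p.1 →ₗ[ℝ] TangentSpace (𝓡 d) q),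
      (h ▸ f : TangentSpace (𝓡 d) p.1 →ₗ[ℝ] TangentSpace (𝓡 d) q') v = f v := by
    rintro q _ rfl f; rfl
  exact key _ _ (p.2 t) (tangentAction t p.1)

variable {ET : Type*} [TopologicalSpace ET] [MulAction (Torus k) ET]

/-- The lift to `ET` of the inclusion of a fixed point. -/
def fixedLift (ET : Type*) [TopologicalSpace ET] [MulAction (Torus k) ET]
    (p : MulAction.fixedPoints (Torus k) M) : C(ET, HomotopyQuotient (Torus k) ET M) :=
  (fixedPointInclusion p).comp (orbitMk (Torus k))

lemma smul_prod_fixed {k : ℕ} {M ET : Type*} [MulAction (Torus k) M] [MulAction (Torus k) ET]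
    (p : MulAction.fixedPoints (Torus k) M) (t : Torus k) (e : ET) :
    t • (e, p.1) = (t • e, p.1) := Prod.ext rfl (p.2 t)

/-- The group element relating two points over the same point of the Borel construction. -/
def orbitDiff {b : HomotopyQuotient (Torus k) ET M} {y : ET × M}
    (hb : orbitMk (Torus k) y = b) (z : {z : ET × M // orbitMk (Torus k) z = b}) : Torus k :=
  (orbitMk_eq_iff.1 (z.2.trans hb.symm)).choose

lemma orbitDiff_smul {b : HomotopyQuotient (Torus k) ET M} {y : ET × M}
    (hb : orbitMk (Torus k) y = b) (z : {z : ET × M // orbitMk (Torus k) z = b}) :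
    orbitDiff hb z • y = z.1 :=
  (orbitMk_eq_iff.1 (z.2.trans hb.symm)).choose_spec

variable [ContinuousSMul (Torus k) ET]

lemma orbitDiff_eq (hE : IsPrincipalBundle (Torus k) ET) {b : HomotopyQuotient (Torus k) ET M}
    {y : ET × M} (hb : orbitMk (Torus k) y = b) {z : {z : ET × M // orbitMk (Torus k) z = b}}
    {t : Torus k} (ht : t • y = z.1) : orbitDiff hb z = t :=
  hE.smul_left_cancel (e := y.1)
    (congrArg Prod.fst ((orbitDiff_smul hb z).trans ht.symm))

variable (d) in
/-- A tangent vector at a fixed point as an element of a fibre of the Borel construction. -/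
def tangentFrame (hE : IsPrincipalBundle (Torus k) ET)
    (hsmooth : ContMDiff ((ModelWithCorners.pi fun _ : Fin k => 𝓡 1).prod (𝓡 d))
      (𝓡 d) ∞ (fun q : Torus k × M => q.1 • q.2))
    (p : MulAction.fixedPoints (Torus k) M) (e : ET) : EuclideanSpace ℝ (Fin d) →ₗ[ℝ]
      BorelBundle ET (V := fun p : M => TangentSpace (𝓡 d) p) tangentAction (fixedLift ET p e) where
  toFun v := ⟨fun z => modelAction (orbitDiff (y := (e, p.1)) rfl z) p.1 v, fun g z => by
    -- The family carries `v` along the orbit by differentials of the action. The action on `ET` is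
    -- free, so the group element is unique and therefore equivariant in the point of the orbit.
    have h1 : orbitDiff (y := (e, p.1)) rfl
        (⟨g • z.1, (orbitMk_smul g z.1).trans z.2⟩ : {z : ET × M // orbitMk (Torus k) z = _}) =
        g * orbitDiff (y := (e, p.1)) rfl z :=
      orbitDiff_eq hE rfl ((mul_smul _ _ _).trans
        (congrArg (g • ·) (orbitDiff_smul (y := (e, p.1)) rfl z)))
    have h2 : orbitDiff (y := (e, p.1)) rfl z • p.1 = z.1.2 :=
      congrArg Prod.snd (orbitDiff_smul (y := (e, p.1)) rfl z)
    have h3 := modelAction_mul hsmooth g (orbitDiff (y := (e, p.1)) rfl z) p.1 v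
    rw [h2, ← h1] at h3
    exact h3⟩
  map_add' v w := Subtype.ext (funext fun z => map_add (modelAction _ p.1) v w)
  map_smul' c v := Subtype.ext (funext fun z => map_smul (modelAction _ p.1) c v)

variable (hE : IsPrincipalBundle (Torus k) ET)
    (hsmooth : ContMDiff ((ModelWithCorners.pi fun _ : Fin k => 𝓡 1).prod (𝓡 d))
      (𝓡 d) ∞ (fun q : Torus k × M => q.1 • q.2))
    (p : MulAction.fixedPoints (Torus k) M)

lemma tangentFrame_apply (e : ET) (v : EuclideanSpace ℝ (Fin d)) (t : Torus k)
    {z : {z : ET × M // orbitMk (Torus k) z = fixedLift ET p e}} (ht : t • (e, p.1) = z.1) :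
    (tangentFrame d hE hsmooth p e v).1 z = modelAction t p.1 v :=
  congrArg (fun s => modelAction s p.1 v) (orbitDiff_eq hE rfl ht)

lemma tangentFrame_apply_self (e : ET) (v : EuclideanSpace ℝ (Fin d)) :
    (tangentFrame d hE hsmooth p e v).1 ⟨(e, p.1), rfl⟩ = v :=
  (tangentFrame_apply hE hsmooth p e v 1 (one_smul _ _)).trans (modelAction_one p.1 v)

variable [IsManifold (𝓡 d) ∞ M]

/-- Both sides are families over the same orbit and are compared at the point `(t • e, p)`. -/
lemma tangentFrame_smul (t : Torus k) (e : ET) (v : EuclideanSpace ℝ (Fin d)) :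
    (⟨fixedLift ET p (t • e), tangentFrame d hE hsmooth p (t • e) (modelAction t p.1 v)⟩ :
      TotalSpace (EuclideanSpace ℝ (Fin d))
        (BorelBundle ET (V := fun p : M => TangentSpace (𝓡 d) p) tangentAction)) =
      ⟨fixedLift ET p e, tangentFrame d hE hsmooth p e v⟩ := by
  refine borel_ext ET _ _ (t • e, p.1) rfl ?_ _ _ ?_
  · rw [← smul_prod_fixed]; exact orbitMk_smul _ _
  · exact (tangentFrame_apply_self hE hsmooth p (t • e) _).trans
      (tangentFrame_apply hE hsmooth p e v t (smul_prod_fixed p t e)).symm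

lemma continuous_tangentFrame : Continuous fun x : ET × EuclideanSpace ℝ (Fin d) =>
    (⟨fixedLift ET p x.1, tangentFrame d hE hsmooth p x.1 x.2⟩ :
      TotalSpace (EuclideanSpace ℝ (Fin d))
        (BorelBundle ET (V := fun p : M => TangentSpace (𝓡 d) p) tangentAction)) := by
  have hv : Continuous fun v : EuclideanSpace ℝ (Fin d) =>
      (⟨p.1, v⟩ : TotalSpace (EuclideanSpace ℝ (Fin d)) fun p : M => TangentSpace (𝓡 d) p) :=
    FiberBundle.continuous_totalSpaceMk (EuclideanSpace ℝ (Fin d))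
      (fun p : M => TangentSpace (𝓡 d) p) p.1
  exact continuous_borel ET _ _ continuous_fst (hv.comp continuous_snd) _
    fun x => ⟨rfl, tangentFrame_apply_self hE hsmooth p x.1 x.2⟩

lemma isEquivariantFrame_tangentFrame : IsEquivariantFrame (EuclideanSpace ℝ (Fin d))
    (fixedLift ET p) (fun t : Torus k => modelAction t p.1) (tangentFrame d hE hsmooth p) where
  injective e v w h := by
    rw [← tangentFrame_apply_self hE hsmooth p e v, h]
    exact tangentFrame_apply_self hE hsmooth p e w
  continuous v := (continuous_tangentFrame hE hsmooth p).comp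
    (continuous_id.prodMk continuous_const)
  equivariant t e v := tangentFrame_smul hE hsmooth p t e v

end Tangent

/-! ### The frame for an invariant almost complex structure -/

section AlmostComplex

variable {k m : ℕ} {M : Type*} [TopologicalSpace M]
  [ChartedSpace (EuclideanSpace ℝ (Fin (2 * m))) M] [IsManifold (𝓡 (2 * m)) ∞ M]
  [MulAction (Torus k) M] {ET : Type*} [TopologicalSpace ET] [MulAction (Torus k) ET]
  [ContinuousSMul (Torus k) ET] (J : InvariantACS k (2 * m) M)

/-- The isotropy representation as a complex representation. -/
def complexIsotropyRep (p : MulAction.fixedPoints (Torus k) M) (t : Torus k) :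
    WithComplex J.toFiberComplexStructure p.1 →ₗ[ℂ] WithComplex J.toFiberComplexStructure p.1 :=
  Eq.rec (motive := fun q _ => WithComplex J.toFiberComplexStructure p.1 →ₗ[ℂ]
    WithComplex J.toFiberComplexStructure q) (J.action t p.1) (p.2 t)

lemma complexIsotropyRep_apply (p : MulAction.fixedPoints (Torus k) M) (t : Torus k)
    (v : EuclideanSpace ℝ (Fin (2 * m))) :
    complexIsotropyRep J p t v = modelAction t p.1 v := by
  have key : ∀ (q q' : M) (h : q = q')
      (f : WithComplex J.toFiberComplexStructure p.1 →ₗ[ℂ]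
        WithComplex J.toFiberComplexStructure q),
      (Eq.rec (motive := fun q _ => WithComplex J.toFiberComplexStructure p.1 →ₗ[ℂ]
        WithComplex J.toFiberComplexStructure q) f h) v =
        (f v : EuclideanSpace ℝ (Fin (2 * m))) := by
    rintro q _ rfl f; rfl
  exact key _ _ (p.2 t) (J.action t p.1)

variable (hE : IsPrincipalBundle (Torus k) ET)
    (hsmooth : ContMDiff ((ModelWithCorners.pi fun _ : Fin k => 𝓡 1).prod (𝓡 (2 * m)))
      (𝓡 (2 * m)) ∞ (fun q : Torus k × M => q.1 • q.2))
    (p : MulAction.fixedPoints (Torus k) M)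

/-- The complex linear version of `tangentFrame`. -/
def complexFrame (e : ET) : WithComplex J.toFiberComplexStructure p.1 →ₗ[ℂ]
    BorelBundle ET J.action (fixedLift ET p e) where
  toFun v := ⟨(tangentFrame (2 * m) hE hsmooth p e v).1, (tangentFrame (2 * m) hE hsmooth p e v).2⟩
  map_add' v w := Subtype.ext (congrArg Subtype.val ((tangentFrame (2 * m) hE hsmooth p e).map_add v w))
  map_smul' c v := Subtype.ext (funext fun z => by
    obtain ⟨z, hz⟩ := z
    obtain ⟨g, rfl⟩ := orbitMk_eq_iff.1 (hz.trans (show _ = orbitMk _ (e, p.1) from rfl))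
    have h1 : ∀ w : EuclideanSpace ℝ (Fin (2 * m)),
        (tangentFrame (2 * m) hE hsmooth p e w).1 ⟨g • (e, p.1), hz⟩ = modelAction g p.1 w :=
      fun w => tangentFrame_apply hE hsmooth p e w g rfl
    -- Complex linearity at the other points of the orbit is the invariance of `J`.
    have h2 := (J.action g p.1).map_smul c v
    exact (h1 _).trans (h2.trans (congrArg
      (fun w : WithComplex J.toFiberComplexStructure (g • p.1) => c • w) (h1 v).symm)))

lemma continuous_complexFrame {X : Type*} [TopologicalSpace X] {e : X → ET}
    {v : X → EuclideanSpace ℝ (Fin (2 * m))} (he : Continuous e) (hv : Continuous v) :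
    Continuous fun x => (⟨fixedLift ET p (e x), complexFrame J hE hsmooth p (e x) (v x)⟩ :
      TotalSpace (EuclideanSpace ℝ (Fin (2 * m))) (BorelBundle ET J.action)) := by
  have h1 : Continuous fun v : EuclideanSpace ℝ (Fin (2 * m)) =>
      (⟨p.1, v⟩ : TotalSpace (EuclideanSpace ℝ (Fin (2 * m)))
        fun p : M => TangentSpace (𝓡 (2 * m)) p) :=
    FiberBundle.continuous_totalSpaceMk (EuclideanSpace ℝ (Fin (2 * m)))
      (fun p : M => TangentSpace (𝓡 (2 * m)) p) p.1
  have h2 : Continuous fun x => (⟨p.1, v x⟩ : TotalSpace (EuclideanSpace ℝ (Fin (2 * m)))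
      (WithComplex J.toFiberComplexStructure)) := continuous_induced_rng.2 (h1.comp hv)
  exact continuous_borel ET _ _ he h2 _
    fun x => ⟨rfl, tangentFrame_apply_self hE hsmooth p (e x) (v x)⟩

/-- The complex scalars enter only through `J`, so continuity in `z` is read off from the formula
`re z • v + im z • J v`. -/
lemma continuous_complexFrame_circle (e : ET) (v : WithComplex J.toFiberComplexStructure p.1) :
    Continuous fun z : Circle => (⟨fixedLift ET p e,
      complexFrame J hE hsmooth p e ((z : ℂ) • v)⟩ :
      TotalSpace (EuclideanSpace ℝ (Fin (2 * m))) (BorelBundle ET J.action)) := by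
  refine continuous_complexFrame J hE hsmooth p continuous_const ?_
  let w : EuclideanSpace ℝ (Fin (2 * m)) := v
  let w' : EuclideanSpace ℝ (Fin (2 * m)) := J.J p.1 v
  have h1 : Continuous fun z : Circle => (z : ℂ).re • w + (z : ℂ).im • w' := by fun_prop
  exact h1.congr fun z => (complexModule_smul (J.J p.1) (J.sq p.1) z v).symm

lemma isEquivariantFrame_complexFrame : IsEquivariantFrame (EuclideanSpace ℝ (Fin (2 * m)))
    (fixedLift ET p) (complexIsotropyRep J p) (complexFrame J hE hsmooth p) where
  injective e v w h := by
    have h1 := tangentFrame_apply_self hE hsmooth p e v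
    have h2 := tangentFrame_apply_self hE hsmooth p e w
    have h3 : (tangentFrame (2 * m) hE hsmooth p e v).1 = (tangentFrame (2 * m) hE hsmooth p e w).1 :=
      congrArg Subtype.val h
    rw [h3] at h1
    exact h1.symm.trans h2
  continuous v := continuous_complexFrame J hE hsmooth p continuous_id
    (continuous_const (y := (show EuclideanSpace ℝ (Fin (2 * m)) from v)))
  equivariant t e v := by
    refine borel_ext ET _ _ (t • e, p.1) rfl ?_ _ _ ?_
    · rw [← smul_prod_fixed]; exact orbitMk_smul _ _
    · refine (tangentFrame_apply_self hE hsmooth p (t • e) _).trans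
        (Eq.trans ?_ (tangentFrame_apply hE hsmooth p e v t (smul_prod_fixed p t e)).symm)
      exact complexIsotropyRep_apply J p t v

end AlmostComplex

/-! ### The complexified tangent frame -/

section Complexification

variable {k d : ℕ} {M : Type*} [TopologicalSpace M]
  [ChartedSpace (EuclideanSpace ℝ (Fin d)) M] [IsManifold (𝓡 d) ∞ M] [MulAction (Torus k) M]
  {ET : Type*} [TopologicalSpace ET] [MulAction (Torus k) ET] [ContinuousSMul (Torus k) ET]

lemma complexified_smul {B : Type*} {V : B → Type*} [∀ b, AddCommGroup (V b)]
    [∀ b, Module ℝ (V b)] {b : B} (z : ℂ) (v : Complexified V b) :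
    z • v = (z.re • v.1 - z.im • v.2, z.re • v.2 + z.im • v.1) := by
  have h := complexModule_smul (W := V b × V b)
    ((-LinearMap.snd ℝ (V b) (V b)).prod (LinearMap.fst ℝ (V b) (V b))) (fun _ => rfl) z v
  refine h.trans (Prod.ext ?_ rfl)
  change z.re • v.1 + z.im • -v.2 = _
  rw [smul_neg, sub_eq_add_neg]

/-- The complexification of a real linear map. -/
def complexifyMap {B B' : Type*} {V : B → Type*} [∀ b, AddCommGroup (V b)]
    [∀ b, Module ℝ (V b)] {V' : B' → Type*} [∀ b, AddCommGroup (V' b)]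
    [∀ b, Module ℝ (V' b)] {b : B} {b' : B'} (f : V b →ₗ[ℝ] V' b') :
    Complexified V b →ₗ[ℂ] Complexified V' b' where
  toFun v := (f v.1, f v.2)
  map_add' v w := Prod.ext (map_add f v.1 w.1) (map_add f v.2 w.2)
  map_smul' z v := by
    have h1 := complexified_smul z v
    have h2 := complexified_smul (V := V') (b := b') z (f v.1, f v.2)
    refine (congrArg (fun w : V b × V b => ((f w.1, f w.2) : V' b' × V' b')) h1).trans
      (Eq.trans ?_ h2.symm)
    simp

/-- The tangent space at a fixed point with complex coefficients. -/
abbrev ComplexTangent (d : ℕ) {M : Type*} [TopologicalSpace M]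
    [ChartedSpace (EuclideanSpace ℝ (Fin d)) M] (p : M) : Type _ :=
  Complexified (fun p : M => TangentSpace (𝓡 d) p) p

variable (hE : IsPrincipalBundle (Torus k) ET)
    (hsmooth : ContMDiff ((ModelWithCorners.pi fun _ : Fin k => 𝓡 1).prod (𝓡 d))
      (𝓡 d) ∞ (fun q : Torus k × M => q.1 • q.2))
    (p : MulAction.fixedPoints (Torus k) M)

/-- The complexification of `tangentFrame`. -/
def complexifiedFrame (e : ET) : ComplexTangent d p.1 →ₗ[ℂ]
    Complexified (BorelBundle ET (V := fun p : M => TangentSpace (𝓡 d) p) tangentAction)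
      (fixedLift ET p e) :=
  complexifyMap (tangentFrame d hE hsmooth p e)

lemma continuous_complexifiedFrame {X : Type*} [TopologicalSpace X] {e : X → ET}
    {v w : X → EuclideanSpace ℝ (Fin d)} (he : Continuous e) (hv : Continuous v)
    (hw : Continuous w) :
    Continuous fun x => (⟨fixedLift ET p (e x),
      complexifiedFrame hE hsmooth p (e x) (v x, w x)⟩ :
      TotalSpace (EuclideanSpace ℝ (Fin d)) (Complexified
        (BorelBundle ET (V := fun p : M => TangentSpace (𝓡 d) p) tangentAction))) :=
  continuous_induced_rng.2 (((continuous_tangentFrame hE hsmooth p).comp (he.prodMk hv)).prodMk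
    ((continuous_tangentFrame hE hsmooth p).comp (he.prodMk hw)))

lemma continuous_complexifiedFrame_circle (e : ET) (v : ComplexTangent d p.1) :
    Continuous fun z : Circle => (⟨fixedLift ET p e,
      complexifiedFrame hE hsmooth p e ((z : ℂ) • v)⟩ :
      TotalSpace (EuclideanSpace ℝ (Fin d)) (Complexified
        (BorelBundle ET (V := fun p : M => TangentSpace (𝓡 d) p) tangentAction))) := by
  let v₁ : EuclideanSpace ℝ (Fin d) := v.1
  let v₂ : EuclideanSpace ℝ (Fin d) := v.2
  have h1 : Continuous fun z : Circle => (z : ℂ).re • v₁ - (z : ℂ).im • v₂ := by fun_prop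
  have h2 : Continuous fun z : Circle => (z : ℂ).re • v₂ + (z : ℂ).im • v₁ := by fun_prop
  refine (continuous_complexifiedFrame hE hsmooth p (continuous_const (y := e)) h1 h2).congr
    fun z => ?_
  rw [complexified_smul]
  rfl

lemma isEquivariantFrame_complexifiedFrame : IsEquivariantFrame (EuclideanSpace ℝ (Fin d))
    (fixedLift ET p) (fun t : Torus k => (complexifyMap (modelAction t p.1 :
      TangentSpace (𝓡 d) p.1 →ₗ[ℝ] TangentSpace (𝓡 d) p.1) :
        ComplexTangent d p.1 →ₗ[ℂ] ComplexTangent d p.1))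
    (complexifiedFrame hE hsmooth p) where
  injective e v w h := by
    have h0 := (isEquivariantFrame_tangentFrame hE hsmooth p).injective e
    exact Prod.ext (h0 (congrArg Prod.fst h)) (h0 (congrArg Prod.snd h))
  continuous v := continuous_complexifiedFrame hE hsmooth p continuous_id
    (continuous_const (y := (show EuclideanSpace ℝ (Fin d) from v.1)))
    (continuous_const (y := (show EuclideanSpace ℝ (Fin d) from v.2)))
  equivariant t e v := by
    have h1 := tangentFrame_smul hE hsmooth p t e v.1
    have h2 := tangentFrame_smul hE hsmooth p t e v.2
    have key : ∀ (b b' : HomotopyQuotient (Torus k) ET M)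
        (f g : BorelBundle ET (V := fun p : M => TangentSpace (𝓡 d) p) tangentAction b)
        (f' g' : BorelBundle ET (V := fun p : M => TangentSpace (𝓡 d) p) tangentAction b'),
        (⟨b, f⟩ : TotalSpace (EuclideanSpace ℝ (Fin d)) _) = ⟨b', f'⟩ →
        (⟨b, g⟩ : TotalSpace (EuclideanSpace ℝ (Fin d)) _) = ⟨b', g'⟩ →
        (⟨b, (f, g)⟩ : TotalSpace (EuclideanSpace ℝ (Fin d)) (Complexified
          (BorelBundle ET (V := fun p : M => TangentSpace (𝓡 d) p) tangentAction))) =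
          ⟨b', (f', g')⟩ := by
      intro b b' f g f' g' hf hg
      cases hf
      cases hg
      rfl
    exact key _ _ _ _ _ _ h1 h2

end Complexification

/-! ### Grouping the indices in pairs -/

section Pairs

/-- Division with remainder by `2`. -/
def pairIdx {m : ℕ} (i : Fin (2 * m)) : Fin m × Fin 2 :=
  (⟨i / 2, by omega⟩, ⟨i % 2, by omega⟩)

lemma pairIdx_injective {m : ℕ} : Function.Injective (pairIdx (m := m)) := by
  intro i j h
  simp only [pairIdx, Prod.mk.injEq, Fin.mk.injEq] at h
  exact Fin.ext (by omega)

/-- The enumeration keeps the two members of a pair adjacent, so the product can be grouped without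
commutativity. -/
lemma prod_ofFn_pairIdx {R : Type*} [Monoid R] {m : ℕ} (f : Fin m × Fin 2 → R) :
    (List.ofFn fun i : Fin (2 * m) => f (pairIdx i)).prod =
      (List.ofFn fun j => f (j, 0) * f (j, 1)).prod := by
  rw [List.ofFn_mul', List.prod_flatten, List.map_ofFn]
  congr 2
  funext j
  have h0 : ∀ i : Fin 2, ∀ h, pairIdx (m := m) ⟨2 * j + i, h⟩ = (j, i) := fun i h => by
    simp only [pairIdx, Prod.mk.injEq]
    exact ⟨Fin.ext (by simp; omega), Fin.ext (by simp; omega)⟩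
  simp only [Function.comp, h0]
  simp [List.ofFn_succ]

lemma linearIndependent_of_dual {K V ι : Type*} [Field K] [AddCommGroup V] [Module K V]
    (v : ι → V) (f : ι → V →ₗ[K] K) (h1 : ∀ i, f i (v i) ≠ 0) (h0 : ∀ i j, j ≠ i → f i (v j) = 0) :
    LinearIndependent K v := by
  rw [linearIndependent_iff']
  intro s g hg i hi
  have := congrArg (f i) hg
  rw [map_sum, map_zero, Finset.sum_eq_single i (fun j _ hj => by rw [map_smul, h0 i j hj, smul_zero])
    (fun h => absurd hi h), map_smul, smul_eq_mul] at this
  exact (mul_eq_zero.1 this).resolve_right (h1 i)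

end Pairs

/-! ### From Chern classes of the complexification to Pontrjagin classes -/

section Scale

variable {X Y : Type*} [TopologicalSpace X] [TopologicalSpace Y]

/-- The sign by which the total Pontrjagin class differs from the total Chern class of the
complexification. -/
def pontrjaginSign (d : ℕ) : ℤ := if 4 ∣ d then (-1) ^ (d / 4) else 0

lemma pontrjaginSign_add_four (d : ℕ) : pontrjaginSign (d + 4) = -pontrjaginSign d := by
  unfold pontrjaginSign
  by_cases h : 4 ∣ d
  · rw [if_pos h, if_pos (by omega), Nat.add_div_right _ (by norm_num), pow_succ]; ring
  · rw [if_neg h, if_neg (by omega), neg_zero]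

lemma Coh.map_scale (s : ℕ → ℤ) (f : C(X, Y)) (x : Coh ℤ Y) :
    Coh.map f (Coh.scale s x) = Coh.scale s (Coh.map f x) := by
  obtain ⟨z, rfl⟩ := Coh.mk_surjective x
  rfl

lemma Coh.scale_pontrjaginSign_one : Coh.scale pontrjaginSign (1 : Coh ℤ X) = 1 := by
  change Coh.mk _ = Coh.mk 1
  refine congrArg Coh.mk (Subtype.ext (Cochain.ext fun n σ => ?_))
  change pontrjaginSign n • (1 : Cochain ℤ X) n σ = (1 : Cochain ℤ X) n σ
  by_cases h : n = 0
  · subst h; simp [pontrjaginSign]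
  · rw [Cochain.one_ne h, smul_zero]

/-- Multiplication by a class of degree `4` raises degrees by `4`, and `pontrjaginSign` changes sign
under this shift. -/
lemma Coh.scale_pontrjaginSign_mul {y : Cochain.cocycles ℤ X}
    (hy : y.1 = Cochain.single 4 (y.1 4)) (x : Coh ℤ X) :
    Coh.scale pontrjaginSign (Coh.mk y * x) = -(Coh.mk y * Coh.scale pontrjaginSign x) := by
  obtain ⟨z, rfl⟩ := Coh.mk_surjective x
  change Coh.mk _ = -(Coh.mk _ * Coh.mk _)
  rw [← map_mul, ← map_neg]
  refine congrArg Coh.mk (Subtype.ext (Cochain.ext fun n σ => ?_))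
  change pontrjaginSign n • (y.1 * z.1) n σ = -((y.1 * Cochain.scale pontrjaginSign z.1) n σ)
  rw [Cochain.mul_apply, Cochain.mul_apply, Finset.smul_sum, ← Finset.sum_neg_distrib]
  refine Finset.sum_congr rfl fun i hi => ?_
  by_cases h : i = 4
  · subst h
    have hn : n = n - 4 + 4 := by rw [Finset.mem_range] at hi; omega
    have hs : pontrjaginSign n = -pontrjaginSign (n - 4) := by
      conv_lhs => rw [hn]
      exact pontrjaginSign_add_four _
    rw [Cochain.scale_apply, hs]
    simp only [smul_eq_mul]
    ring
  · rw [hy, Cochain.single_of_ne h]; simp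

lemma IsTransgression.exists_sq {k : ℕ} {E : Type*} [TopologicalSpace E] [MulAction (Torus k) E]
    {a : Fin k → ℤ} {x : Coh ℤ (OrbitSpace (Torus k) E)} (hx : IsTransgression a x) :
    ∃ y : Cochain.cocycles ℤ (OrbitSpace (Torus k) E), Coh.mk y = x ^ 2 ∧
      y.1 = Cochain.single 4 (y.1 4) := by
  obtain ⟨c, ⟨z, rfl, hz, -⟩, -⟩ := hx
  refine ⟨z ^ 2, map_pow _ _ _, Cochain.eq_single_of fun n hn σ => ?_⟩
  rw [sq]
  change (z.1 * z.1) n σ = 0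
  rw [Cochain.mul_apply]
  refine Finset.sum_eq_zero fun i hi => ?_
  by_cases h1 : i = 2
  · subst h1
    rw [Finset.mem_range] at hi
    rw [hz, Cochain.single_of_ne (n := n - 2) (by omega), mul_zero]
  · rw [hz, Cochain.single_of_ne h1, zero_mul]

/-- A pair contributes `(1 + w)(1 - w) = 1 - w²` with `w²` of degree `4`, and the scaling turns
every `-w²` into `w²`. -/
lemma Coh.scale_pontrjaginSign_prod (L : List (Coh ℤ X))
    (hL : ∀ w ∈ L, ∃ y : Cochain.cocycles ℤ X, Coh.mk y = w ^ 2 ∧ y.1 = Cochain.single 4 (y.1 4)) :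
    Coh.scale pontrjaginSign (L.map fun w => (1 + w) * (1 + -w)).prod =
      (L.map fun w => 1 + w ^ 2).prod := by
  induction L with
  | nil => exact Coh.scale_pontrjaginSign_one
  | cons w L ih =>
    obtain ⟨y, hy, hy4⟩ := hL w (by simp)
    have h1 : (1 + w) * (1 + -w) = 1 - Coh.mk y := by rw [hy]; noncomm_ring
    rw [List.map_cons, List.map_cons, List.prod_cons, List.prod_cons, h1, sub_mul, one_mul, map_sub,
      Coh.scale_pontrjaginSign_mul hy4, ih fun w hw => hL w (by simp [hw]), ← hy]
    noncomm_ring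

end Scale

/-! ### Restriction of the three equivariant classes to a fixed point -/

section Weights

variable {k m : ℕ} {M : Type*} [TopologicalSpace M]
  [ChartedSpace (EuclideanSpace ℝ (Fin (2 * m))) M] [IsManifold (𝓡 (2 * m)) ∞ M]
  [MulAction (Torus k) M] {ET : Type*} [TopologicalSpace ET] [MulAction (Torus k) ET]
  [ContinuousSMul (Torus k) ET]

lemma weightClass_neg {X : Type*} [TopologicalSpace X] (u : Fin k → Coh ℤ X) (a : Fin k → ℤ) :
    weightClass u (-a) = -weightClass u a := by
  simp [weightClass]

lemma weightChar_neg (a : Fin k → ℤ) (t : Torus k) :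
    weightChar (-a) t = starRingEnd ℂ (weightChar a t) := by
  rw [← coe_weightCircle, ← coe_weightCircle, ← Circle.coe_inv_eq_conj]
  simp [weightCircle]

lemma weightChar_eq_weightSign (a : Fin k → ℤ) {t : Torus k} (ht : ∀ l, t l ^ 2 = 1) :
    weightChar a t = ((weightSign a t : ℝ) : ℂ) := by
  have h1 : ∀ l, t l = (-1 : Circle) ^ signLog (t l) := fun l => by
    rcases circle_sq_eq_one_iff.1 (ht l) with h | h <;> rw [h] <;> simp
  have h2 : weightCircle a t = (-1) ^ ∑ l, a l * signLog (t l) := by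
    have h3 : ∀ s : Finset (Fin k),
        ∏ l ∈ s, t l ^ a l = (-1 : Circle) ^ ∑ l ∈ s, a l * signLog (t l) := fun s => by
      induction s using Finset.cons_induction with
      | empty => simp
      | cons l s hl ih =>
        rw [Finset.prod_cons, Finset.sum_cons, zpow_add, ih, mul_comm (a l), zpow_mul, ← h1 l]
    exact h3 Finset.univ
  rw [← coe_weightCircle, h2, weightSign]
  simp

/-- The restriction of the equivariant Chern class to a fixed point. -/
theorem map_chern_eq (hE : IsPrincipalBundle (Torus k) ET)
    (hsmooth : ContMDiff ((ModelWithCorners.pi fun _ : Fin k => 𝓡 1).prod (𝓡 (2 * m)))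
      (𝓡 (2 * m)) ∞ (fun q : Torus k × M => q.1 • q.2))
    (p : MulAction.fixedPoints (Torus k) M)
    {u : Fin k → Coh ℤ (OrbitSpace (Torus k) ET)}
    (hu : ∀ l, IsTransgression (Pi.single l 1) (u l)) (J : InvariantACS k (2 * m) M) {b : Fin m → Fin k → ℤ}
    (hb : IsComplexWeights J p b) {x : Coh ℤ (HomotopyQuotient (Torus k) ET M)}
    (hx : IsEquivariantChern ET J x) :
    Coh.map (fixedPointInclusion p) x = (List.ofFn fun j => 1 + weightClass u (b j)).prod := by
  obtain ⟨φ, hφJ, hφ⟩ := hb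
  let ψ : WithComplex J.toFiberComplexStructure p.1 →ₗ[ℂ] (Fin m → ℂ) :=
    { toFun := φ
      map_add' := fun v w => map_add φ v w
      map_smul' := fun z v => by
        have h1 := complexModule_smul (J.J p.1) (J.sq p.1) z v
        refine (congrArg φ h1).trans (funext fun j => ?_)
        have h2 : ∀ v : TangentSpace (𝓡 (2 * m)) p.1, φ (z.re • v + z.im • J.J p.1 v) j =
            z * φ v j := fun v => by
          rw [map_add, map_smul, map_smul, Pi.add_apply, Pi.smul_apply, Pi.smul_apply, hφJ,
            Complex.real_smul, Complex.real_smul]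
          nth_rw 3 [← Complex.re_add_im z]
          ring
        exact h2 v }
  let a : Fin m → WithComplex J.toFiberComplexStructure p.1 := fun j => φ.symm (Pi.single j 1)
  have hψa : ∀ j, ψ (a j) = Pi.single j 1 := fun j => φ.apply_symm_apply _
  have ha : LinearIndependent ℂ a := by
    refine linearIndependent_of_dual a (fun j => (LinearMap.proj j).comp ψ) (fun j => ?_)
      fun i j h => ?_
    · rw [LinearMap.comp_apply, hψa]; simp
    · rw [LinearMap.comp_apply, hψa]; simp [h]
  refine (isEquivariantFrame_complexFrame J hE hsmooth p).chern_eq hE hu ha (b := b)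
    (fun j t => ?_) (fun j e => continuous_complexFrame_circle J hE hsmooth p e (a j)) hx _
    fun e => rfl
  have hinj : Function.Injective ψ := φ.injective
  apply hinj
  rw [map_smul, hψa]
  refine funext fun i => ?_
  have h1 : ψ (complexIsotropyRep J p t (a j)) i = weightChar (b i) t * ψ (a j) i := by
    have h2 := hφ t (a j) i
    have h3 : isotropyRep p t (a j) = complexIsotropyRep J p t (a j) :=
      (isotropyRep_apply p t (a j)).trans (complexIsotropyRep_apply J p t (a j)).symm
    rw [h3] at h2
    exact h2
  rw [h1, hψa, Pi.smul_apply, smul_eq_mul]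
  by_cases h : i = j
  · subst h; rfl
  · simp [h]

lemma IsWeights.exists_model {p : MulAction.fixedPoints (Torus k) M} {α : Fin m → Fin k → ℤ}
    (hα : IsWeights (2 * m) p α) : ∃ φ : EuclideanSpace ℝ (Fin (2 * m)) ≃ₗ[ℝ] (Fin m → ℂ),
      ∀ t v j, φ (modelAction t p.1 v) j = weightChar (α j) t * φ v j := by
  obtain ⟨φ, hφ⟩ := hα
  refine ⟨φ, fun t v j => ?_⟩
  rw [← isotropyRep_apply]
  exact hφ t v j

/-- The complex coordinate `w ↦ φ(w)ⱼ` or its conjugate, extended to complex coefficients. -/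
def complexCoord {p : M} (φ : EuclideanSpace ℝ (Fin (2 * m)) ≃ₗ[ℝ] (Fin m → ℂ)) (c : ℂ →ₗ[ℝ] ℂ)
    (j : Fin m) : ComplexTangent (2 * m) p →ₗ[ℂ] ℂ where
  toFun v := c (φ v.1 j) + Complex.I * c (φ v.2 j)
  map_add' v w := by
    have h1 : φ (v + w).1 = φ v.1 + φ w.1 := map_add φ v.1 w.1
    have h2 : φ (v + w).2 = φ v.2 + φ w.2 := map_add φ v.2 w.2
    rw [h1, h2, Pi.add_apply, Pi.add_apply, map_add, map_add]; ring
  map_smul' z v := by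
    have h := complexified_smul z v
    have h1 : ∀ v w : EuclideanSpace ℝ (Fin (2 * m)),
        φ (z.re • v - z.im • w) = z.re • φ v - z.im • φ w := by simp
    have h2 : ∀ v w : EuclideanSpace ℝ (Fin (2 * m)),
        φ (z.re • v + z.im • w) = z.re • φ v + z.im • φ w := by simp
    rw [(congrArg (fun w => φ w.1) h).trans (h1 v.1 v.2),
      (congrArg (fun w => φ w.2) h).trans (h2 v.2 v.1), Pi.sub_apply, Pi.add_apply, map_sub, map_add]
    simp only [Pi.smul_apply, map_smul]
    simp only [Complex.real_smul, smul_eq_mul, RingHom.id_apply]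
    linear_combination (c (φ v.1 j) + Complex.I * c (φ v.2 j)) * Complex.re_add_im z -
      (z.im : ℂ) * c (φ v.2 j) * Complex.I_sq

/-- The restriction of the equivariant Pontrjagin class to a fixed point. -/
theorem map_pontrjagin_eq (hE : IsPrincipalBundle (Torus k) ET)
    (hsmooth : ContMDiff ((ModelWithCorners.pi fun _ : Fin k => 𝓡 1).prod (𝓡 (2 * m)))
      (𝓡 (2 * m)) ∞ (fun q : Torus k × M => q.1 • q.2))
    (p : MulAction.fixedPoints (Torus k) M)
    {u : Fin k → Coh ℤ (OrbitSpace (Torus k) ET)}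
    (hu : ∀ l, IsTransgression (Pi.single l 1) (u l)) {α : Fin m → Fin k → ℤ}
    (hα : IsWeights (2 * m) p α) {x : Coh ℤ (HomotopyQuotient (Torus k) ET M)}
    (hx : IsEquivariantPontrjagin ET (2 * m) x) :
    Coh.map (fixedPointInclusion p) x =
      (List.ofFn fun j => 1 + weightClass u (α j) ^ 2).prod := by
  obtain ⟨φ, hφ⟩ := hα.exists_model
  obtain ⟨c, hc, rfl⟩ := hx
  let e : Fin m → ℂ → EuclideanSpace ℝ (Fin (2 * m)) := fun j z => φ.symm (Pi.single j z)
  have hφe : ∀ j z, φ (e j z) = Pi.single j z := fun j z => φ.apply_symm_apply _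
  have headd : ∀ j (r s : ℝ) z w, r • e j z + s • e j w = e j (r * z + s * w) := fun j r s z w => by
    apply φ.injective
    rw [map_add, map_smul, map_smul, hφe, hφe, hφe, ← Pi.single_smul, ← Pi.single_smul, ← Pi.single_add,
      Complex.real_smul, Complex.real_smul]
  have hact : ∀ t j z, modelAction t p.1 (e j z) = e j (weightChar (α j) t * z) := fun t j z => by
    apply φ.injective
    funext i
    refine (hφ t (e j z) i).trans ?_
    rw [hφe, hφe]
    by_cases h : i = j
    · subst h; simp
    · simp [h]
  -- With pairs read as `v + i w`, these are `e(1) - i e(i)` and `e(1) + i e(i)`: eigenvectors of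
  -- the complexified plane, with weights `α` and `-α`.
  let a : Fin m × Fin 2 → ComplexTangent (2 * m) p.1 := fun i =>
    (e i.1 1, e i.1 (if i.2 = 0 then -Complex.I else Complex.I))
  let b : Fin m × Fin 2 → Fin k → ℤ := fun i => if i.2 = 0 then α i.1 else -α i.1
  have ha : LinearIndependent ℂ a := by
    -- The complex linear extensions of the plane coordinate and of its conjugate separate the two
    -- eigenvectors.
    refine linearIndependent_of_dual a (fun i => complexCoord φ
      (if i.2 = 0 then LinearMap.id else Complex.conjAe.toLinearMap) i.1) ?_ ?_
    · rintro ⟨j, i⟩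
      change (_ : ℂ →ₗ[ℝ] ℂ) (φ (e j 1) j) + Complex.I * (_ : ℂ →ₗ[ℝ] ℂ) (φ (e j _) j) ≠ 0
      rw [hφe, hφe]
      fin_cases i <;> norm_num
    · rintro ⟨j, i⟩ ⟨j', i'⟩ h
      change (_ : ℂ →ₗ[ℝ] ℂ) (φ (e j' 1) j) + Complex.I * (_ : ℂ →ₗ[ℝ] ℂ) (φ (e j' _) j) = 0
      rw [hφe, hφe]
      by_cases hj : j = j'
      · subst hj
        have hi : i' ≠ i := fun hi => h (by rw [hi])
        fin_cases i <;> fin_cases i' <;> simp at hi ⊢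
      · simp [hj]
  have hb : ∀ i t, (complexifyMap (modelAction t p.1 :
      TangentSpace (𝓡 (2 * m)) p.1 →ₗ[ℝ] TangentSpace (𝓡 (2 * m)) p.1) :
        ComplexTangent (2 * m) p.1 →ₗ[ℂ] ComplexTangent (2 * m) p.1) (a i) =
          weightChar (b i) t • a i := by
    rintro ⟨j, i⟩ t
    have h1 := complexified_smul (weightChar (b (j, i)) t) (a (j, i))
    refine Eq.trans ?_ h1.symm
    have h2 : ∀ (r s : ℝ) z w, r • e j z - s • e j w = e j (r * z - s * w) := fun r s z w => by
      rw [sub_eq_add_neg, ← neg_smul, headd]; congr 1; push_cast; ring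
    refine Prod.ext ((hact t j _).trans (Eq.trans ?_ (h2 _ _ _ _).symm))
      ((hact t j _).trans (Eq.trans ?_ (headd j _ _ _ _).symm))
    · congr 1
      fin_cases i
      · simp only [b]
        simp
      · simp only [b]
        simp [weightChar_neg]
    · congr 1
      fin_cases i
      · simp only [b]
        simp
        apply Complex.ext <;> simp
      · simp only [b]
        simp [weightChar_neg]
        apply Complex.ext <;> simp
  have h := (isEquivariantFrame_complexifiedFrame hE hsmooth p).chern_eq hE hu
    (ha.comp pairIdx pairIdx_injective) (b := fun i => b (pairIdx i))
    (fun i t => hb (pairIdx i) t)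
    (fun i e => continuous_complexifiedFrame_circle hE hsmooth p e (a (pairIdx i))) hc
    (fixedPointInclusion p) fun e => rfl
  rw [Coh.map_scale, h, prod_ofFn_pairIdx (fun i => 1 + weightClass u (b i))]
  have h1 := Coh.scale_pontrjaginSign_prod (List.ofFn fun j => weightClass u (α j)) fun w hw => by
    obtain ⟨j, rfl⟩ := List.mem_ofFn.1 hw
    exact (IsTransgression.weightClass hu (α j)).exists_sq
  rw [List.map_ofFn, List.map_ofFn] at h1
  refine Eq.trans ?_ h1
  change Coh.scale pontrjaginSign _ = _
  congr 3
  funext j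
  simp [b, weightClass_neg]

/-- The restriction of the equivariant Stiefel-Whitney class to a fixed point. -/
theorem map_sw_eq (hE : IsPrincipalBundle (Torus k) ET)
    (hsmooth : ContMDiff ((ModelWithCorners.pi fun _ : Fin k => 𝓡 1).prod (𝓡 (2 * m)))
      (𝓡 (2 * m)) ∞ (fun q : Torus k × M => q.1 • q.2))
    (p : MulAction.fixedPoints (Torus k) M)
    {u : Fin k → Coh ℤ (OrbitSpace (Torus k) ET)}
    (hu : ∀ l, IsTransgression (Pi.single l 1) (u l)) {α : Fin m → Fin k → ℤ}
    (hα : IsWeights (2 * m) p α) {x : Coh (ZMod 2) (HomotopyQuotient (Torus k) ET M)}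
    (hx : IsEquivariantSW ET (2 * m) x) :
    Coh.map (fixedPointInclusion p) x = (List.ofFn fun j =>
      1 + Coh.coeff (Int.castRingHom (ZMod 2)) (weightClass u (α j))).prod := by
  obtain ⟨φ, hφ⟩ := hα.exists_model
  -- A tuple of signs acts on a whole plane by one real scalar `±1`, so `1` and `i` span invariant
  -- real lines with the same sign character.
  let a : Fin m × Fin 2 → EuclideanSpace ℝ (Fin (2 * m)) := fun i =>
    φ.symm (Pi.single i.1 (if i.2 = 0 then 1 else Complex.I))
  have hφa : ∀ i, φ (a i) = Pi.single i.1 (if i.2 = 0 then 1 else Complex.I) :=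
    fun i => φ.apply_symm_apply _
  have ha : LinearIndependent ℝ a := by
    refine linearIndependent_of_dual a (fun i =>
      (if i.2 = 0 then Complex.reLm else Complex.imLm).comp
        ((LinearMap.proj i.1).comp φ.toLinearMap)) ?_ ?_
    · rintro ⟨j, i⟩
      change (_ : ℂ →ₗ[ℝ] ℝ) (φ (a (j, i)) j) ≠ 0
      rw [hφa]
      fin_cases i <;> simp
    · rintro ⟨j, i⟩ ⟨j', i'⟩ h
      change (_ : ℂ →ₗ[ℝ] ℝ) (φ (a (j', i')) j) = 0
      rw [hφa]
      by_cases hj : j = j'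
      · subst hj
        have hi : i' ≠ i := fun hi => h (by rw [hi])
        fin_cases i <;> fin_cases i' <;> simp at hi ⊢
      · simp [hj]
  have hl : ∀ t ∈ signSubgroup k k, ∀ l, t l ^ 2 = 1 := fun t ht l => ht l l.2
  have hb : ∀ i, ∀ t ∈ signSubgroup k k,
      modelAction t p.1 (a i) = weightSign (α i.1) t • a i := fun i t ht => by
    apply φ.injective
    funext j
    rw [hφ, Units.smul_def, map_smul, Pi.smul_apply, hφa]
    by_cases h : j = i.1
    · subst h
      rw [weightChar_eq_weightSign _ (hl t ht), Complex.real_smul]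
    · simp [h]
  obtain ⟨R, hR, h⟩ := (isEquivariantFrame_tangentFrame hE hsmooth p).sw_eq hE
    (hE.signSubgroup k) hl hu (ha.comp pairIdx pairIdx_injective) (b := fun i => α (pairIdx i).1)
    (fun i t ht => hb (pairIdx i) t ht) hx
    ((fixedPointInclusion p).comp (orbitBase ET (signSubgroup k k))) fun e => rfl
  -- After pullback to the orbit space of the signs, each plane contributes `(1 + R)² = 1 + R²`, and
  -- `R²` is the pullback of the weight class modulo `2`.
  refine coh_map_orbitBase_injective hE le_rfl ?_
  rw [← Coh.map_comp, h, prod_ofFn_pairIdx (fun i => 1 + R (α i.1)), map_list_prod, List.map_ofFn]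
  congr 2
  funext j
  simp only [Function.comp, map_add, map_one, ← hR]
  have := Coh.add_self_zmod_two (R (α j))
  calc (1 + R (α j)) * (1 + R (α j)) = 1 + (R (α j) + R (α j)) + R (α j) * R (α j) := by
        noncomm_ring
    _ = _ := by rw [this, add_zero]

end Weights

/-! ### Uniqueness of weights -/

section WeightUniqueness

/-- A nonzero determinant has a nonzero term in its Leibniz expansion. This is what matches the
eigenvectors of isomorphic representations. -/
lemma exists_perm_repr_ne_zero {ι K V : Type*} [Fintype ι] [DecidableEq ι] [Field K]
    [AddCommGroup V] [Module K V] (b : Module.Basis ι K V) (Θ : V ≃ₗ[K] V) :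
    ∃ σ : Equiv.Perm ι, ∀ i, b.repr (Θ (b i)) (σ i) ≠ 0 := by
  have h := (LinearEquiv.isUnit_det Θ b b).ne_zero
  rw [Matrix.det_apply] at h
  obtain ⟨σ, -, hσ⟩ := Finset.exists_ne_zero_of_sum_ne_zero h
  refine ⟨σ, fun i hi => hσ ?_⟩
  rw [Finset.prod_eq_zero (Finset.mem_univ i) (by rw [LinearMap.toMatrix_apply]; exact hi),
    smul_zero]

variable {k : ℕ}

lemma weightChar_injective {a b : Fin k → ℤ} (h : ∀ t, weightChar a t = weightChar b t) :
    a = b := by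
  funext l
  set n : ℤ := a l - b l with hn
  -- The characters are compared on the rotation of coordinate `l` by `1 / (2 (|n| + 1))` of a turn.
  -- They agree there only if `n / (2 (|n| + 1))` is an integer, and its absolute value is less than
  -- `1 / 2`.
  have hN : (0 : ℝ) < 2 * (|(n : ℝ)| + 1) := by positivity
  have h1 : Circle.exp (2 * Real.pi * (1 / (2 * (|(n : ℝ)| + 1)))) ^ a l =
      Circle.exp (2 * Real.pi * (1 / (2 * (|(n : ℝ)| + 1)))) ^ b l := by
    rw [← weightCircle_mulSingle, ← weightCircle_mulSingle]
    exact Circle.ext (h _)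
  rw [← Circle.exp_zsmul, ← Circle.exp_zsmul] at h1
  obtain ⟨N, hN'⟩ := (circle_exp_two_pi_eq_iff (a := a l * (1 / (2 * (|(n : ℝ)| + 1))))
    (b := b l * (1 / (2 * (|(n : ℝ)| + 1))))).1 (by
      rw [zsmul_eq_mul, zsmul_eq_mul] at h1
      rw [mul_left_comm, mul_left_comm (2 * Real.pi)]
      exact h1)
  have h2 : (n : ℝ) = N * (2 * (|(n : ℝ)| + 1)) := by
    have : (n : ℝ) * (1 / (2 * (|(n : ℝ)| + 1))) = N := by
      rw [hn]; push_cast [hn] at hN' ⊢; linarith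
    rw [← this]; field_simp
  have hN0 : N = 0 := by
    by_contra hne
    have h3 : (1 : ℝ) ≤ |(N : ℝ)| := by exact_mod_cast Int.one_le_abs hne
    have h4 : |(n : ℝ)| = |(N : ℝ)| * (2 * (|(n : ℝ)| + 1)) := by
      conv_lhs => rw [h2]
      rw [abs_mul, abs_of_pos hN]
    nlinarith [abs_nonneg (n : ℝ)]
  rw [hN0] at h2
  have h3 : n = 0 := by
    have : (n : ℝ) = 0 := by rw [h2]; simp
    exact_mod_cast this
  omega

/-- A nonzero real linear map between characters exists only if they agree up to conjugation. -/
lemma weight_eq_or_eq_neg {a b : Fin k → ℤ} (L : ℂ →ₗ[ℝ] ℂ) (hL : L ≠ 0)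
    (h : ∀ t z, L (weightChar a t * z) = weightChar b t * L z) : b = a ∨ b = -a := by
  have key : ∀ t z, L (weightChar a t * z) = (weightChar a t).re * L z +
      (weightChar a t).im * L (Complex.I * z) := fun t z => by
    conv_lhs => rw [← Complex.re_add_im (weightChar a t)]
    rw [add_mul, map_add, mul_assoc, ← Complex.real_smul, map_smul, ← Complex.real_smul, map_smul,
      Complex.real_smul, Complex.real_smul]
  have h1 : ∀ t, (weightChar a t).re * L 1 + (weightChar a t).im * L Complex.I =
      weightChar b t * L 1 := fun t => by
    rw [← h, key, mul_one]
  have h2 : ∀ t, (weightChar a t).re * L Complex.I - (weightChar a t).im * L 1 =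
      weightChar b t * L Complex.I := fun t => by
    rw [← h, key, Complex.I_mul_I, map_neg]; ring
  -- Up to a factor `2` these are the coefficients of the complex linear and the conjugate linear
  -- part of `L`. By `h1` and `h2` a nonzero linear part forces `b = a` and a nonzero conjugate
  -- linear part forces `b = -a`.
  by_cases hA : L 1 - Complex.I * L Complex.I = 0
  · by_cases hB : L 1 + Complex.I * L Complex.I = 0
    · refine absurd ?_ hL
      have e1 : L 1 = 0 := by linear_combination (hA + hB) / 2
      have e2 : L Complex.I = 0 := by
        have : Complex.I * L Complex.I = 0 := by linear_combination (hB - hA) / 2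
        exact (mul_eq_zero.1 this).resolve_left Complex.I_ne_zero
      refine LinearMap.ext fun z => ?_
      rw [← Complex.re_add_im z, map_add, ← mul_one (z.re : ℂ), ← Complex.real_smul,
        ← Complex.real_smul, map_smul, map_smul, e1, e2]
      simp
    · right
      refine weightChar_injective fun t => mul_right_cancel₀ hB ?_
      rw [weightChar_neg]
      have hc : starRingEnd ℂ (weightChar a t) =
          (weightChar a t).re - (weightChar a t).im * Complex.I := by
        apply Complex.ext <;> simp
      rw [hc]
      linear_combination -h1 t - Complex.I * h2 t +
        ((weightChar a t).im : ℂ) * L Complex.I * Complex.I_sq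
  · left
    refine weightChar_injective fun t => mul_right_cancel₀ hA ?_
    linear_combination -h1 t + Complex.I * h2 t +
        (L 1 - Complex.I * L Complex.I) * Complex.re_add_im (weightChar a t) +
        ((weightChar a t).im : ℂ) * L Complex.I * Complex.I_sq

/-- The weights of a complex representation are unique up to order. -/
lemma exists_perm_of_weights {m : ℕ} {β γ : Fin m → Fin k → ℤ}
    (Θ : (Fin m → ℂ) ≃ₗ[ℂ] (Fin m → ℂ))
    (h : ∀ t v j, Θ (fun i => weightChar (β i) t * v i) j = weightChar (γ j) t * Θ v j) :
    ∃ σ : Equiv.Perm (Fin m), γ = β ∘ σ := by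
  obtain ⟨σ, hσ⟩ := exists_perm_repr_ne_zero (Pi.basisFun ℂ (Fin m)) Θ
  refine ⟨σ.symm, ?_⟩
  have key : ∀ i, γ (σ i) = β i := fun i => by
    have h0 := hσ i
    rw [Pi.basisFun_repr, Pi.basisFun_apply] at h0
    refine weightChar_injective fun t => mul_right_cancel₀ h0 ?_
    rw [← h t]
    have h1 : (fun j => weightChar (β j) t * (Pi.single i 1 : Fin m → ℂ) j) =
        weightChar (β i) t • Pi.single i 1 := by
      funext j
      by_cases hj : j = i
      · subst hj; simp
      · simp [hj]
    rw [h1, map_smul]; rfl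
  funext j
  rw [Function.comp, ← key, Equiv.apply_symm_apply]

/-- Real isomorphic representations have the same weights up to order and signs. -/
lemma exists_perm_of_real_weights {m : ℕ} {α γ : Fin m → Fin k → ℤ}
    (Θ : (Fin m → ℂ) ≃ₗ[ℝ] (Fin m → ℂ))
    (h : ∀ t v j, Θ (fun i => weightChar (α i) t * v i) j = weightChar (γ j) t * Θ v j) :
    ∃ σ : Equiv.Perm (Fin m), ∀ j, γ (σ j) = α j ∨ γ (σ j) = -α j := by
  classical
  -- This permutes the `2m` real basis vectors and need not respect the planes, so it only compares
  -- the multiplicities of the classes `{a, -a}`.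
  obtain ⟨σ, hσ⟩ := exists_perm_repr_ne_zero (Pi.basis fun _ : Fin m => Complex.basisOneI) Θ
  let κ : (Fin k → ℤ) → Set (Fin k → ℤ) := fun a => {a, -a}
  have hκ : ∀ a b, κ b = κ a ↔ b = a ∨ b = -a := fun a b => by
    constructor
    · intro h
      have : b ∈ κ a := h ▸ (Set.mem_insert b _)
      exact this
    · rintro (rfl | rfl)
      · rfl
      · simp [κ, Set.pair_comm]
  have key : ∀ x, κ (γ (σ x).1) = κ (α x.1) := fun x => by
    rw [hκ]
    let L : ℂ →ₗ[ℝ] ℂ := (LinearMap.proj (σ x).1).comp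
      (Θ.toLinearMap.comp (LinearMap.single ℝ (fun _ : Fin m => ℂ) x.1))
    refine weight_eq_or_eq_neg L ?_ fun t z => ?_
    · intro hL
      refine hσ x ?_
      have h1 : Θ (Pi.single x.1 (Complex.basisOneI x.2)) (σ x).1 = 0 :=
        DFunLike.congr_fun hL (Complex.basisOneI x.2)
      rw [Pi.basis_repr, Pi.basis_apply, h1]
      simp
    · change Θ (Pi.single x.1 _) (σ x).1 = _ * Θ (Pi.single x.1 z) (σ x).1
      rw [← h t]
      refine congrArg (fun w => Θ w (σ x).1) (funext fun j => ?_)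
      by_cases hj : j = x.1
      · subst hj; simp
      · simp [hj]
  -- Every plane has two basis vectors, so the multiplicities counted in planes follow after
  -- division by `2`.
  have hcard : ∀ c, Nonempty ({j : Fin m // κ (α j) = c} ≃ {j : Fin m // κ (γ j) = c}) := by
    intro c
    have e1 : ∀ f : Fin m → Fin k → ℤ, Nat.card {x : Σ _ : Fin m, Fin 2 // κ (f x.1) = c} =
        Nat.card {j : Fin m // κ (f j) = c} * 2 := fun f => by
      let e : {x : Σ _ : Fin m, Fin 2 // κ (f x.1) = c} ≃ {j : Fin m // κ (f j) = c} × Fin 2 :=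
        { toFun := fun x => (⟨x.1.1, x.2⟩, x.1.2)
          invFun := fun y => ⟨⟨y.1.1, y.2⟩, y.1.2⟩
          left_inv := fun _ => rfl
          right_inv := fun _ => rfl }
      rw [Nat.card_congr e, Nat.card_prod]; simp
    have e2 : Nat.card {x : Σ _ : Fin m, Fin 2 // κ (α x.1) = c} =
        Nat.card {x : Σ _ : Fin m, Fin 2 // κ (γ x.1) = c} :=
      Nat.card_congr (σ.subtypeEquiv fun x => by rw [key])
    rw [e1, e1] at e2
    exact Finite.card_eq.1 (by omega)
  let e := fun c => (hcard c).some
  refine ⟨Equiv.ofFiberEquiv e, fun j => (hκ _ _).1 ?_⟩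
  exact Equiv.ofFiberEquiv_map (f := fun j => κ (α j)) (g := fun j => κ (γ j)) e j

end WeightUniqueness

/-! ### Existence of complex weights -/

section WeightExistence

variable {k m : ℕ} {A : Type*} [AddCommGroup A] [Module ℂ A]

/-- The weights of a complex representation are obtained by choosing signs for the weights of the
underlying real representation. -/
lemma exists_complex_weights (ρ : Torus k → A →ₗ[ℂ] A) (φ : A ≃ₗ[ℝ] (Fin m → ℂ))
    {α : Fin m → Fin k → ℤ} (hφ : ∀ t v j, φ (ρ t v) j = weightChar (α j) t * φ v j) :
    ∃ (β : Fin m → Fin k → ℤ) (ψ : A ≃ₗ[ℂ] (Fin m → ℂ)),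
      (∀ t v j, ψ (ρ t v) j = weightChar (β j) t * ψ v j) ∧ ∀ j, β j = α j ∨ β j = -α j := by
  classical
  let e : Fin m → ℂ →ₗ[ℝ] A := fun j =>
    φ.symm.toLinearMap.comp (LinearMap.single ℝ (fun _ : Fin m => ℂ) j)
  have hact : ∀ t j z, ρ t (e j z) = e j (weightChar (α j) t * z) := fun t j z => by
    apply φ.injective
    funext i
    rw [hφ]
    have h1 : ∀ z, φ (e j z) = Pi.single j z := fun z => φ.apply_symm_apply _
    rw [h1, h1]
    by_cases h : i = j
    · subst h; simp
    · simp [h]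
  have hexp : ∀ t j z, ρ t (e j z) = ((weightChar (α j) t).re : ℂ) • e j z +
      ((weightChar (α j) t).im : ℂ) • e j (Complex.I * z) := fun t j z => by
    rw [hact]
    conv_lhs => rw [← Complex.re_add_im (weightChar (α j) t)]
    rw [add_mul, map_add, mul_assoc, ← Complex.real_smul, map_smul, ← Complex.real_smul, map_smul]
    rfl
  let S : Set A := {w | ∃ c : Fin k → ℤ, ∀ t, ρ t w = weightChar c t • w}
  have hS : ⊤ ≤ Submodule.span ℂ S := by
    have h1 : ∀ j z, e j z ∈ Submodule.span ℂ S := fun j z => by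
      -- The scalar `i` of `A` commutes with the representation but need not be multiplication by
      -- `i` in the plane given by `φ`. The combinations `e(z) ∓ i • e(iz)` are eigenvectors of
      -- weights `α j` and `-α j` in any case; one of them may be `0`, which `S` allows.
      have hp : e j z - Complex.I • e j (Complex.I * z) ∈ S := ⟨α j, fun t => by
        rw [map_sub, map_smul, hexp, hexp, ← mul_assoc, Complex.I_mul_I, neg_one_mul, map_neg]
        nth_rw 5 [← Complex.re_add_im (weightChar (α j) t)]
        have := Complex.I_mul_I
        match_scalars <;>
          first
            | ring1
            | linear_combination ((weightChar (α j) t).im : ℂ) * this⟩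
      have hm : e j z + Complex.I • e j (Complex.I * z) ∈ S := ⟨-α j, fun t => by
        rw [map_add, map_smul, hexp, hexp, ← mul_assoc, Complex.I_mul_I, neg_one_mul, map_neg]
        have hc : weightChar (-α j) t =
            (weightChar (α j) t).re - (weightChar (α j) t).im * Complex.I := by
          rw [weightChar_neg]; apply Complex.ext <;> simp
        rw [hc]
        have := Complex.I_mul_I
        match_scalars <;>
          first
            | ring1
            | linear_combination ((weightChar (α j) t).im : ℂ) * this⟩
      have h2 : e j z = (1 / 2 : ℂ) • ((e j z - Complex.I • e j (Complex.I * z)) +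
          (e j z + Complex.I • e j (Complex.I * z))) := by module
      rw [h2]
      exact Submodule.smul_mem _ _ (Submodule.add_mem _ (Submodule.subset_span hp)
        (Submodule.subset_span hm))
    intro v _
    have h2 : v = ∑ j, e j (φ v j) := by
      apply φ.injective
      rw [map_sum]
      have h1 : ∀ j z, φ (e j z) = Pi.single j z := fun j z => φ.apply_symm_apply _
      simp only [h1]
      exact (Finset.univ_sum_single _).symm
    rw [h2]
    exact Submodule.sum_mem _ fun j _ => h1 _ _
  -- A spanning set of eigenvectors contains a basis, which has `m` elements by comparison of real
  -- dimensions.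
  let b := Module.Basis.ofSpan hS
  have hfr : Module.finrank ℝ A = 2 * m := by
    rw [φ.finrank_eq, Module.finrank_pi_fintype]; simp [Complex.finrank_real_complex, mul_comm]
  have hfc : Module.finrank ℂ A = m := by
    have := finrank_real_of_complex A
    omega
  have hfin : Module.Finite ℝ A := Module.Finite.equiv φ.symm
  have hfinC : Module.Finite ℂ A := Module.Finite.right ℝ ℂ A
  have hι : Finite _ := Module.Finite.finite_basis b
  let _ := Fintype.ofFinite ((linearIndepOn_empty ℂ (id : A → A)).extend (Set.empty_subset S))
  have hcard := (Module.finrank_eq_card_basis b).symm.trans hfc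
  let b' := b.reindex (Fintype.equivFinOfCardEq hcard)
  have hb' : ∀ j, ∃ c : Fin k → ℤ, ∀ t, ρ t (b' j) = weightChar c t • b' j := fun j => by
    rw [Module.Basis.reindex_apply]
    exact Module.Basis.ofSpan_subset hS ⟨_, rfl⟩
  choose γ hγ using hb'
  have hψ : ∀ t v j, b'.equivFun (ρ t v) j = weightChar (γ j) t * b'.equivFun v j := by
    intro t v j
    let f : A →ₗ[ℂ] ℂ := (b'.coord j).comp (ρ t)
    let g : A →ₗ[ℂ] ℂ := weightChar (γ j) t • b'.coord j
    have hfg : f = g := b'.ext fun i => by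
      change b'.coord j (ρ t (b' i)) = weightChar (γ j) t • b'.coord j (b' i)
      rw [hγ, map_smul]
      by_cases h : i = j
      · subst h; rfl
      · simp [h]
    exact DFunLike.congr_fun hfg v
  -- Both coordinate systems describe the same real representation, so their weights agree up to
  -- order and sign; the eigenbasis is reordered accordingly.
  obtain ⟨σ, hσ⟩ := exists_perm_of_real_weights (α := α) (γ := γ)
    (φ.symm.trans (b'.equivFun.restrictScalars ℝ)) fun t v j => by
      change b'.equivFun (φ.symm _) j = _ * b'.equivFun (φ.symm v) j
      rw [← hψ]
      refine congrArg (fun w => b'.equivFun w j) (φ.injective (funext fun i => ?_))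
      rw [LinearEquiv.apply_symm_apply, hφ, LinearEquiv.apply_symm_apply]
  refine ⟨fun j => γ (σ j), b'.equivFun.trans (LinearEquiv.funCongrLeft ℂ ℂ σ),
    fun t v j => hψ t v (σ j), hσ⟩

end WeightExistence

/-! ### Weights of the isotropy representation with an almost complex structure -/

section ComplexWeights

variable {k m : ℕ} {M : Type*} [TopologicalSpace M]
  [ChartedSpace (EuclideanSpace ℝ (Fin (2 * m))) M] [IsManifold (𝓡 (2 * m)) ∞ M]
  [MulAction (Torus k) M]

lemma IsComplexWeights.exists_linear {J : InvariantACS k (2 * m) M}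
    {p : MulAction.fixedPoints (Torus k) M} {b : Fin m → Fin k → ℤ}
    (hb : IsComplexWeights J p b) :
    ∃ ψ : WithComplex J.toFiberComplexStructure p.1 ≃ₗ[ℂ] (Fin m → ℂ),
      ∀ t v j, ψ (complexIsotropyRep J p t v) j = weightChar (b j) t * ψ v j := by
  obtain ⟨φ, hφJ, hφ⟩ := hb
  refine ⟨{ φ.toAddEquiv with map_smul' := fun z v => ?_ }, fun t v j => ?_⟩
  · have h1 := complexModule_smul (J.J p.1) (J.sq p.1) z v
    refine (congrArg φ h1).trans (funext fun j => ?_)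
    have h2 : ∀ v : TangentSpace (𝓡 (2 * m)) p.1, φ (z.re • v + z.im • J.J p.1 v) j =
        z * φ v j := fun v => by
      rw [map_add, map_smul, map_smul, Pi.add_apply, Pi.smul_apply, Pi.smul_apply, hφJ,
        Complex.real_smul, Complex.real_smul]
      nth_rw 3 [← Complex.re_add_im z]
      ring
    exact h2 v
  · have h3 : isotropyRep p t v = complexIsotropyRep J p t v :=
      (isotropyRep_apply p t v).trans (complexIsotropyRep_apply J p t v).symm
    have h2 := hφ t v j
    rw [h3] at h2
    exact h2

lemma isComplexWeights_of_linear {J : InvariantACS k (2 * m) M}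
    {p : MulAction.fixedPoints (Torus k) M} {b : Fin m → Fin k → ℤ}
    (ψ : WithComplex J.toFiberComplexStructure p.1 ≃ₗ[ℂ] (Fin m → ℂ))
    (hψ : ∀ t v j, ψ (complexIsotropyRep J p t v) j = weightChar (b j) t * ψ v j) :
    IsComplexWeights J p b := by
  have hsmul : ∀ (z : ℂ) (v : TangentSpace (𝓡 (2 * m)) p.1),
      ψ (z.re • v + z.im • J.J p.1 v : TangentSpace (𝓡 (2 * m)) p.1) = z • ψ v := fun z v =>
    (congrArg ψ (complexModule_smul (J.J p.1) (J.sq p.1) z v).symm).trans (ψ.map_smul z v)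
  let φ : TangentSpace (𝓡 (2 * m)) p.1 ≃ₗ[ℝ] (Fin m → ℂ) :=
    { ψ.toAddEquiv with
      map_smul' := fun r v => by
        have := hsmul r v
        simp only [Complex.ofReal_re, Complex.ofReal_im, zero_smul, add_zero] at this
        exact this }
  refine ⟨φ, fun v j => ?_, fun t v j => ?_⟩
  · have := congrFun (hsmul Complex.I v) j
    simp only [Complex.I_re, Complex.I_im, zero_smul, zero_add, one_smul] at this
    exact this
  · have h3 : isotropyRep p t v = complexIsotropyRep J p t v :=
      (isotropyRep_apply p t v).trans (complexIsotropyRep_apply J p t v).symm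
    rw [h3]
    exact hψ t v j

lemma IsComplexWeights.unique {J : InvariantACS k (2 * m) M}
    {p : MulAction.fixedPoints (Torus k) M} {β γ : Fin m → Fin k → ℤ}
    (hβ : IsComplexWeights J p β) (hγ : IsComplexWeights J p γ) :
    ∃ σ : Equiv.Perm (Fin m), γ = β ∘ σ := by
  obtain ⟨ψ, hψ⟩ := hβ.exists_linear
  obtain ⟨ψ', hψ'⟩ := hγ.exists_linear
  refine exists_perm_of_weights (ψ.symm.trans ψ') fun t v j => ?_
  rw [LinearEquiv.trans_apply, LinearEquiv.trans_apply, ← hψ']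
  refine congrArg (fun w => ψ' w j) (ψ.injective (funext fun i => ?_))
  rw [LinearEquiv.apply_symm_apply, hψ, LinearEquiv.apply_symm_apply]

lemma IsWeights.exists_isComplexWeights {p : MulAction.fixedPoints (Torus k) M}
    {α : Fin m → Fin k → ℤ} (hα : IsWeights (2 * m) p α) (J : InvariantACS k (2 * m) M) :
    ∃ β, IsComplexWeights J p β ∧ ∀ j, β j = α j ∨ β j = -α j := by
  obtain ⟨φ, hφ⟩ := hα.exists_model
  let φ' : WithComplex J.toFiberComplexStructure p.1 ≃ₗ[ℝ] (Fin m → ℂ) :=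
    { φ.toAddEquiv with
      map_smul' := fun r v => by
        have h1 := complexModule_smul (J.J p.1) (J.sq p.1) r v
        refine (congrArg φ h1).trans ?_
        simp only [Complex.ofReal_re, Complex.ofReal_im, zero_smul, add_zero]
        exact map_smul φ r (show EuclideanSpace ℝ (Fin (2 * m)) from v) }
  obtain ⟨β, ψ, hψ, hβ⟩ := exists_complex_weights (complexIsotropyRep J p) φ' (α := α)
    fun t v j =>
      (congrArg (fun w => φ w j) (complexIsotropyRep_apply J p t v)).trans (hφ t v j)
  exact ⟨β, isComplexWeights_of_linear ψ hψ, hβ⟩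

end ComplexWeights

end EquivClass

end

/-! ### The proposition -/

theorem proposition5p2 (k m : ℕ)
    -- the universal principal `T`-bundle `ET → BT`, for any model of it
    (ET : Type*) [TopologicalSpace ET] [MulAction (Torus k) ET] [ContinuousSMul (Torus k) ET]
    [ContractibleSpace ET] (hET : IsPrincipalBundle (Torus k) ET)
    -- a closed connected smooth `2m`-manifold with a smooth `T`-action and finite fixed point set
    (M : Type*) [TopologicalSpace M] [T2Space M] [CompactSpace M] [ConnectedSpace M]
    [ChartedSpace (EuclideanSpace ℝ (Fin (2 * m))) M] [IsManifold (𝓡 (2 * m)) ∞ M]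
    [MulAction (Torus k) M]
    (hsmooth : ContMDiff ((ModelWithCorners.pi fun _ : Fin k => 𝓡 1).prod (𝓡 (2 * m)))
      (𝓡 (2 * m)) ∞ (fun q : Torus k × M => q.1 • q.2))
    (hfin : (MulAction.fixedPoints (Torus k) M).Finite)
    -- the generators `u₁, …, uₖ` of `H^*(BT; ℤ)`
    (u : Fin k → Coh ℤ (OrbitSpace (Torus k) ET))
    (hu : ∀ l, IsTransgression (Pi.single l 1) (u l))
    -- the weights (up to sign) of the isotropy representations at the fixed points
    (α : MulAction.fixedPoints (Torus k) M → Fin m → Fin k → ℤ)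
    (hα : ∀ p, IsWeights (2 * m) p (α p)) :
    (∀ x : Coh ℤ (HomotopyQuotient (Torus k) ET M), IsEquivariantPontrjagin ET (2 * m) x →
      restrictFixed x = fun p => (List.ofFn fun j => 1 + weightClass u (α p j) ^ 2).prod) ∧
    (∀ x : Coh (ZMod 2) (HomotopyQuotient (Torus k) ET M), IsEquivariantSW ET (2 * m) x →
      ∀ ε : MulAction.fixedPoints (Torus k) M → Fin m → ℤˣ,
        restrictFixed x = fun p => (List.ofFn fun j =>
          1 + (ε p j : ℤ) • Coh.coeff (Int.castRingHom (ZMod 2)) (weightClass u (α p j))).prod) ∧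
    (∀ J : InvariantACS k (2 * m) M,
      (∀ p, ∃ β : Fin m → Fin k → ℤ, IsComplexWeights J p β ∧
        (∀ j, β j = α p j ∨ β j = -α p j) ∧
        ∀ γ : Fin m → Fin k → ℤ, IsComplexWeights J p γ →
          ∃ σ : Equiv.Perm (Fin m), γ = β ∘ σ) ∧
      ∀ x : Coh ℤ (HomotopyQuotient (Torus k) ET M), IsEquivariantChern ET J x →
        ∀ β : MulAction.fixedPoints (Torus k) M → Fin m → Fin k → ℤ,
          (∀ p, IsComplexWeights J p (β p)) →
          restrictFixed x = fun p => (List.ofFn fun j => 1 + weightClass u (β p j)).prod) := by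
  refine ⟨fun x hx => funext fun p => map_pontrjagin_eq hET hsmooth p hu (hα p) hx,
    fun x hx ε => funext fun p => ?_, fun J => ⟨fun p => ?_, fun x hx β hβ => funext fun p =>
      map_chern_eq hET hsmooth p hu J (hβ p) hx⟩⟩
  -- A class modulo `2` equals its negative, so the signs are immaterial.
  · have hε : ∀ (e : ℤˣ) (y : Coh (ZMod 2) (OrbitSpace (Torus k) ET)), (e : ℤ) • y = y := by
      intro e y
      rcases Int.units_eq_one_or e with rfl | rfl
      · simp
      · rw [Units.val_neg, Units.val_one, neg_smul, one_smul]
        exact neg_eq_of_add_eq_zero_left (Coh.add_self_zmod_two y)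
    refine (map_sw_eq hET hsmooth p hu (hα p) hx).trans ?_
    simp only [hε]
  · obtain ⟨β, hβ, h⟩ := (hα p).exists_isComplexWeights J
    exact ⟨β, hβ, h, fun γ hγ => hβ.unique hγ⟩
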